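/- Let $p$ be a prime, let $L$ be a finite extension of $\mathbb{Q}_p$ and $K$ a finite extension of $L$, inside a fixed algebraic closure $\overline{\mathbb{Q}}_p$ with its absolute value $|\cdot|$. For $M\in\{L,K\}$ let $\mathcal{O}_M$ be the ring of integers of $M$, $\pi_M$ a uniformizer, $q_M=|\mathcal{O}_M/\pi_M\mathcal{O}_M|$, and let $f_M\in\mathcal{O}_M[[x]]$ be a series with $f_M(x)\equiv \pi_M x \bmod x^2$ and $f_M(x)\equiv x^{q_M} \bmod \pi_M$. Let $F_M(x,y)\in\mathcal{O}_M[[x,y]]$ be the Lubin–Tate formal group law of $f_M$, that is, the unique series with $F_M(x,y)\equiv x+y$ modulo degree $2$ and $f_M(F_M(x,y))=F_M(f_M(x),f_M(y))$. For $a\in\mathcal{O}_M$ let $[a]_M(x)\in\mathcal{O}_M[[x]]$ be its endomorphism attached to $a$, the unique series with $[a]_M(x)\equiv ax \bmod x^2$ that commutes with $f_M$ under composition. Write $u\oplus_M v=F_M(u,v)$. Let $\log_{F_L}\in L[[x]]$ be the logarithm of $F_L$ and $\exp_{F_L}$ its inverse under composition. Let $\mathfrak{F}_0$ be the set of all $z\in\overline{\mathbb{Q}}_p$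 with $|z|<1$ and $f_K(z)=0$. All compositions of power series below are taken as coefficientwise limits. Let $\alpha\in\mathcal{O}_L$, and exclude the case in which both $q_L=2$ and $\pi_L\mid\alpha$. Let $\mathscr{A}^\alpha_{L,K}$ be the set of all $r\in\mathcal{O}_K[[x]]$ with $|r(0)|<1$ such that $$\sum^{F_L}_{z\in\mathfrak{F}_0} r(x\oplus_K z)=[\alpha]_L\bigl(r([\pi_K]_K(x))\bigr),$$ where $\sum^{F_L}$ denotes summation with respect to $\oplus_L$, and let $\mathscr{A}^\alpha_{L,K,\pi_L}=\mathscr{A}^\alpha_{L,K}\cap\pi_L\mathcal{O}_K[[x]]$. Coleman's trace operator $\mathscr{L}_{F_K}$ is defined by $$\mathscr{L}_{F_K}(g)([\pi_K]_K(x))=\sum_{z\in\mathfrak{F}_0} g(x\oplus_K z)$$ for $g\in\mathcal{O}_K[[x]]$. Let $\mathscr{E}^\alpha_{L,K}=\{g\in\pi_L\mathcal{O}_K[[x]] : \mathscr{L}_{F_K}(g)=\alpha g\}$. Then $\mathscr{A}^\alpha_{L,K,\pi_L}$ is an $\mathcal{O}_L$-module under $(r,s)\mapsto r\oplus_L s$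 and $(a,r)\mapsto [a]_L(r)$, and $\mathscr{E}^\alpha_{L,K}$ is an $\mathcal{O}_L$-submodule of the power series under the usual operations. The map $r\mapsto\log_{F_L}(r(x))$ is a well-defined isomorphism of $\mathcal{O}_L$-modules $\mathscr{A}^\alpha_{L,K,\pi_L}\to\mathscr{E}^\alpha_{L,K}$, and its inverse is $g\mapsto\exp_{F_L}(g(x))$; the compositions with $\log_{F_L}$ and $\exp_{F_L}$ converge coefficientwise. -/

import Mathlib

noncomputable section

namespace LubinTate

/-! ### Formal (algebraic) Lubin-Tate theory over a commutative ring -/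

section Formal

variable {R : Type*} [CommRing R]

/-- `f` is a Lubin-Tate series for `π`: `f ≡ π X` modulo `X²` and `f ≡ X ^ q` modulo `π`, where
`q = |R / π R|`. -/
structure IsLubinTateSeries (π : R) (f : PowerSeries R) : Prop where
  constantCoeff_eq : PowerSeries.constantCoeff f = 0
  coeff_one_eq : PowerSeries.coeff 1 f = π
  dvd_sub : PowerSeries.C π ∣ f - PowerSeries.X ^ Nat.card (R ⧸ Ideal.span {π})

/-- `F(X, Y) ≡ X + Y` modulo degree `2`, and `f(F(X, Y)) = F(f(X), f(Y))`. -/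
structure IsGroupLawOf (f : PowerSeries R) (F : MvPowerSeries (Fin 2) R) : Prop where
  constantCoeff_eq : MvPowerSeries.constantCoeff F = 0
  coeff_X_eq : MvPowerSeries.coeff (Finsupp.single 0 1) F = 1
  coeff_Y_eq : MvPowerSeries.coeff (Finsupp.single 1 1) F = 1
  comm : f.subst F =
    F.subst (fun i : Fin 2 => f.subst (MvPowerSeries.X i : MvPowerSeries (Fin 2) R))

/-- The Lubin-Tate formal group law of the Lubin-Tate series `f`: the unique power series
`F(X, Y)` over `R` with `F ≡ X + Y` modulo degree `2` and `f(F(X, Y)) = F(f(X), f(Y))`. -/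
def groupLaw (f : PowerSeries R) : MvPowerSeries (Fin 2) R :=
  Classical.epsilon (IsGroupLawOf f)

/-- `g ≡ a X` modulo `X²`, and `f(g(X)) = g(f(X))`. -/
structure IsEndoOf (f : PowerSeries R) (a : R) (g : PowerSeries R) : Prop where
  constantCoeff_eq : PowerSeries.constantCoeff g = 0
  coeff_one_eq : PowerSeries.coeff 1 g = a
  comm : f.subst g = g.subst f

/-- The endomorphism `[a](X)` of the Lubin-Tate formal group law of `f`: the unique power series
over `R` with `[a] ≡ a X` modulo `X²` which commutes with `f`. -/
def endo (f : PowerSeries R) (a : R) : PowerSeries R :=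
  Classical.epsilon (IsEndoOf f a)

end Formal

/-! ### Logarithm and exponential of a formal group law over a field -/

section LogExp

variable {E : Type*} [Field E]

/-- The partial derivative of `F(X, Y)` with respect to `X`, at `X = 0`, as a series in `Y`. -/
def partialX (F : MvPowerSeries (Fin 2) E) : PowerSeries E :=
  PowerSeries.mk fun j =>
    MvPowerSeries.coeff (Finsupp.single (0 : Fin 2) 1 + Finsupp.single (1 : Fin 2) j) F

/-- The logarithm of a formal group law `F` over a field of characteristic zero: the integral,
without constant term, of the invariant differential `dT / (∂F/∂X)(0, T)`. -/
def logSeries (F : MvPowerSeries (Fin 2) E) : PowerSeries E :=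
  PowerSeries.mk fun n => PowerSeries.coeff (n - 1) (partialX F)⁻¹ / (n : E)

open Classical in
/-- The exponential of a formal group law `F`: the inverse of the logarithm under composition.
(The linear coefficient of the logarithm is `1`, so the first case always occurs.) -/
def expSeries (F : MvPowerSeries (Fin 2) E) : PowerSeries E :=
  if h : IsUnit (PowerSeries.coeff 1 (logSeries F)) then (logSeries F).substInvOfIsUnit h else 0

end LogExp

/-! ### Convergent composition of power series -/

section Convergent

variable {E : Type*} [NormedField E]

/-- The series `∑ₖ cₖ h(X) ^ k` converges coefficientwise. -/
def Composable (c h : PowerSeries E) : Prop :=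
  ∀ n : ℕ, Summable fun k : ℕ => PowerSeries.coeff k c * PowerSeries.coeff n (h ^ k)

/-- The composition `c(h(X)) = ∑ₖ cₖ h(X) ^ k` as a coefficientwise limit; the constant term of
`h` need not vanish. -/
def comp (c h : PowerSeries E) : PowerSeries E :=
  PowerSeries.mk fun n => ∑' k : ℕ, PowerSeries.coeff k c * PowerSeries.coeff n (h ^ k)

/-- `F(r(X), s(X))` as a coefficientwise limit: the formal sum of `r` and `s`. -/
def formalAdd (F : MvPowerSeries (Fin 2) E) (r s : PowerSeries E) : PowerSeries E :=
  PowerSeries.mk fun n => ∑' d : Fin 2 →₀ ℕ,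
    MvPowerSeries.coeff d F * PowerSeries.coeff n (r ^ d 0 * s ^ d 1)

/-- The formal sum `r₁ ⊕ (r₂ ⊕ (⋯ ⊕ 0))` of a list of power series. -/
def formalSum (F : MvPowerSeries (Fin 2) E) (l : List (PowerSeries E)) : PowerSeries E :=
  l.foldr (formalAdd F) 0

end Convergent

/-! ### Finite extensions of `ℚ_[p]` inside a fixed algebraic closure -/

section Padic

variable {p : ℕ} [Fact p.Prime]

/-- The ring of integers of an extension `M` of `ℚ_[p]` inside the algebraic closure: the elements
of `M` whose absolute value (the unique extension of the `p`-adic one) is at most `1`. -/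
def integers (M : IntermediateField ℚ_[p] (PadicAlgCl p)) : Subring (PadicAlgCl p) where
  carrier := {x | x ∈ M ∧ ‖x‖ ≤ 1}
  mul_mem' {a b} ha hb := ⟨M.mul_mem ha.1 hb.1, by
    rw [norm_mul]; exact mul_le_one₀ ha.2 (norm_nonneg b) hb.2⟩
  one_mem' := ⟨M.one_mem, by simp⟩
  add_mem' {a b} ha hb := ⟨M.add_mem ha.1 hb.1,
    (PadicAlgCl.isNonarchimedean p a b).trans (max_le ha.2 hb.2)⟩
  zero_mem' := ⟨M.zero_mem, by simp⟩
  neg_mem' {a} ha := ⟨M.neg_mem ha.1, by rw [norm_neg]; exact ha.2⟩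

variable {L K : IntermediateField ℚ_[p] (PadicAlgCl p)}

/-- A power series over the ring of integers of `M`, as a series over the algebraic closure. -/
def ofIntegers {M : IntermediateField ℚ_[p] (PadicAlgCl p)} (f : PowerSeries (integers M)) :
    PowerSeries (PadicAlgCl p) :=
  PowerSeries.map (integers M).subtype f

/-- The Lubin-Tate formal group law of `f`, over the algebraic closure. -/
def law (f : PowerSeries (integers L)) : MvPowerSeries (Fin 2) (PadicAlgCl p) :=
  MvPowerSeries.map (integers L).subtype (groupLaw f)

/-- The endomorphism `[a](X)` of the formal group law of `f`, over the algebraic closure. -/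
def mulBy (f : PowerSeries (integers L)) (a : integers L) : PowerSeries (PadicAlgCl p) :=
  ofIntegers (endo f a)

/-- The zeros of `f` in the maximal ideal of the integers of the algebraic closure. -/
def zeroSet (f : PowerSeries (integers K)) : Set (PadicAlgCl p) :=
  {z | ‖z‖ < 1 ∧ ∑' k : ℕ, ((PowerSeries.coeff k f : integers K) : PadicAlgCl p) * z ^ k = 0}

open Classical in
/-- The zeros of `f` in the maximal ideal, as a finite set (a Lubin-Tate series has exactly `q`
zeros there, so the first case always occurs for such a series). -/
def zeros (f : PowerSeries (integers K)) : Finset (PadicAlgCl p) :=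
  if h : (zeroSet f).Finite then h.toFinset else ∅

/-- The translate `r(X ⊕ z)`, for the formal group law of `f`. -/
def translate (f : PowerSeries (integers K)) (r : PowerSeries (PadicAlgCl p))
    (z : PadicAlgCl p) : PowerSeries (PadicAlgCl p) :=
  comp r (formalAdd (law f) PowerSeries.X (PowerSeries.C z))

/-- The module `𝒜^α_{L,K}`, as a set: the series `r` over the integers of `K` with `|r(0)| < 1` and
`⊕_z r(X ⊕_K z) = [α]_L(r([π_K]_K(X)))`. On the left the outer formal sum, for the formal group law
of `fL`, runs over all zeros `z` of `fK` (including `z = 0`). -/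
def normSeries (fL : PowerSeries (integers L)) (πK : integers K) (fK : PowerSeries (integers K))
    (α : integers L) : Set (PowerSeries (PadicAlgCl p)) :=
  {r | (∃ s : PowerSeries (integers K), r = ofIntegers s) ∧
    ‖PowerSeries.constantCoeff r‖ < 1 ∧
    formalSum (law fL) ((zeros fK).toList.map (translate fK r)) =
      comp (mulBy fL α) (r.subst (mulBy fK πK))}

/-- `π_L 𝒪_K[[X]]`, the series over the integers of `K` that are divisible by `π_L` there. -/
def divisibleSeries (K : IntermediateField ℚ_[p] (PadicAlgCl p)) (πL : integers L) :
    Set (PowerSeries (PadicAlgCl p)) :=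
  {r | ∃ s : PowerSeries (integers K), r = πL • ofIntegers s}

/-- The module `𝒜^α_{L,K,π_L}`, as a set: the members of `𝒜^α_{L,K}` that are divisible by `π_L`
in `𝒪_K[[X]]`. -/
def divisibleNormSeries (πL : integers L) (fL : PowerSeries (integers L)) (πK : integers K)
    (fK : PowerSeries (integers K)) (α : integers L) : Set (PowerSeries (PadicAlgCl p)) :=
  normSeries fL πK fK α ∩ divisibleSeries K πL

/-- Coleman's trace operator `𝓛`: `𝓛(g)` is the unique power series `t` with
`t([π_K]_K(X)) = ∑_z g(X ⊕_K z)`, the sum over the zeros `z` of `fK`. The series `[π_K]_K` is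
invertible under composition over a field, so `t` exists over the algebraic closure. -/
def colemanTrace (πK : integers K) (fK : PowerSeries (integers K))
    (g : PowerSeries (PadicAlgCl p)) : PowerSeries (PadicAlgCl p) :=
  Classical.epsilon fun t => t.subst (mulBy fK πK) = ∑ z ∈ zeros fK, translate fK g z

/-- The `α`-eigenspace `ℰ^α_{L,K}` of Coleman's trace operator on `π_L 𝒪_K[[X]]`, as a set. -/
def traceEigenspace (πL : integers L) (πK : integers K) (fK : PowerSeries (integers K))
    (α : integers L) : Set (PowerSeries (PadicAlgCl p)) :=
  {g | g ∈ divisibleSeries K πL ∧ colemanTrace πK fK g = α • g}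

end Padic

end LubinTate

end

/-! Put ϖ = |π_L|, q = q_L and θ = ϖ^(1/(q-1)). The logarithm of F_L and its inverse both have
coefficients with |c_n| θ^n ≤ θ (`boundedOn_logSeries`, `boundedOn_expSeries`). They are therefore
inverse to each other on arguments of size less than θ, where the logarithm carries ⊕_L to + and
[α]_L to multiplication by α. Composition with the logarithm on the left commutes with the
substitutions x ↦ x ⊕_K z and x ↦ [π_K]_K(x) on the right, by associativity of convergent
composition (`mvComp_mvComp`). So for small r the logarithm turns the formal-sum equation into the
trace equation for log r, and its injectivity gives the converse (`formalSum_translate_eq_iff`).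

It remains to see that the series in question are small enough. Compositions are coefficientwise
limits, so it suffices that all coefficients are at most ϖ and that |r(0)| < θ: at a radius t < 1
each nonconstant term gains a factor t (`BoundedOn.shrink`, `InDomain`). If q > 2 then ϖ < θ and
nothing is needed. If q = 2 then ϖ = θ, and the excluded case forces α to be a unit. Compare
constant terms modulo elements of size less than ϖ: there F_L is addition, translation does not
change r(0), and there are q_K translates with π_K dividing q_K, so the left side vanishes while the
right side is α r(0). Hence |r(0)| < ϖ. The trace equation gives the same for its solutions.

The formal theory rests on the series Λ = X + ⋯ over the field with Λ(f) = πΛ. With e its inverse,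
e(∑ aᵢ Λ(Xᵢ)) commutes with f; it is integral because f(ψ) ≡ ψ(f) modulo π
(`coeff_mem_range_of_subst_comm`); and a series commuting with f is determined by its linear part
(`log_subst_eq_logCombination`). This provides the group law and the endomorphisms, and identifies Λ
with the integral of the invariant differential (`logSeries_eq`). The number of zeros of f comes
from Weierstrass preparation and f' = π · unit (`card_zeros`).

The algebraic closure of ℚ_p is not complete. All limits are taken in a complete subring S, in the
end a finite extension N of K that contains the zeros of f_K. -/

noncomputable section

namespace LubinTate

open Filter Topology

/-! ### Gauss norms and convergent composition in several variables. -/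

section BoundedSeries

variable {E : Type*} [NormedField E] {σ τ υ : Type*}

/-- The coefficients of `u` lie in `S`, and the Gauss norm of `u` of radius `t` is at most `C`. -/
structure BoundedOn (S : Subring E) (t C : ℝ) (u : MvPowerSeries τ E) : Prop where
  coeff_mem : ∀ n, MvPowerSeries.coeff n u ∈ S
  norm_le : ∀ n : τ →₀ ℕ, ‖MvPowerSeries.coeff n u‖ * t ^ n.degree ≤ C

namespace BoundedOn

variable {S : Subring E} {t C C₁ C₂ : ℝ} {u v : MvPowerSeries τ E}

lemma nonneg (hu : BoundedOn S t C u) : 0 ≤ C := by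
  have := hu.norm_le 0
  simp only [map_zero, pow_zero, mul_one] at this
  exact (norm_nonneg _).trans this

lemma mono (hu : BoundedOn S t C₁ u) (h : C₁ ≤ C₂) : BoundedOn S t C₂ u :=
  ⟨hu.coeff_mem, fun n => (hu.norm_le n).trans h⟩

lemma mono_subring {S' : Subring E} (hu : BoundedOn S t C u) (h : S ≤ S') : BoundedOn S' t C u :=
  ⟨fun n => h (hu.coeff_mem n), hu.norm_le⟩

lemma norm_coeff_le (hu : BoundedOn S 1 C u) (n : τ →₀ ℕ) : ‖MvPowerSeries.coeff n u‖ ≤ C := by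
  simpa using hu.norm_le n

lemma norm_constantCoeff_le (hu : BoundedOn S t C u) :
    ‖MvPowerSeries.constantCoeff u‖ ≤ C := by
  simpa using hu.norm_le 0

lemma norm_coeff_le_div (ht : 0 < t) (hu : BoundedOn S t C u) (n : τ →₀ ℕ) :
    ‖MvPowerSeries.coeff n u‖ ≤ C / t ^ n.degree := by
  rw [le_div_iff₀ (by positivity)]
  exact hu.norm_le n

lemma zero (hC : 0 ≤ C) : BoundedOn S t C (0 : MvPowerSeries τ E) :=
  ⟨fun n => by simp [S.zero_mem], fun n => by simpa using hC⟩

lemma one : BoundedOn S t 1 (1 : MvPowerSeries τ E) := by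
  classical
  constructor
  · intro n
    rw [MvPowerSeries.coeff_one]
    split_ifs
    exacts [S.one_mem, S.zero_mem]
  · intro n
    rw [MvPowerSeries.coeff_one]
    split_ifs with h
    · simp [h]
    · simp

lemma neg (hu : BoundedOn S t C u) : BoundedOn S t C (-u) :=
  ⟨fun n => by simpa using S.neg_mem (hu.coeff_mem n), fun n => by simpa using hu.norm_le n⟩

variable [IsUltrametricDist E]

lemma add (ht : 0 ≤ t) (hu : BoundedOn S t C u) (hv : BoundedOn S t C v) :
    BoundedOn S t C (u + v) := by
  refine ⟨fun n => by simpa using S.add_mem (hu.coeff_mem n) (hv.coeff_mem n), fun n => ?_⟩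
  have hp : 0 ≤ t ^ n.degree := by positivity
  calc _ ≤ max ‖MvPowerSeries.coeff n u‖ ‖MvPowerSeries.coeff n v‖ * t ^ n.degree := by
        rw [map_add]
        gcongr
        exact IsUltrametricDist.norm_add_le_max _ _
    _ ≤ C := by
        rw [max_mul_of_nonneg _ _ hp]
        exact max_le (hu.norm_le n) (hv.norm_le n)

lemma sub (ht : 0 ≤ t) (hu : BoundedOn S t C u) (hv : BoundedOn S t C v) :
    BoundedOn S t C (u - v) := by
  rw [sub_eq_add_neg]
  exact hu.add ht hv.neg

lemma mul (ht : 0 ≤ t) (hu : BoundedOn S t C₁ u) (hv : BoundedOn S t C₂ v) :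
    BoundedOn S t (C₁ * C₂) (u * v) := by
  classical
  have h1 := hu.nonneg
  have h2 := hv.nonneg
  constructor
  · intro n
    rw [MvPowerSeries.coeff_mul]
    exact S.sum_mem fun x _ => S.mul_mem (hu.coeff_mem _) (hv.coeff_mem _)
  · intro n
    rw [MvPowerSeries.coeff_mul]
    rcases ht.eq_or_lt with rfl | ht'
    · rcases eq_or_ne n 0 with rfl | hn0
      · have h3 := hu.norm_constantCoeff_le
        have h4 := hv.norm_constantCoeff_le
        rw [← MvPowerSeries.coeff_mul, MvPowerSeries.coeff_zero_eq_constantCoeff_apply, map_mul,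
          norm_mul, map_zero, pow_zero, mul_one]
        gcongr
      · have : n.degree ≠ 0 := by rwa [Ne, Finsupp.degree_eq_zero_iff]
        rw [zero_pow this, mul_zero]
        positivity
    · rw [← le_div_iff₀ (by positivity)]
      refine IsUltrametricDist.norm_sum_le_of_forall_le_of_nonneg (by positivity) fun x hx => ?_
      rw [Finset.HasAntidiagonal.mem_antidiagonal] at hx
      rw [norm_mul, le_div_iff₀ (by positivity), ← hx, map_add, pow_add]
      calc _ = (‖MvPowerSeries.coeff x.1 u‖ * t ^ x.1.degree) *
            (‖MvPowerSeries.coeff x.2 v‖ * t ^ x.2.degree) := by ring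
        _ ≤ C₁ * C₂ := mul_le_mul (hu.norm_le _) (hv.norm_le _) (by positivity) h1

lemma pow (ht : 0 ≤ t) (hu : BoundedOn S t C u) (n : ℕ) : BoundedOn S t (C ^ n) (u ^ n) := by
  induction n with
  | zero => simpa using one
  | succ n ih => rw [pow_succ, pow_succ]; exact ih.mul ht hu

lemma prod_pow (ht : 0 ≤ t) {r : σ → MvPowerSeries τ E} (hr : ∀ i, BoundedOn S t C (r i))
    (d : σ →₀ ℕ) : BoundedOn S t (C ^ d.degree) (d.prod fun i e => r i ^ e) := by
  classical
  induction d using Finsupp.induction with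
  | zero => simpa using one
  | single_add a b f ha hb ih =>
    rw [Finsupp.prod_add_index' (by simp) (by intros; rw [pow_add]),
      Finsupp.prod_single_index (by simp), map_add, Finsupp.degree_single, pow_add]
    exact ((hr a).pow ht b).mul ht ih

end BoundedOn

/-- The composition `G(r)` of power series in several variables as a coefficientwise limit. -/
def mvComp (G : MvPowerSeries σ E) (r : σ → MvPowerSeries τ E) : MvPowerSeries τ E := fun m =>
  ∑' d : σ →₀ ℕ, MvPowerSeries.coeff d G * MvPowerSeries.coeff m (d.prod fun i e => r i ^ e)

lemma coeff_mvComp (G : MvPowerSeries σ E) (r : σ → MvPowerSeries τ E) (m : τ →₀ ℕ) :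
    MvPowerSeries.coeff m (mvComp G r) = ∑' d : σ →₀ ℕ, MvPowerSeries.coeff d G *
      MvPowerSeries.coeff m (d.prod fun i e => r i ^ e) := rfl

lemma mvComp_smul (a : E) (G : MvPowerSeries σ E) (r : σ → MvPowerSeries τ E) :
    mvComp (a • G) r = a • mvComp G r := by
  ext m
  rw [MvPowerSeries.coeff_smul, coeff_mvComp, coeff_mvComp, ← tsum_mul_left]
  simp only [MvPowerSeries.coeff_smul, mul_assoc]

lemma mvComp_monomial (d : σ →₀ ℕ) (a : E) (r : σ → MvPowerSeries τ E) :
    mvComp (MvPowerSeries.monomial d a) r = a • d.prod fun i e => r i ^ e := by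
  classical
  ext m
  rw [coeff_mvComp, MvPowerSeries.coeff_smul, tsum_eq_single d]
  · rw [MvPowerSeries.coeff_monomial_same]
  · intro d' hd'
    rw [MvPowerSeries.coeff_monomial_ne hd', zero_mul]

lemma mvComp_one (r : σ → MvPowerSeries τ E) : mvComp 1 r = 1 := by
  have := mvComp_monomial 0 1 r
  rw [MvPowerSeries.monomial_zero_one] at this
  simpa using this

lemma mvComp_X (i : σ) (r : σ → MvPowerSeries τ E) : mvComp (MvPowerSeries.X i) r = r i := by
  rw [MvPowerSeries.X_def, mvComp_monomial]
  simp

lemma mvComp_eq_subst {G : MvPowerSeries σ E} {r : σ → MvPowerSeries τ E} (hr : MvPowerSeries.HasSubst r) : mvComp G r = G.subst r := by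
  ext m
  rw [coeff_mvComp, MvPowerSeries.coeff_subst hr]
  simp only [smul_eq_mul]
  refine tsum_eq_finsum ?_
  simpa only [smul_eq_mul] using MvPowerSeries.coeff_subst_finite hr G m

/-- A divergent sum has the default value 0, which lies in `S`, so no summability is needed here or
in the bounds built on it. -/
lemma tsum_mem_of_isClosed {ι : Type*} {S : Subring E} (hS : IsComplete (S : Set E))
    {f : ι → E} (hfS : ∀ i, f i ∈ S) : ∑' i, f i ∈ S := by
  by_cases h : Summable f
  · exact hS.isClosed.mem_of_tendsto h.hasSum (Eventually.of_forall fun s => S.sum_mem fun i _ => hfS i)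
  · rw [tsum_eq_zero_of_not_summable h]
    exact S.zero_mem

variable [IsUltrametricDist E]

/-- In a complete ultrametric group it is enough that the terms tend to 0 along the cofinite filter.
Only `S` is complete, so the sum is formed there and then mapped to `E`. -/
lemma summable_of_norm_le_pow {ι : Type*} {S : Subring E} (hS : IsComplete (S : Set E))
    (w : ι → ℕ) (hw : ∀ n, {i | w i ≤ n}.Finite) {f : ι → E} (hfS : ∀ i, f i ∈ S) {B κ : ℝ}
    (hκ₀ : 0 ≤ κ) (hκ : κ < 1) (hf : ∀ i, ‖f i‖ ≤ B * κ ^ w i) : Summable f := by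
  have : CompleteSpace S := hS.completeSpace_coe
  let g : ι → S := fun i => ⟨f i, hfS i⟩
  have hwt : Tendsto w cofinite atTop := by
    refine tendsto_atTop.2 fun n => ?_
    rw [eventually_cofinite]
    refine (hw n).subset fun i hi => ?_
    simp only [Set.mem_ofPred_eq, not_le] at hi ⊢
    exact hi.le
  have h0 : Tendsto g cofinite (𝓝 0) := by
    rw [tendsto_zero_iff_norm_tendsto_zero]
    refine squeeze_zero (fun _ => norm_nonneg _) (fun i => hf i) ?_
    have := ((tendsto_pow_atTop_nhds_zero_of_lt_one hκ₀ hκ).comp hwt).const_mul B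
    simpa using this
  have : IsUltrametricDist S := ⟨fun x y z => IsUltrametricDist.dist_triangle_max (x : E) y z⟩
  have hg : Summable g := NonarchimedeanAddGroup.summable_of_tendsto_cofinite_zero h0
  exact hg.map S.subtype continuous_subtype_val

variable {S : Subring E} {t ρ ρ' C : ℝ} {G G' : MvPowerSeries σ E} {r : σ → MvPowerSeries τ E}

/-- The ultrametric inequality bounds a sum by its terms. The radius for `G` equals the bound on
`r`, with no gap: convergence may fail, but the bound survives. -/
lemma BoundedOn.mvComp (hS : IsComplete (S : Set E)) (ht : 0 < t) (hG : BoundedOn S ρ C G)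
    (hr : ∀ i, BoundedOn S t ρ (r i)) : BoundedOn S t C (mvComp G r) := by
  have hC := hG.nonneg
  refine ⟨fun m => ?_, fun m => ?_⟩
  · exact tsum_mem_of_isClosed hS fun d =>
      S.mul_mem (hG.coeff_mem d) ((BoundedOn.prod_pow ht.le hr d).coeff_mem m)
  · rw [← le_div_iff₀ (by positivity), coeff_mvComp]
    refine IsUltrametricDist.norm_tsum_le_of_forall_le_of_nonneg (by positivity) fun d => ?_
    rw [norm_mul, le_div_iff₀ (by positivity), mul_assoc]
    exact (mul_le_mul_of_nonneg_left ((BoundedOn.prod_pow ht.le hr d).norm_le m)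
      (norm_nonneg _)).trans (hG.norm_le d)

lemma norm_coeff_mul_coeff_le (ht : 0 < t) (hρ : 0 < ρ')
    (hG : BoundedOn S ρ' C G) (hr : ∀ i, BoundedOn S t ρ (r i)) (m : τ →₀ ℕ) (d : σ →₀ ℕ) :
    ‖MvPowerSeries.coeff d G * MvPowerSeries.coeff m (d.prod fun i e => r i ^ e)‖ ≤
      C / t ^ m.degree * (ρ / ρ') ^ d.degree := by
  have h1 := hG.norm_coeff_le_div hρ d
  have h2 := (BoundedOn.prod_pow ht.le hr d).norm_coeff_le_div ht m
  have hC := hG.nonneg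
  rw [norm_mul]
  calc _ ≤ C / ρ' ^ d.degree * (ρ ^ d.degree / t ^ m.degree) := by gcongr
    _ = _ := by rw [div_pow]; ring

/-- The gap ρ < ρ' makes the terms decay like (ρ/ρ')^deg, and only finitely many exponents have a
given degree. -/
lemma summable_mvComp [Finite σ] (hS : IsComplete (S : Set E)) (ht : 0 < t) (hρ₀ : 0 ≤ ρ)
    (hρ : ρ < ρ') (hG : BoundedOn S ρ' C G) (hr : ∀ i, BoundedOn S t ρ (r i)) (m : τ →₀ ℕ) :
    Summable fun d : σ →₀ ℕ => MvPowerSeries.coeff d G *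
      MvPowerSeries.coeff m (d.prod fun i e => r i ^ e) := by
  have hρ' : 0 < ρ' := hρ₀.trans_lt hρ
  refine summable_of_norm_le_pow hS Finsupp.degree Finsupp.finite_of_degree_le
    (fun d => S.mul_mem (hG.coeff_mem d) ((BoundedOn.prod_pow ht.le hr d).coeff_mem m))
    (div_nonneg hρ₀ hρ'.le) ((div_lt_one hρ').2 hρ)
    (norm_coeff_mul_coeff_le ht hρ' hG hr m)

lemma mvComp_add [Finite σ] (hS : IsComplete (S : Set E)) (ht : 0 < t) (hρ₀ : 0 ≤ ρ)
    (hρ : ρ < ρ') (hG : BoundedOn S ρ' C G) (hG' : BoundedOn S ρ' C G')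
    (hr : ∀ i, BoundedOn S t ρ (r i)) : mvComp (G + G') r = mvComp G r + mvComp G' r := by
  ext m
  rw [map_add, coeff_mvComp, coeff_mvComp, coeff_mvComp,
    ← (summable_mvComp hS ht hρ₀ hρ hG hr m).tsum_add (summable_mvComp hS ht hρ₀ hρ hG' hr m)]
  simp only [map_add, add_mul]

lemma nonarchimedeanRing_of_isUltrametricDist : NonarchimedeanRing E where
  is_nonarchimedean := NonarchimedeanAddGroup.is_nonarchimedean

/-- Summable families can be multiplied termwise in a nonarchimedean ring; regrouping the pairs of
exponents by their sum gives the Cauchy product. -/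
lemma mvComp_mul [Finite σ] (hS : IsComplete (S : Set E)) (ht : 0 < t) (hρ₀ : 0 ≤ ρ)
    (hρ : ρ < ρ') {C' : ℝ} (hG : BoundedOn S ρ' C G) (hG' : BoundedOn S ρ' C' G')
    (hr : ∀ i, BoundedOn S t ρ (r i)) : mvComp (G * G') r = mvComp G r * mvComp G' r := by
  classical
  have := nonarchimedeanRing_of_isUltrametricDist (E := E)
  have hsum := fun m => (summable_mvComp hS ht hρ₀ hρ hG hr m).hasSum
  have hsum' := fun m => (summable_mvComp hS ht hρ₀ hρ hG' hr m).hasSum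
  ext m
  rw [MvPowerSeries.coeff_mul, coeff_mvComp]
  have key : HasSum (fun x : (σ →₀ ℕ) × (σ →₀ ℕ) =>
      MvPowerSeries.coeff x.1 G * MvPowerSeries.coeff x.2 G' *
        MvPowerSeries.coeff m ((x.1 + x.2).prod fun i e => r i ^ e))
      (∑ p ∈ Finset.HasAntidiagonal.antidiagonal m, MvPowerSeries.coeff p.1 (mvComp G r) *
        MvPowerSeries.coeff p.2 (mvComp G' r)) := by
    have := hasSum_sum (s := Finset.HasAntidiagonal.antidiagonal m) fun p _ =>
      (hsum p.1).mul_of_nonarchimedean (hsum' p.2)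
    refine this.congr_fun ?_
    intro x
    rw [Finsupp.prod_add_index' (by simp) (by intros; rw [pow_add]), MvPowerSeries.coeff_mul,
      Finset.mul_sum]
    exact Finset.sum_congr rfl fun p _ => by ring
  rw [← Finset.HasAntidiagonal.sigmaAntidiagonalEquivProd.hasSum_iff] at key
  have := key.sigma (fun d => hasSum_fintype _)
  rw [← this.tsum_eq]
  refine tsum_congr fun d => ?_
  rw [MvPowerSeries.coeff_mul, Finset.sum_mul, ← Finset.sum_coe_sort]
  refine Finset.sum_congr rfl fun x _ => ?_
  have hx := Finset.HasAntidiagonal.mem_antidiagonal.1 x.2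
  simp only [Function.comp_apply, Finset.HasAntidiagonal.sigmaAntidiagonalEquivProd_apply, hx]

lemma mvComp_pow [Finite σ] (hS : IsComplete (S : Set E)) (ht : 0 < t) (hρ₀ : 0 ≤ ρ)
    (hρ : ρ < ρ') (hG : BoundedOn S ρ' C G) (hr : ∀ i, BoundedOn S t ρ (r i)) (n : ℕ) :
    mvComp (G ^ n) r = mvComp G r ^ n := by
  induction n with
  | zero => simp [mvComp_one]
  | succ n ih =>
    rw [pow_succ, pow_succ, mvComp_mul hS ht hρ₀ hρ (hG.pow (hρ₀.trans hρ.le) n) hG hr, ih]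

lemma mvComp_prod_pow [Finite τ] (hS : IsComplete (S : Set E)) (ht : 0 < t) (hρ₀ : 0 ≤ ρ)
    (hρ : ρ < ρ') {H : σ → MvPowerSeries τ E} {s : τ → MvPowerSeries υ E}
    (hH : ∀ i, BoundedOn S ρ' C (H i)) (hs : ∀ i, BoundedOn S t ρ (s i)) (d : σ →₀ ℕ) :
    mvComp (d.prod fun i e => H i ^ e) s = d.prod fun i e => mvComp (H i) s ^ e := by
  classical
  induction d using Finsupp.induction with
  | zero => simp [mvComp_one]
  | single_add a b f ha hb ih =>
    rw [Finsupp.prod_add_index' (by simp) (by intros; rw [pow_add]),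
      Finsupp.prod_single_index (by simp),
      Finsupp.prod_add_index' (by simp) (by intros; rw [pow_add]),
      Finsupp.prod_single_index (by simp),
      mvComp_mul hS ht hρ₀ hρ ((hH a).pow (hρ₀.trans hρ.le) b)
        (BoundedOn.prod_pow (hρ₀.trans hρ.le) hH f) hs, ih,
      mvComp_pow hS ht hρ₀ hρ (hH a) hs]

/-- Associativity of convergent composition. -/
lemma mvComp_mvComp [Finite σ] [Finite τ] (hS : IsComplete (S : Set E)) {a a' b b' : ℝ}
    (ht : 0 < t) (ha₀ : 0 ≤ a) (ha : a < a') (hb : b < b')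
    {H : σ → MvPowerSeries τ E} {s : τ → MvPowerSeries υ E}
    (hG : BoundedOn S b' C G) (hH : ∀ i, BoundedOn S a' b (H i))
    (hb₀ : 0 ≤ b) (hs : ∀ i, BoundedOn S t a (s i)) :
    mvComp (mvComp G H) s = mvComp G fun i => mvComp (H i) s := by
  have ha' : 0 < a' := ha₀.trans_lt ha
  have hb' : 0 < b' := hb₀.trans_lt hb
  ext m
  rw [coeff_mvComp, coeff_mvComp]
  let T : (τ →₀ ℕ) → (σ →₀ ℕ) → E := fun e d => MvPowerSeries.coeff d G *
    MvPowerSeries.coeff e (d.prod fun i k => H i ^ k) *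
      MvPowerSeries.coeff m (e.prod fun i k => s i ^ k)
  -- The two gaps a < a' and b < b' give geometric decay in both indices; κ is the worse ratio.
  -- Summability of the double family justifies exchanging the sums.
  have hT : Summable (Function.uncurry T) := by
    set κ := max (a / a') (b / b') with hκ
    have hκ₀ : 0 ≤ κ := le_max_of_le_left (by positivity)
    refine summable_of_norm_le_pow hS (fun x => x.1.degree + x.2.degree) (fun n => ?_)
      (fun x => ?_) (B := C / t ^ m.degree) (κ := κ) hκ₀
      (max_lt ((div_lt_one ha').2 ha) ((div_lt_one hb').2 hb)) (fun x => ?_)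
    · refine ((Finsupp.finite_of_degree_le n).prod (Finsupp.finite_of_degree_le n)).subset ?_
      rintro ⟨x, y⟩ h
      simp only [Set.mem_ofPred_eq, Set.mem_prod] at h ⊢
      omega
    · exact S.mul_mem (S.mul_mem (hG.coeff_mem _)
        ((BoundedOn.prod_pow ha'.le hH x.2).coeff_mem _))
        ((BoundedOn.prod_pow ht.le hs x.1).coeff_mem m)
    · have h1 := hG.norm_coeff_le_div hb' x.2
      have h2 := norm_coeff_mul_coeff_le ht ha' (BoundedOn.prod_pow ha'.le hH x.2) hs m x.1
      have hC := hG.nonneg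
      simp only [Function.uncurry, T]
      rw [mul_assoc, norm_mul]
      calc _ ≤ C / b' ^ x.2.degree *
            (b ^ x.2.degree / t ^ m.degree * (a / a') ^ x.1.degree) := by gcongr
        _ = C / t ^ m.degree * ((a / a') ^ x.1.degree * (b / b') ^ x.2.degree) := by
            rw [div_pow b]; ring
        _ ≤ C / t ^ m.degree * (κ ^ x.1.degree * κ ^ x.2.degree) := by
            gcongr
            exacts [le_max_left _ _, le_max_right _ _]
        _ = _ := by rw [pow_add]
  calc _ = ∑' e, ∑' d, T e d := by
        refine tsum_congr fun e => ?_
        rw [coeff_mvComp, ← tsum_mul_right]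
    _ = ∑' d, ∑' e, T e d := by
        refine (hT.tsum_comm' (fun e => ?_) fun d => ?_).symm
        · exact (summable_mvComp hS ha' hb₀ hb hG hH e).mul_right _
        · simp only [T, mul_assoc]
          exact (summable_mvComp hS ht ha₀ ha (BoundedOn.prod_pow ha'.le hH d) hs m).mul_left _
    _ = _ := by
        refine tsum_congr fun d => ?_
        rw [← mvComp_prod_pow hS ht ha₀ ha hH hs d, coeff_mvComp, ← tsum_mul_left]
        exact tsum_congr fun e => by simp only [T]; ring

end BoundedSeries

/-! ### Composition in one variable and the domain of the logarithm. -/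

section OneVariable

variable {E : Type*} [NormedField E]

lemma boundedOn_powerSeries_iff {S : Subring E} {t C : ℝ} {u : PowerSeries E} :
    BoundedOn S t C u ↔
      (∀ n : ℕ, PowerSeries.coeff n u ∈ S) ∧ ∀ n : ℕ, ‖PowerSeries.coeff n u‖ * t ^ n ≤ C := by
  constructor
  · intro h
    refine ⟨fun n => h.coeff_mem _, fun n => ?_⟩
    simpa [PowerSeries.coeff] using h.norm_le (Finsupp.single () n)
  · rintro ⟨h1, h2⟩
    have key : ∀ n : Unit →₀ ℕ, n = Finsupp.single () (n ()) := fun n => by ext; simp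
    refine ⟨fun n => ?_, fun n => ?_⟩
    · rw [key n]; exact h1 _
    · have := h2 (n ())
      rw [PowerSeries.coeff, ← key n] at this
      rw [key n] at this ⊢
      simpa using this

lemma comp_eq_mvComp (c h : PowerSeries E) :
    comp c h = mvComp (σ := Unit) (τ := Unit) c (fun _ => h) := by
  ext n
  rw [comp, PowerSeries.coeff_mk]
  change _ = MvPowerSeries.coeff (Finsupp.single () n) (mvComp (σ := Unit) (τ := Unit) c _)
  rw [coeff_mvComp, ← (Finsupp.uniqueLinearEquiv ℕ ℕ ()).symm.toEquiv.tsum_eq]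
  refine tsum_congr fun k => ?_
  simp [PowerSeries.coeff]

lemma composable_iff_summable_mvComp (c h : PowerSeries E) :
    Composable c h ↔ ∀ n : ℕ, Summable fun d : Unit →₀ ℕ => MvPowerSeries.coeff d c *
      MvPowerSeries.coeff (Finsupp.single () n) (d.prod fun _ e => (h : PowerSeries E) ^ e) := by
  refine forall_congr' fun n => ?_
  rw [← (Finsupp.uniqueLinearEquiv ℕ ℕ ()).symm.toEquiv.summable_iff]
  refine summable_congr fun k => ?_
  simp [PowerSeries.coeff]

lemma formalAdd_eq_mvComp (F : MvPowerSeries (Fin 2) E) (r s : PowerSeries E) :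
    formalAdd F r s = mvComp (τ := Unit) F ![r, s] := by
  ext n
  rw [formalAdd, PowerSeries.coeff_mk]
  change _ = MvPowerSeries.coeff (Finsupp.single () n) (mvComp (τ := Unit) F _)
  rw [coeff_mvComp]
  refine tsum_congr fun d => ?_
  rw [Finsupp.prod_fintype _ _ (by simp), Fin.prod_univ_two]
  rfl

lemma hasSubst_of_constantCoeff_eq_zero {u : PowerSeries E}
    (hu : PowerSeries.constantCoeff u = 0) : PowerSeries.HasSubst u :=
  PowerSeries.HasSubst.of_constantCoeff_zero' hu

lemma comp_eq_subst {c h : PowerSeries E} (hh : PowerSeries.constantCoeff h = 0) :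
    comp c h = c.subst h := by
  rw [comp_eq_mvComp, mvComp_eq_subst (hasSubst_of_constantCoeff_eq_zero hh).const]
  rfl

lemma comp_smul (a : E) (c h : PowerSeries E) : comp (a • c) h = a • comp c h := by
  simp only [comp_eq_mvComp]
  exact mvComp_smul a c _

lemma comp_X (h : PowerSeries E) : comp PowerSeries.X h = h := by
  rw [comp_eq_mvComp]
  exact mvComp_X () _

variable {S : Subring E} {t ρ ρ' C : ℝ}

/-- Without a constant term the bound says ‖c_n‖ θ^(n-1) ≤ 1 for n ≥ 1, which persists at smaller
radii: the series maps every smaller disc to itself. -/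
lemma BoundedOn.self_of_le {τ : Type*} {θ : ℝ} {u : MvPowerSeries τ E} (hθ : 0 < θ)
    (hu : BoundedOn S θ θ u) (hu₀ : MvPowerSeries.constantCoeff u = 0) (hρ₀ : 0 ≤ ρ)
    (hρ : ρ ≤ θ) : BoundedOn S ρ ρ u := by
  refine ⟨hu.coeff_mem, fun n => ?_⟩
  rcases eq_or_ne n 0 with rfl | hn
  · simpa [hu₀] using hρ₀
  obtain ⟨k, hk⟩ : ∃ k, n.degree = k + 1 :=
    Nat.exists_eq_succ_of_ne_zero (by rwa [Ne, Finsupp.degree_eq_zero_iff])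
  have h := hu.norm_le n
  rw [hk, pow_succ, ← mul_assoc] at h
  have h1 : ‖MvPowerSeries.coeff n u‖ * θ ^ k ≤ 1 := by
    by_contra! h2
    have := mul_lt_mul_of_pos_right h2 hθ
    linarith
  rw [hk, pow_succ, ← mul_assoc]
  calc _ ≤ ‖MvPowerSeries.coeff n u‖ * θ ^ k * ρ := by gcongr
    _ ≤ 1 * ρ := by gcongr
    _ = ρ := one_mul ρ

/-- Terms of positive degree gain a factor `t`. This rescues the borderline case ϖ = θ, leaving a
condition on the constant term only. -/
lemma BoundedOn.shrink {τ : Type*} {ϖ : ℝ} {u : MvPowerSeries τ E} (hu : BoundedOn S 1 ϖ u)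
    (ht₀ : 0 ≤ t) (ht : t ≤ 1) :
    BoundedOn S t (max ‖MvPowerSeries.constantCoeff u‖ (ϖ * t)) u := by
  refine ⟨hu.coeff_mem, fun n => ?_⟩
  rcases eq_or_ne n 0 with rfl | hn
  · simp
  obtain ⟨k, hk⟩ : ∃ k, n.degree = k + 1 :=
    Nat.exists_eq_succ_of_ne_zero (by rwa [Ne, Finsupp.degree_eq_zero_iff])
  refine le_max_of_le_right ?_
  have h := hu.norm_coeff_le n
  have := hu.nonneg
  calc _ ≤ ϖ * t ^ n.degree := by gcongr
    _ ≤ ϖ * t := by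
      gcongr
      rw [hk]
      exact pow_le_of_le_one ht₀ ht (by simp)

lemma BoundedOn.X {τ : Type*} (i : τ) (ht : 0 ≤ t) :
    BoundedOn S t t (MvPowerSeries.X i : MvPowerSeries τ E) := by
  classical
  constructor
  · intro n
    rw [MvPowerSeries.coeff_X]
    split_ifs
    exacts [S.one_mem, S.zero_mem]
  · intro n
    rw [MvPowerSeries.coeff_X]
    split_ifs with h
    · simp [h]
    · simpa using ht

/-- The domain on which the logarithm and the exponential of a formal group law are inverse to
each other: coefficients of absolute value at most `ϖ` and constant term of absolute value less
than `θ`. -/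
structure InDomain (S : Subring E) (ϖ θ : ℝ) (u : PowerSeries E) : Prop where
  bounded : BoundedOn S 1 ϖ u
  norm_constantCoeff_lt : ‖PowerSeries.constantCoeff u‖ < θ

variable {ϖ θ : ℝ} {u v b c h : PowerSeries E}

lemma InDomain.of_boundedOn (hu : BoundedOn S 1 ϖ u) (hu' : BoundedOn S t ρ u) (hρ : ρ < θ) :
    InDomain S ϖ θ u :=
  ⟨hu, hu'.norm_constantCoeff_le.trans_lt hρ⟩

lemma InDomain.zero (hϖ : 0 < ϖ) (hϖθ : ϖ ≤ θ) : InDomain S ϖ θ (0 : PowerSeries E) :=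
  ⟨BoundedOn.zero hϖ.le, by simpa using hϖ.trans_le hϖθ⟩

lemma comp_zero_right (hc₀ : PowerSeries.constantCoeff c = 0) : comp c 0 = 0 := by
  rw [comp_eq_subst (by simp), PowerSeries.subst_zero_of_constantCoeff_zero hc₀]

lemma InDomain.exists_boundedOn (hu : InDomain S ϖ θ u) (hϖ : 0 < ϖ) (hϖθ : ϖ ≤ θ)
    (ht₀ : 0 ≤ t) (ht : t < 1) : ∃ ρ, 0 ≤ ρ ∧ ρ < θ ∧ BoundedOn S t ρ u := by
  refine ⟨_, ?_, ?_, hu.bounded.shrink ht₀ ht.le⟩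
  · exact le_max_of_le_left (norm_nonneg _)
  · refine max_lt hu.norm_constantCoeff_lt (lt_of_lt_of_le ?_ hϖθ)
    nlinarith

variable [IsUltrametricDist E]

lemma InDomain.composable (hS : IsComplete (S : Set E)) (hϖ : 0 < ϖ) (hϖθ : ϖ ≤ θ)
    (hc : BoundedOn S θ θ c) (hu : InDomain S ϖ θ u) : Composable c u := by
  obtain ⟨ρ, hρ₀, hρ, hb⟩ := hu.exists_boundedOn hϖ hϖθ (t := 1 / 2) (by norm_num) (by norm_num)
  rw [composable_iff_summable_mvComp]
  exact fun n => summable_mvComp hS (by norm_num) hρ₀ hρ hc (fun _ => hb) _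

/-- Two radii are used. Radius 1 controls all coefficients, where only ϖ ≤ θ is known; radius 1/2,
an arbitrary choice below 1, gives the strict bound on the constant term. -/
lemma InDomain.comp (hS : IsComplete (S : Set E)) (hϖ : 0 < ϖ) (hϖθ : ϖ ≤ θ)
    (hc : BoundedOn S θ θ c) (hc₀ : PowerSeries.constantCoeff c = 0) (hu : InDomain S ϖ θ u) :
    InDomain S ϖ θ (comp c u) := by
  have hθ : 0 < θ := hϖ.trans_le hϖθ
  obtain ⟨ρ, hρ₀, hρ, hb⟩ := hu.exists_boundedOn hϖ hϖθ (t := 1 / 2) (by norm_num) (by norm_num)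
  rw [comp_eq_mvComp]
  refine .of_boundedOn (t := 1 / 2) ?_ ?_ hρ
  · exact BoundedOn.mvComp hS one_pos (hc.self_of_le hθ hc₀ hϖ.le hϖθ) fun _ => hu.bounded
  · exact BoundedOn.mvComp hS (by norm_num) (hc.self_of_le hθ hc₀ hρ₀ hρ.le) fun _ => hb

lemma InDomain.formalAdd (hS : IsComplete (S : Set E)) (hϖ : 0 < ϖ) (hϖθ : ϖ ≤ θ) (hθ : θ ≤ 1)
    {F : MvPowerSeries (Fin 2) E} (hF : BoundedOn S 1 1 F)
    (hF₀ : MvPowerSeries.constantCoeff F = 0) (hu : InDomain S ϖ θ u) (hv : InDomain S ϖ θ v) :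
    InDomain S ϖ θ (formalAdd F u v) := by
  obtain ⟨ρ, hρ₀, hρ, hb⟩ := hu.exists_boundedOn hϖ hϖθ (t := 1 / 2) (by norm_num) (by norm_num)
  obtain ⟨ρ', hρ₀', hρ', hb'⟩ :=
    hv.exists_boundedOn hϖ hϖθ (t := 1 / 2) (by norm_num) (by norm_num)
  rw [formalAdd_eq_mvComp]
  have hm : max ρ ρ' < θ := max_lt hρ hρ'
  refine .of_boundedOn (t := 1 / 2) ?_ ?_ hm
  · refine BoundedOn.mvComp hS one_pos (hF.self_of_le one_pos hF₀ hϖ.le (hϖθ.trans hθ)) ?_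
    simpa [Fin.forall_fin_two] using And.intro hu.bounded hv.bounded
  · refine BoundedOn.mvComp hS (by norm_num)
      (hF.self_of_le one_pos hF₀ (le_max_of_le_left hρ₀) (hm.le.trans hθ)) ?_
    simpa [Fin.forall_fin_two] using And.intro (hb.mono (le_max_left _ _))
      (hb'.mono (le_max_right _ _))

/-- The inner series may have a nonzero constant term, as for a translate X ⊕ z. It therefore comes
with some radius `t` at which its Gauss norm is less than 1. -/
lemma InDomain.comp_right (hS : IsComplete (S : Set E)) (hϖ : 0 < ϖ) (hϖθ : ϖ ≤ θ)
    (hu : InDomain S ϖ θ u) (hh : BoundedOn S 1 1 h) (ht : 0 < t) (hρ : ρ < 1)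
    (hh' : BoundedOn S t ρ h) : InDomain S ϖ θ (LubinTate.comp u h) := by
  obtain ⟨ρ', hρ₀', hρ', hb'⟩ := hu.exists_boundedOn hϖ hϖθ hh'.nonneg hρ
  rw [comp_eq_mvComp]
  exact .of_boundedOn (t := t) (BoundedOn.mvComp hS one_pos hu.bounded fun _ => hh)
    (BoundedOn.mvComp hS ht hb' fun _ => hh') hρ'

/-- A ρ' strictly between ρ and θ supplies the two strict gaps required by `mvComp_mvComp`: `b`
preserves the disc of radius ρ', which is still smaller than that of `c`. -/
lemma comp_comp_of_inDomain (hS : IsComplete (S : Set E)) (hϖ : 0 < ϖ) (hϖθ : ϖ ≤ θ)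
    (hc : BoundedOn S θ θ c) (hb : BoundedOn S θ θ b)
    (hb₀ : PowerSeries.constantCoeff b = 0) (hu : InDomain S ϖ θ u) :
    comp c (comp b u) = comp (c.subst b) u := by
  have hθ : 0 < θ := hϖ.trans_le hϖθ
  obtain ⟨ρ, hρ₀, hρ, hbu⟩ := hu.exists_boundedOn hϖ hϖθ (t := 1 / 2) (by norm_num) (by norm_num)
  obtain ⟨ρ', h1, h2⟩ := exists_between hρ
  rw [← comp_eq_subst hb₀]
  simp only [comp_eq_mvComp]
  exact (mvComp_mvComp hS (by norm_num) hρ₀ h1 h2 hc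
    (fun _ => hb.self_of_le hθ hb₀ (hρ₀.trans h1.le) h2.le) (hρ₀.trans h1.le) fun _ => hbu).symm

lemma comp_comp_right (hS : IsComplete (S : Set E)) (hϖ : 0 < ϖ) (hϖθ : ϖ ≤ θ)
    (hc : BoundedOn S θ θ c) (hu : InDomain S ϖ θ u) (ht : 0 < t) (hρ : ρ < 1)
    (hh' : BoundedOn S t ρ h) : comp c (comp u h) = comp (comp c u) h := by
  obtain ⟨ρ', h1, h2⟩ := exists_between hρ
  obtain ⟨κ, hκ₀, hκ, hb⟩ := hu.exists_boundedOn hϖ hϖθ (hh'.nonneg.trans h1.le) h2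
  simp only [comp_eq_mvComp]
  exact (mvComp_mvComp hS ht hh'.nonneg h1 hκ hc (fun _ => hb) hκ₀ fun _ => hh').symm

/-- The formal identity c(F) = c(X) + c(Y) is evaluated at (u, v), each of its three terms being
rewritten by associativity. -/
lemma comp_formalAdd (hS : IsComplete (S : Set E)) (hϖ : 0 < ϖ) (hϖθ : ϖ ≤ θ) (hθ : θ ≤ 1)
    {F : MvPowerSeries (Fin 2) E} (hF : BoundedOn S 1 1 F)
    (hF₀ : MvPowerSeries.constantCoeff F = 0) (hc : BoundedOn S θ θ c)
    (hcF : c.subst F = c.subst (MvPowerSeries.X 0 : MvPowerSeries (Fin 2) E) +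
      c.subst (MvPowerSeries.X 1 : MvPowerSeries (Fin 2) E))
    (hu : InDomain S ϖ θ u) (hv : InDomain S ϖ θ v) :
    comp c (formalAdd F u v) = comp c u + comp c v := by
  have hθ₀ : 0 < θ := hϖ.trans_le hϖθ
  obtain ⟨ρ₁, hρ₁₀, hρ₁, hb₁⟩ :=
    hu.exists_boundedOn hϖ hϖθ (t := 1 / 2) (by norm_num) (by norm_num)
  obtain ⟨ρ₂, -, hρ₂, hb₂⟩ :=
    hv.exists_boundedOn hϖ hϖθ (t := 1 / 2) (by norm_num) (by norm_num)
  set ρ := max ρ₁ ρ₂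
  have hρ₀ : 0 ≤ ρ := le_max_of_le_left hρ₁₀
  have hb : ∀ i, BoundedOn S (1 / 2) ρ ((![u, v] : Fin 2 → MvPowerSeries Unit E) i) := by
    simpa [Fin.forall_fin_two] using And.intro (hb₁.mono (le_max_left _ _))
      (hb₂.mono (le_max_right _ _))
  obtain ⟨ρ', h1, h2⟩ := exists_between (max_lt hρ₁ hρ₂ : ρ < θ)
  have hρ'₀ : 0 ≤ ρ' := hρ₀.trans h1.le
  have hsub : ∀ H : MvPowerSeries (Fin 2) E, MvPowerSeries.constantCoeff H = 0 →
      c.subst H = mvComp (σ := Unit) c fun _ => H := fun H hH =>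
    (mvComp_eq_subst (PowerSeries.HasSubst.of_constantCoeff_zero hH).const).symm
  have hX : ∀ i, mvComp (c.subst (MvPowerSeries.X i : MvPowerSeries (Fin 2) E)) ![u, v] =
      mvComp (σ := Unit) c fun _ => (![u, v] : Fin 2 → MvPowerSeries Unit E) i := by
    intro i
    rw [hsub _ (by simp), mvComp_mvComp hS (by norm_num) hρ₀ h1 h2 hc
      (fun _ => BoundedOn.X i hρ'₀) hρ'₀ hb]
    simp only [mvComp_X]
  have hXb : ∀ i, BoundedOn S ρ' θ (c.subst (MvPowerSeries.X i : MvPowerSeries (Fin 2) E)) := by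
    intro i
    rw [hsub _ (by simp)]
    exact BoundedOn.mvComp hS (hρ₀.trans_lt h1) hc fun _ => (BoundedOn.X i hρ'₀).mono h2.le
  rw [comp_eq_mvComp, formalAdd_eq_mvComp, comp_eq_mvComp, comp_eq_mvComp,
    ← mvComp_mvComp hS (by norm_num) hρ₀ h1 h2 hc
    (fun _ => hF.self_of_le one_pos hF₀ hρ'₀ (h2.le.trans hθ)) hρ'₀ hb, ← hsub F hF₀, hcF,
    mvComp_add hS (by norm_num) hρ₀ h1 (hXb 0) (hXb 1) hb, hX, hX]
  rfl

lemma InDomain.formalSum (hS : IsComplete (S : Set E)) (hϖ : 0 < ϖ) (hϖθ : ϖ ≤ θ) (hθ : θ ≤ 1)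
    {F : MvPowerSeries (Fin 2) E} (hF : BoundedOn S 1 1 F)
    (hF₀ : MvPowerSeries.constantCoeff F = 0) {l : List (PowerSeries E)}
    (hl : ∀ u ∈ l, InDomain S ϖ θ u) : InDomain S ϖ θ (formalSum F l) := by
  induction l with
  | nil => exact .zero hϖ hϖθ
  | cons u l ih =>
    simp only [List.forall_mem_cons] at hl
    exact hl.1.formalAdd hS hϖ hϖθ hθ hF hF₀ (ih hl.2)

lemma comp_formalSum (hS : IsComplete (S : Set E)) (hϖ : 0 < ϖ) (hϖθ : ϖ ≤ θ) (hθ : θ ≤ 1)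
    {F : MvPowerSeries (Fin 2) E} (hF : BoundedOn S 1 1 F)
    (hF₀ : MvPowerSeries.constantCoeff F = 0) (hc : BoundedOn S θ θ c)
    (hc₀ : PowerSeries.constantCoeff c = 0)
    (hcF : c.subst F = c.subst (MvPowerSeries.X 0 : MvPowerSeries (Fin 2) E) +
      c.subst (MvPowerSeries.X 1 : MvPowerSeries (Fin 2) E)) {l : List (PowerSeries E)}
    (hl : ∀ u ∈ l, InDomain S ϖ θ u) : comp c (formalSum F l) = (l.map (comp c)).sum := by
  induction l with
  | nil => exact comp_zero_right hc₀
  | cons u l ih =>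
    simp only [List.forall_mem_cons] at hl
    rw [List.map_cons, List.sum_cons, ← ih hl.2]
    exact comp_formalAdd hS hϖ hϖθ hθ hF hF₀ hc hcF hl.1
      (.formalSum hS hϖ hϖθ hθ hF hF₀ hl.2)

end OneVariable

/-! ### Formal substitution of f into each variable. -/

section FormalSubstitution

variable {R : Type*} [CommRing R] {σ τ : Type*}

lemma hasSubst_mv [Finite σ] {r : σ → MvPowerSeries τ R}
    (hr : ∀ i, MvPowerSeries.constantCoeff (r i) = 0) : MvPowerSeries.HasSubst r :=
  MvPowerSeries.hasSubst_of_constantCoeff_zero hr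

lemma subst_subst_mv [Finite σ] (f : PowerSeries R) {φ : MvPowerSeries σ R}
    {r : σ → MvPowerSeries τ R} (hφ : MvPowerSeries.constantCoeff φ = 0)
    (hr : ∀ i, MvPowerSeries.constantCoeff (r i) = 0) :
    (f.subst φ).subst r = f.subst (φ.subst r) :=
  MvPowerSeries.subst_comp_subst_apply (PowerSeries.HasSubst.of_constantCoeff_zero hφ).const
    (hasSubst_mv hr) f

lemma constantCoeff_subst_zero {f : PowerSeries R} (hf : PowerSeries.constantCoeff f = 0)
    {φ : MvPowerSeries τ R} (hφ : MvPowerSeries.constantCoeff φ = 0) :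
    MvPowerSeries.constantCoeff (f.subst φ) = 0 :=
  PowerSeries.constantCoeff_subst_eq_zero hφ f hf

/-- The family `f(Xᵢ)` of power series in several variables. -/
def substVars (σ : Type*) (f : PowerSeries R) : σ → MvPowerSeries σ R :=
  fun i => f.subst (MvPowerSeries.X i : MvPowerSeries σ R)

variable {f : PowerSeries R}

lemma constantCoeff_substVars (hf : PowerSeries.constantCoeff f = 0) (i : σ) :
    MvPowerSeries.constantCoeff (substVars σ f i) = 0 :=
  constantCoeff_subst_zero hf (by simp)

/-- Writing f = X g, each factor f(Xᵢ) is Xᵢ g(Xᵢ). So substitution of f is triangular for the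
degree, with diagonal entries powers of f'(0). -/
lemma prod_substVars_pow (hf : PowerSeries.constantCoeff f = 0) (e : σ →₀ ℕ) :
    ∃ P : MvPowerSeries σ R, MvPowerSeries.constantCoeff P = PowerSeries.coeff 1 f ^ e.degree ∧
      (e.prod fun i k => substVars σ f i ^ k) = MvPowerSeries.monomial e 1 * P := by
  classical
  obtain ⟨g, rfl⟩ := PowerSeries.X_dvd_iff.2 hf
  induction e using Finsupp.induction with
  | zero => exact ⟨1, by simp, by simp [MvPowerSeries.monomial_zero_one]⟩
  | single_add a b e ha hb ih =>
    obtain ⟨P, hP, hP'⟩ := ih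
    have hX : PowerSeries.HasSubst (MvPowerSeries.X a : MvPowerSeries σ R) :=
      PowerSeries.HasSubst.X a
    refine ⟨(g.subst (MvPowerSeries.X a : MvPowerSeries σ R)) ^ b * P, ?_, ?_⟩
    · have h0 : MvPowerSeries.constantCoeff (g.subst (MvPowerSeries.X a : MvPowerSeries σ R)) =
          PowerSeries.coeff 1 (PowerSeries.X * g) := by
        rw [PowerSeries.constantCoeff_subst hX, finsum_eq_single _ 0]
        · simp [PowerSeries.coeff_succ_X_mul 0]
        · intro n hn
          simp [hn]
      rw [map_mul, map_pow, h0, hP, map_add, pow_add, Finsupp.degree_single]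
    · rw [Finsupp.prod_add_index' (by simp) (by intros; rw [pow_add]),
        Finsupp.prod_single_index (by simp), hP']
      have h1 : MvPowerSeries.monomial (Finsupp.single a b + e) (1 : R) =
          MvPowerSeries.X a ^ b * MvPowerSeries.monomial e 1 := by
        rw [MvPowerSeries.X_pow_eq, MvPowerSeries.monomial_mul_monomial, one_mul]
      rw [h1, substVars, PowerSeries.subst_mul hX, PowerSeries.subst_X hX, mul_pow]
      ring

lemma coeff_prod_substVars_pow_of_not_le (hf : PowerSeries.constantCoeff f = 0) {d e : σ →₀ ℕ}
    (h : ¬ e ≤ d) : MvPowerSeries.coeff d (e.prod fun i k => substVars σ f i ^ k) = 0 := by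
  classical
  obtain ⟨P, -, hP⟩ := prod_substVars_pow hf e
  rw [hP, MvPowerSeries.coeff_monomial_mul, if_neg h]

lemma coeff_prod_substVars_pow_self (hf : PowerSeries.constantCoeff f = 0) (d : σ →₀ ℕ) :
    MvPowerSeries.coeff d (d.prod fun i k => substVars σ f i ^ k) =
      PowerSeries.coeff 1 f ^ d.degree := by
  classical
  obtain ⟨P, hP', hP⟩ := prod_substVars_pow hf d
  rw [hP, MvPowerSeries.coeff_monomial_mul, if_pos le_rfl, one_mul, tsub_self,
    MvPowerSeries.coeff_zero_eq_constantCoeff_apply, hP']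

/-- If `ψ` has no terms of degree less than that of `d`, then the coefficient of `ψ(f(Xᵢ))` at `d`
is that of `ψ` times a power of the linear coefficient of `f`. -/
lemma coeff_subst_substVars [Finite σ] (hf : PowerSeries.constantCoeff f = 0)
    {ψ : MvPowerSeries σ R} {d : σ →₀ ℕ}
    (hψ : ∀ e : σ →₀ ℕ, e.degree < d.degree → MvPowerSeries.coeff e ψ = 0) :
    MvPowerSeries.coeff d (ψ.subst (substVars σ f)) =
      MvPowerSeries.coeff d ψ * PowerSeries.coeff 1 f ^ d.degree := by
  rw [MvPowerSeries.coeff_subst (hasSubst_mv (constantCoeff_substVars hf)), finsum_eq_single _ d,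
    coeff_prod_substVars_pow_self hf, smul_eq_mul]
  intro e he
  by_cases hed : e ≤ d
  · rw [hψ e, zero_smul]
    obtain ⟨c, rfl⟩ := exists_add_of_le hed
    rw [map_add]
    have : c.degree ≠ 0 := by
      rw [Ne, Finsupp.degree_eq_zero_iff]
      rintro rfl
      simp at he
    omega
  · rw [coeff_prod_substVars_pow_of_not_le hf hed, smul_zero]

/-- A lowest-degree coefficient c, in degree n ≥ 2, satisfies c (π^n - π) = 0 with π = f'(0). This
is the source of all uniqueness statements below. -/
lemma eq_zero_of_subst_substVars_eq [Finite σ] [NoZeroDivisors R]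
    (hf : PowerSeries.constantCoeff f = 0)
    (hπ : ∀ n, 2 ≤ n → PowerSeries.coeff 1 f ^ n ≠ PowerSeries.coeff 1 f) {ψ : MvPowerSeries σ R}
    (hψ : ∀ e : σ →₀ ℕ, e.degree ≤ 1 → MvPowerSeries.coeff e ψ = 0)
    (h : ψ.subst (substVars σ f) = PowerSeries.coeff 1 f • ψ) : ψ = 0 := by
  suffices H : ∀ n, ∀ d : σ →₀ ℕ, d.degree = n → MvPowerSeries.coeff d ψ = 0 by
    ext d
    simpa using H _ d rfl
  intro n
  induction n using Nat.strong_induction_on with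
  | _ n ih =>
    intro d hd
    by_cases hn : n ≤ 1
    · exact hψ d (hd.trans_le hn)
    have h1 := coeff_subst_substVars hf (ψ := ψ) (d := d) fun e he => ih _ (hd ▸ he) e rfl
    rw [h, MvPowerSeries.coeff_smul, hd] at h1
    have h2 : MvPowerSeries.coeff d ψ *
        (PowerSeries.coeff 1 f ^ n - PowerSeries.coeff 1 f) = 0 := by
      rw [mul_sub, ← h1]; ring
    exact (mul_eq_zero.1 h2).resolve_right (sub_ne_zero.2 (hπ n (by omega)))

/-- If `φ` and `ψ` without constant term agree in degrees less than that of `d`, then the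
coefficients of `f(φ)` and `f(ψ)` at `d` differ only through the linear term of `f`. -/
lemma coeff_subst_sub_coeff_subst (f : PowerSeries R) {φ ψ : MvPowerSeries σ R}
    (hφ : MvPowerSeries.constantCoeff φ = 0) (hψ : MvPowerSeries.constantCoeff ψ = 0)
    {d : σ →₀ ℕ} (h : ∀ e : σ →₀ ℕ, e.degree < d.degree →
      MvPowerSeries.coeff e φ = MvPowerSeries.coeff e ψ) :
    MvPowerSeries.coeff d (f.subst φ) - MvPowerSeries.coeff d (f.subst ψ) =
      PowerSeries.coeff 1 f * (MvPowerSeries.coeff d φ - MvPowerSeries.coeff d ψ) := by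
  classical
  have hφ' := PowerSeries.HasSubst.of_constantCoeff_zero hφ
  have hψ' := PowerSeries.HasSubst.of_constantCoeff_zero hψ
  rw [PowerSeries.coeff_subst hφ', PowerSeries.coeff_subst hψ', ← finsum_sub_distrib
    (PowerSeries.coeff_subst_finite hφ' f d) (PowerSeries.coeff_subst_finite hψ' f d),
    finsum_eq_single _ 1]
  · simp [mul_sub]
  · intro n hn
    rw [← smul_sub, ← map_sub]
    rcases n with _ | _ | n
    · simp
    · simp at hn
    -- The factor φ - ψ vanishes below degree `d.degree`, and the cofactor has no constant term, so
    -- their product has no coefficient at d.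
    · have : φ ^ (n + 1 + 1) - ψ ^ (n + 1 + 1) = (∑ i ∈ Finset.range (n + 1 + 1),
          φ ^ i * ψ ^ (n + 1 + 1 - 1 - i)) * (φ - ψ) := (Commute.all φ ψ).geom_sum₂_mul _ |>.symm
      rw [this, MvPowerSeries.coeff_mul, Finset.sum_eq_zero, smul_zero]
      intro x hx
      rw [Finset.HasAntidiagonal.mem_antidiagonal] at hx
      rcases eq_or_ne x.1 0 with h0 | h0
      · rw [h0, MvPowerSeries.coeff_zero_eq_constantCoeff_apply, map_sum, Finset.sum_eq_zero,
          zero_mul]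
        intro i hi
        rw [Finset.mem_range] at hi
        rw [map_mul, map_pow, map_pow, hφ, hψ]
        rcases eq_or_ne i 0 with rfl | hi0
        · simp
        · simp [hi0]
      · have hd : x.2.degree < d.degree := by
          rw [← hx, map_add]
          have : x.1.degree ≠ 0 := by rwa [Ne, Finsupp.degree_eq_zero_iff]
          omega
        rw [map_sub, h _ hd, sub_self, mul_zero]

lemma coeff_subst_of_degree_eq_one (f : PowerSeries R) {φ : MvPowerSeries σ R}
    (hφ : MvPowerSeries.constantCoeff φ = 0) {d : σ →₀ ℕ} (hd : d.degree = 1) :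
    MvPowerSeries.coeff d (f.subst φ) = PowerSeries.coeff 1 f * MvPowerSeries.coeff d φ := by
  classical
  have h := coeff_subst_sub_coeff_subst f hφ (ψ := 0) (by simp) (d := d) fun e he => by
    have : e = 0 := by rw [← Finsupp.degree_eq_zero_iff]; omega
    simp [this, hφ]
  have hd0 : d ≠ 0 := by rintro rfl; simp at hd
  rw [PowerSeries.subst_zero_eq_C_constantCoeff, MvPowerSeries.map_C, MvPowerSeries.coeff_C,
    if_neg hd0] at h
  simpa using h

end FormalSubstitution

/-! ### Frobenius congruence for Lubin–Tate series. -/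

section Frobenius

variable {R : Type*} [CommRing R] {σ : Type*} [Finite σ]

/-- `f(ψ) ≡ ψ(f)` modulo `π`, for a Lubin-Tate series `f`. -/
lemma IsLubinTateSeries.dvd_coeff_subst_sub {π : R} {f : PowerSeries R}
    (hf : IsLubinTateSeries π f) [hmax : (Ideal.span {π}).IsMaximal]
    [hfin : Finite (R ⧸ Ideal.span {π})] {ψ : MvPowerSeries σ R}
    (hψ : MvPowerSeries.constantCoeff ψ = 0) (d : σ →₀ ℕ) :
    π ∣ MvPowerSeries.coeff d (f.subst ψ - ψ.subst (substVars σ f)) := by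
  let k := R ⧸ Ideal.span {π}
  let _ : Field k := Ideal.Quotient.field _
  let _ : Fintype k := Fintype.ofFinite k
  let m : R →+* k := Ideal.Quotient.mk _
  obtain ⟨p, hchar⟩ := CharP.exists k
  obtain ⟨h, hp, hcard⟩ := FiniteField.card k p
  have : Fact p.Prime := ⟨hp⟩
  have hq : Nat.card k = p ^ (h : ℕ) := by rw [Nat.card_eq_fintype_card, hcard]
  have hq0 : p ^ (h : ℕ) ≠ 0 := pow_ne_zero _ hp.ne_zero
  have hmf : PowerSeries.map m f = PowerSeries.X ^ p ^ (h : ℕ) := by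
    obtain ⟨g, hg⟩ := hf.dvd_sub
    rw [← hq, ← sub_eq_zero]
    have h1 := congrArg (PowerSeries.map m) hg
    rw [map_sub, map_pow, PowerSeries.map_X, map_mul, PowerSeries.map_C] at h1
    have h2 : m π = 0 := Ideal.Quotient.eq_zero_iff_mem.2 (Ideal.mem_span_singleton_self π)
    rw [h1, h2, map_zero, zero_mul]
  have hψ' : MvPowerSeries.constantCoeff (MvPowerSeries.map m ψ) = 0 := by
    rw [MvPowerSeries.constantCoeff_map, hψ, map_zero]
  have hX : ∀ i : σ, PowerSeries.HasSubst (MvPowerSeries.X i : MvPowerSeries σ k) :=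
    fun i => PowerSeries.HasSubst.X i
  have key : MvPowerSeries.map m (f.subst ψ - ψ.subst (substVars σ f)) = 0 := by
    -- Over the residue field, with q elements, x^q = x on coefficients, so raising a series to the
    -- power q replaces each variable by its q-th power.
    have hexp : MvPowerSeries.map m ψ ^ p ^ (h : ℕ) =
        MvPowerSeries.expand (p ^ (h : ℕ)) hq0 (MvPowerSeries.map m ψ) := by
      rw [← MvPowerSeries.map_iterateFrobenius_expand p hp.ne_zero]
      have : iterateFrobenius k p h = RingHom.id k := by
        refine RingHom.ext fun x => ?_
        rw [iterateFrobenius_def, ← hcard, FiniteField.pow_card, RingHom.id_apply]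
      rw [this, MvPowerSeries.map_id, RingHom.id_apply]
    rw [map_sub, sub_eq_zero, PowerSeries.map_subst (.of_constantCoeff_zero hψ),
      MvPowerSeries.map_subst (hasSubst_mv (constantCoeff_substVars hf.constantCoeff_eq))]
    change PowerSeries.subst _ (PowerSeries.map m f) = _
    rw [hmf, PowerSeries.subst_pow (.of_constantCoeff_zero hψ'),
      PowerSeries.subst_X (.of_constantCoeff_zero hψ'), hexp, MvPowerSeries.expand,
      MvPowerSeries.substAlgHom_apply]
    congr 1
    funext i
    rw [substVars, PowerSeries.map_subst (.X i)]
    change _ = PowerSeries.subst _ (PowerSeries.map m f)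
    rw [hmf, MvPowerSeries.map_X, PowerSeries.subst_pow (hX i), PowerSeries.subst_X (hX i)]
  rw [← Ideal.mem_span_singleton, ← Ideal.Quotient.eq_zero_iff_mem]
  change m _ = 0
  rw [← MvPowerSeries.coeff_map, key, map_zero]

end Frobenius

/-! ### Integrality of series commuting with f. -/

section Integrality

variable {A : Type*} [CommRing A]

/-- The properties of a uniformizer of a nonarchimedean local field that the formal theory uses. -/
structure IsLocalUniformizer (π : A) : Prop where
  ne_zero : π ≠ 0
  isUnit_pow_sub_one : ∀ n : ℕ, IsUnit (π ^ (n + 1) - 1)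
  isMaximal : (Ideal.span {π}).IsMaximal
  finite : Finite (A ⧸ Ideal.span {π})

variable {E : Type*} [Field E] {ι : A →+* E} {π : A} {f : PowerSeries A}
  {σ : Type*}

lemma map_subst_zero (f : PowerSeries A) {ψ : MvPowerSeries σ A}
    (hψ : MvPowerSeries.constantCoeff ψ = 0) :
    MvPowerSeries.map ι (f.subst ψ) = (PowerSeries.map ι f).subst (MvPowerSeries.map ι ψ) := by
  rw [PowerSeries.map_subst (.of_constantCoeff_zero hψ)]

variable [Finite σ]

lemma map_substVars (hf : PowerSeries.constantCoeff f = 0) (ψ : MvPowerSeries σ A) :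
    MvPowerSeries.map ι (ψ.subst (substVars σ f)) =
      (MvPowerSeries.map ι ψ).subst (substVars σ (PowerSeries.map ι f)) := by
  rw [MvPowerSeries.map_subst (hasSubst_mv (constantCoeff_substVars hf))]
  congr 1
  funext i
  rw [substVars, PowerSeries.map_subst (.X i), MvPowerSeries.map_X]
  rfl

/-- A series over a field that commutes with a Lubin-Tate series is integral if its linear
coefficients are. -/
theorem coeff_mem_range_of_subst_comm (hι : Function.Injective ι) (hπ : IsLocalUniformizer π)
    (hf : IsLubinTateSeries π f) {φ : MvPowerSeries σ E}
    (hφ : MvPowerSeries.constantCoeff φ = 0)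
    (hlin : ∀ e : σ →₀ ℕ, e.degree = 1 → MvPowerSeries.coeff e φ ∈ ι.range)
    (hcomm : (PowerSeries.map ι f).subst φ = φ.subst (substVars σ (PowerSeries.map ι f)))
    (d : σ →₀ ℕ) : MvPowerSeries.coeff d φ ∈ ι.range := by
  classical
  have := hπ.isMaximal
  have := hπ.finite
  set g := PowerSeries.map ι f with hg
  have hg₀ : PowerSeries.constantCoeff g = 0 := by
    rw [hg, ← PowerSeries.coeff_zero_eq_constantCoeff_apply, PowerSeries.coeff_map,
      PowerSeries.coeff_zero_eq_constantCoeff_apply, hf.constantCoeff_eq, map_zero]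
  have hg₁ : PowerSeries.coeff 1 g = ι π := by rw [hg, PowerSeries.coeff_map, hf.coeff_one_eq]
  have hιπ : ι π ≠ 0 := (map_ne_zero_iff ι hι).2 hπ.ne_zero
  induction hn : d.degree using Nat.strong_induction_on generalizing d with
  | _ n ih =>
    obtain _ | _ | n := n
    · rw [Finsupp.degree_eq_zero_iff] at hn
      rw [hn, MvPowerSeries.coeff_zero_eq_constantCoeff_apply, hφ]
      exact ι.range.zero_mem
    · exact hlin d hn
    choose! c hc using fun e (he : e.degree < n + 1 + 1) => ih _ he e rfl
    -- An integral model of the part of φ in degrees below n + 2, available by induction.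
    let ψ : MvPowerSeries σ A := fun e => if e.degree < n + 1 + 1 then c e else 0
    have hψc : ∀ e, MvPowerSeries.coeff e ψ = if e.degree < n + 1 + 1 then c e else 0 :=
      fun e => rfl
    set φ' := MvPowerSeries.map ι ψ with hφ'
    have hlow : ∀ e : σ →₀ ℕ, e.degree < d.degree →
        MvPowerSeries.coeff e φ = MvPowerSeries.coeff e φ' := by
      intro e he
      rw [hn] at he
      rw [hφ', MvPowerSeries.coeff_map, hψc, if_pos he, hc e he]
    have hd : MvPowerSeries.coeff d φ' = 0 := by
      rw [hφ', MvPowerSeries.coeff_map, hψc, if_neg (by omega), map_zero]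
    have hφ'₀ : MvPowerSeries.constantCoeff φ' = 0 := by
      rw [← hφ, ← MvPowerSeries.coeff_zero_eq_constantCoeff_apply,
        ← MvPowerSeries.coeff_zero_eq_constantCoeff_apply, hlow 0 (by simp [hn])]
    have hψ₀ : MvPowerSeries.constantCoeff ψ = 0 := by
      apply hι
      rw [← MvPowerSeries.constantCoeff_map, ← hφ', hφ'₀, map_zero]
    have h1 := coeff_subst_sub_coeff_subst g hφ hφ'₀ hlow
    have h2 := coeff_subst_substVars (ψ := φ - φ') (d := d) hg₀
      fun e he => by rw [map_sub, hlow e he, sub_self]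
    rw [← MvPowerSeries.coe_substAlgHom (hasSubst_mv (constantCoeff_substVars hg₀)), map_sub,
      MvPowerSeries.coe_substAlgHom, ← hcomm, map_sub, map_sub, hd, hg₁, hn] at h2
    rw [hd, hg₁] at h1
    obtain ⟨b, hb⟩ := hf.dvd_coeff_subst_sub hψ₀ d
    have h3 := congrArg ι hb
    rw [← MvPowerSeries.coeff_map, map_sub, map_subst_zero f hψ₀, map_substVars hf.constantCoeff_eq,
      map_sub, map_mul] at h3
    obtain ⟨w, hw⟩ := hπ.isUnit_pow_sub_one n
    have hw' : ι (π ^ (n + 1) - 1) * ι ↑w⁻¹ = 1 := by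
      rw [← hw, ← map_mul, Units.mul_inv, map_one]
    -- With c the coefficient of φ at d, comparing f(φ) = φ(f) with the truncation gives c (π^(n+2)
    -- - π) = π b, where b comes from the Frobenius congruence. After cancelling π, the factor
    -- π^(n+1) - 1 is a unit.
    have h4 : MvPowerSeries.coeff d φ * ι (π ^ (n + 1) - 1) = ι b := by
      apply mul_left_cancel₀ hιπ
      rw [map_sub, map_pow, map_one]
      linear_combination h3 - h2 + h1
    refine ⟨b * ↑w⁻¹, ?_⟩
    rw [map_mul, ← h4, mul_assoc, hw', mul_one]

end Integrality

/-! ### The linearizing series Λ and series commuting with f. -/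

section Logarithm

variable {E : Type*} [Field E]

/-- The coefficients of the series `λ = X + ⋯` with `λ(f) = f'(0) λ`. -/
def linearizerCoeff (f : PowerSeries E) : ℕ → E
  | 0 => 0
  | 1 => 1
  | n + 2 => -(∑ k : Fin (n + 2), linearizerCoeff f k * PowerSeries.coeff (n + 2) (f ^ (k : ℕ))) /
      (PowerSeries.coeff 1 f ^ (n + 2) - PowerSeries.coeff 1 f)

/-- The series `λ = X + ⋯` with `λ(f) = f'(0) λ`. -/
def linearizer (f : PowerSeries E) : PowerSeries E := PowerSeries.mk (linearizerCoeff f)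

variable {f : PowerSeries E}

lemma constantCoeff_linearizer : PowerSeries.constantCoeff (linearizer f) = 0 := by
  rw [← PowerSeries.coeff_zero_eq_constantCoeff_apply, linearizer, PowerSeries.coeff_mk,
    linearizerCoeff]

lemma coeff_one_linearizer : PowerSeries.coeff 1 (linearizer f) = 1 := by
  rw [linearizer, PowerSeries.coeff_mk, linearizerCoeff]

lemma coeff_pow_of_lt (hf : PowerSeries.constantCoeff f = 0) {n k : ℕ} (h : n < k) :
    PowerSeries.coeff n (f ^ k) = 0 := by
  obtain ⟨g, rfl⟩ := PowerSeries.X_dvd_iff.2 hf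
  rw [mul_pow, PowerSeries.coeff_X_pow_mul', if_neg (by omega)]

lemma coeff_pow_self (hf : PowerSeries.constantCoeff f = 0) (n : ℕ) :
    PowerSeries.coeff n (f ^ n) = PowerSeries.coeff 1 f ^ n := by
  obtain ⟨g, rfl⟩ := PowerSeries.X_dvd_iff.2 hf
  rw [mul_pow, PowerSeries.coeff_X_pow_mul', if_pos le_rfl, PowerSeries.coeff_succ_X_mul 0]
  simp

lemma coeff_subst_eq_sum (c : PowerSeries E) (hf : PowerSeries.constantCoeff f = 0) (n : ℕ) :
    PowerSeries.coeff n (c.subst f) =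
      ∑ k ∈ Finset.range (n + 1), PowerSeries.coeff k c * PowerSeries.coeff n (f ^ k) := by
  rw [PowerSeries.coeff_subst' (.of_constantCoeff_zero' hf), finsum_eq_sum_of_support_subset]
  · rfl
  · intro k hk
    rw [Function.mem_support] at hk
    by_contra h
    simp only [Finset.coe_range, Set.mem_Iio, not_lt] at h
    exact hk (by rw [coeff_pow_of_lt hf (by omega), smul_zero])

/-- In degree n ≥ 2 the recursion is the coefficient identity solved for the n-th coefficient of Λ,
which enters through π^n - π ≠ 0. -/
lemma linearizer_subst (hf : PowerSeries.constantCoeff f = 0)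
    (hπ : ∀ n, 2 ≤ n → PowerSeries.coeff 1 f ^ n ≠ PowerSeries.coeff 1 f) :
    (linearizer f).subst f = PowerSeries.coeff 1 f • linearizer f := by
  ext n
  rw [coeff_subst_eq_sum _ hf, Finset.sum_range_succ, coeff_pow_self hf, map_smul, smul_eq_mul]
  obtain _ | _ | n := n
  · simp [constantCoeff_linearizer]
  · simp [constantCoeff_linearizer, coeff_one_linearizer]
  · have h := sub_ne_zero.2 (hπ (n + 2) (by omega))
    have h2 : PowerSeries.coeff (n + 2) (linearizer f) *
        (PowerSeries.coeff 1 f ^ (n + 2) - PowerSeries.coeff 1 f) =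
        -(∑ k ∈ Finset.range (n + 2), PowerSeries.coeff k (linearizer f) *
          PowerSeries.coeff (n + 2) (f ^ k)) := by
      rw [linearizer, PowerSeries.coeff_mk, linearizerCoeff, div_mul_cancel₀ _ h,
        Finset.sum_range]
      simp only [PowerSeries.coeff_mk]
    linear_combination h2

/-- A pair of mutually inverse power series, the first of which linearizes `f`. -/
structure IsLinearizer (f Λ e : PowerSeries E) : Prop where
  constantCoeff_log : PowerSeries.constantCoeff Λ = 0
  constantCoeff_exp : PowerSeries.constantCoeff e = 0
  coeff_one_log : PowerSeries.coeff 1 Λ = 1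
  log_subst_exp : Λ.subst e = PowerSeries.X
  exp_subst_log : e.subst Λ = PowerSeries.X
  log_subst : Λ.subst f = PowerSeries.coeff 1 f • Λ

lemma isUnit_coeff_one_linearizer : IsUnit (PowerSeries.coeff 1 (linearizer f)) := by
  rw [coeff_one_linearizer]; exact isUnit_one

lemma isLinearizer_linearizer (hf : PowerSeries.constantCoeff f = 0)
    (hπ : ∀ n, 2 ≤ n → PowerSeries.coeff 1 f ^ n ≠ PowerSeries.coeff 1 f) :
    IsLinearizer f (linearizer f)
      ((linearizer f).substInvOfIsUnit isUnit_coeff_one_linearizer) where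
  constantCoeff_log := constantCoeff_linearizer
  constantCoeff_exp := by simp
  coeff_one_log := coeff_one_linearizer
  log_subst_exp := PowerSeries.subst_substInvOfIsUnit_right _ constantCoeff_linearizer _
  exp_subst_log := PowerSeries.subst_substInvOfIsUnit_left _ constantCoeff_linearizer _
  log_subst := linearizer_subst hf hπ

namespace IsLinearizer

variable {Λ e : PowerSeries E} {σ : Type*}

lemma exp_subst_log_subst (h : IsLinearizer f Λ e) {φ : MvPowerSeries σ E}
    (hφ : MvPowerSeries.constantCoeff φ = 0) : e.subst (Λ.subst φ) = φ := by
  have hs := PowerSeries.HasSubst.of_constantCoeff_zero hφ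
  rw [← PowerSeries.subst_comp_subst_apply (.of_constantCoeff_zero' h.constantCoeff_log) hs,
    h.exp_subst_log, PowerSeries.subst_X hs]

lemma log_subst_exp_subst (h : IsLinearizer f Λ e) {φ : MvPowerSeries σ E}
    (hφ : MvPowerSeries.constantCoeff φ = 0) : Λ.subst (e.subst φ) = φ := by
  have hs := PowerSeries.HasSubst.of_constantCoeff_zero hφ
  rw [← PowerSeries.subst_comp_subst_apply (.of_constantCoeff_zero' h.constantCoeff_exp) hs,
    h.log_subst_exp, PowerSeries.subst_X hs]

lemma log_subst_injective (h : IsLinearizer f Λ e) {φ ψ : MvPowerSeries σ E}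
    (hφ : MvPowerSeries.constantCoeff φ = 0) (hψ : MvPowerSeries.constantCoeff ψ = 0)
    (heq : Λ.subst φ = Λ.subst ψ) : φ = ψ := by
  rw [← h.exp_subst_log_subst hφ, heq, h.exp_subst_log_subst hψ]

lemma log_subst_subst (h : IsLinearizer f Λ e) (hf : PowerSeries.constantCoeff f = 0)
    {φ : MvPowerSeries σ E} (hφ : MvPowerSeries.constantCoeff φ = 0) :
    Λ.subst (f.subst φ) = PowerSeries.coeff 1 f • Λ.subst φ := by
  have hs := PowerSeries.HasSubst.of_constantCoeff_zero hφ
  rw [← PowerSeries.subst_comp_subst_apply (.of_constantCoeff_zero' hf) hs, h.log_subst,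
    PowerSeries.subst_smul hs]

variable [Fintype σ]

/-- The linear combination of the series `Λ(Xᵢ)` with coefficients `a i`. -/
def logCombination (Λ : PowerSeries E) (a : σ → E) : MvPowerSeries σ E :=
  ∑ i, a i • Λ.subst (MvPowerSeries.X i : MvPowerSeries σ E)

lemma constantCoeff_logCombination (h : IsLinearizer f Λ e) (a : σ → E) :
    MvPowerSeries.constantCoeff (logCombination Λ a) = 0 := by
  rw [logCombination, map_sum]
  refine Finset.sum_eq_zero fun i _ => ?_
  have : MvPowerSeries.constantCoeff (Λ.subst (MvPowerSeries.X i : MvPowerSeries σ E)) = 0 :=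
    constantCoeff_subst_zero h.constantCoeff_log (by simp)
  rw [← MvPowerSeries.coeff_zero_eq_constantCoeff_apply] at this ⊢
  rw [MvPowerSeries.coeff_smul, this, mul_zero]

lemma coeff_logCombination (h : IsLinearizer f Λ e) (a : σ → E) (i : σ) :
    MvPowerSeries.coeff (Finsupp.single i 1) (logCombination Λ a) = a i := by
  classical
  rw [logCombination, map_sum, Finset.sum_eq_single i]
  · rw [MvPowerSeries.coeff_smul, coeff_subst_of_degree_eq_one _ (by simp) (by simp),
      MvPowerSeries.coeff_X, if_pos rfl, h.coeff_one_log, mul_one, mul_one]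
  · intro j _ hj
    rw [MvPowerSeries.coeff_smul, coeff_subst_of_degree_eq_one _ (by simp) (by simp),
      MvPowerSeries.coeff_X, if_neg, mul_zero, mul_zero]
    intro h
    exact hj ((Finsupp.single_left_inj one_ne_zero).1 h).symm
  · simp

lemma logCombination_subst (h : IsLinearizer f Λ e) (hf : PowerSeries.constantCoeff f = 0)
    (a : σ → E) : (logCombination Λ a).subst (substVars σ f) =
      PowerSeries.coeff 1 f • logCombination Λ a := by
  have hs := hasSubst_mv (constantCoeff_substVars (σ := σ) hf)
  rw [logCombination, ← MvPowerSeries.coe_substAlgHom hs, map_sum, Finset.smul_sum]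
  refine Finset.sum_congr rfl fun i _ => ?_
  rw [map_smul, MvPowerSeries.coe_substAlgHom, subst_subst_mv _ (by simp)
    (constantCoeff_substVars hf), MvPowerSeries.subst_X hs, substVars,
    h.log_subst_subst hf (by simp), smul_comm]

/-- A series that commutes with `f` is determined by its linear coefficients. -/
lemma log_subst_eq_logCombination (h : IsLinearizer f Λ e)
    (hf : PowerSeries.constantCoeff f = 0)
    (hπ : ∀ n, 2 ≤ n → PowerSeries.coeff 1 f ^ n ≠ PowerSeries.coeff 1 f)
    {φ : MvPowerSeries σ E} (hφ : MvPowerSeries.constantCoeff φ = 0)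
    (hcomm : f.subst φ = φ.subst (substVars σ f)) :
    Λ.subst φ = logCombination Λ fun i => MvPowerSeries.coeff (Finsupp.single i 1) φ := by
  have hs := hasSubst_mv (constantCoeff_substVars (σ := σ) hf)
  rw [← sub_eq_zero]
  -- The difference has no terms of degree at most 1, and substitution of f multiplies it by f'(0).
  refine eq_zero_of_subst_substVars_eq hf hπ (fun d hd => ?_) ?_
  · rcases Nat.le_one_iff_eq_zero_or_eq_one.1 hd with hd | hd
    · rw [Finsupp.degree_eq_zero_iff] at hd
      rw [hd, MvPowerSeries.coeff_zero_eq_constantCoeff_apply, map_sub,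
        constantCoeff_subst_zero h.constantCoeff_log hφ, h.constantCoeff_logCombination, sub_zero]
    · obtain ⟨i, rfl⟩ : ∃ i, Finsupp.single i 1 = d := by
        have : d ∈ Set.range fun i : σ => Finsupp.single i 1 := by
          rw [Finsupp.range_single_one]; exact hd
        exact this
      rw [map_sub, h.coeff_logCombination, coeff_subst_of_degree_eq_one _ hφ (by simp),
        h.coeff_one_log, one_mul, sub_self]
  · rw [← MvPowerSeries.coe_substAlgHom hs, map_sub, MvPowerSeries.coe_substAlgHom,
      h.logCombination_subst hf, subst_subst_mv _ hφ (constantCoeff_substVars hf), ← hcomm,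
      h.log_subst_subst hf hφ, smul_sub]

/-- Under Λ both sides become f'(0) times the logarithmic combination, and Λ is injective on series
without constant term. -/
lemma subst_exp_logCombination (h : IsLinearizer f Λ e) (hf : PowerSeries.constantCoeff f = 0)
    (a : σ → E) : f.subst (e.subst (logCombination Λ a)) =
      (e.subst (logCombination Λ a)).subst (substVars σ f) := by
  have h0 := h.constantCoeff_logCombination a
  have h1 := constantCoeff_subst_zero h.constantCoeff_exp h0
  have hX := constantCoeff_substVars (σ := σ) hf
  refine h.log_subst_injective (constantCoeff_subst_zero hf h1)
    (MvPowerSeries.constantCoeff_subst_eq_zero (hasSubst_mv hX) hX h1) ?_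
  rw [h.log_subst_subst hf h1, ← subst_subst_mv _ h1 hX, h.log_subst_exp_subst h0,
    h.logCombination_subst hf]

lemma coeff_exp_logCombination (h : IsLinearizer f Λ e) (a : σ → E) (i : σ) :
    MvPowerSeries.coeff (Finsupp.single i 1) (e.subst (logCombination Λ a)) = a i := by
  have h0 := h.constantCoeff_logCombination a
  have h1 := constantCoeff_subst_zero h.constantCoeff_exp h0
  have := coeff_subst_of_degree_eq_one Λ h1 (d := Finsupp.single i 1) (by simp)
  rw [h.log_subst_exp_subst h0, h.coeff_one_log, one_mul, h.coeff_logCombination] at this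
  exact this.symm

end IsLinearizer

end Logarithm

/-! ### Existence and logarithms of the group law and its endomorphisms. -/

section GroupLaw

variable {A : Type*} [CommRing A] {E : Type*} [Field E] {ι : A →+* E} {π : A} {f : PowerSeries A}

lemma IsLocalUniformizer.map_pow_ne (hι : Function.Injective ι) (hπ : IsLocalUniformizer π)
    {n : ℕ} (hn : 2 ≤ n) : ι π ^ n ≠ ι π := by
  obtain ⟨k, rfl⟩ := Nat.exists_eq_add_of_le hn
  intro h
  rw [← map_pow] at h
  have h1 : π * (π ^ (k + 1) - 1) = 0 := by linear_combination hι h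
  exact hπ.ne_zero (((hπ.isUnit_pow_sub_one k).mul_left_eq_zero).1 h1)

lemma IsLubinTateSeries.coeff_one_map (hf : IsLubinTateSeries π f) :
    PowerSeries.coeff 1 (PowerSeries.map ι f) = ι π := by
  rw [PowerSeries.coeff_map, hf.coeff_one_eq]

lemma IsLubinTateSeries.constantCoeff_map (hf : IsLubinTateSeries π f) :
    PowerSeries.constantCoeff (PowerSeries.map ι f) = 0 := by
  rw [← PowerSeries.coeff_zero_eq_constantCoeff_apply, PowerSeries.coeff_map,
    PowerSeries.coeff_zero_eq_constantCoeff_apply, hf.constantCoeff_eq, map_zero]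

lemma IsLubinTateSeries.coeff_one_map_pow_ne (hι : Function.Injective ι)
    (hπ : IsLocalUniformizer π) (hf : IsLubinTateSeries π f) (n : ℕ) (hn : 2 ≤ n) :
    PowerSeries.coeff 1 (PowerSeries.map ι f) ^ n ≠
      PowerSeries.coeff 1 (PowerSeries.map ι f) := by
  rw [hf.coeff_one_map]
  exact hπ.map_pow_ne hι hn

lemma IsLubinTateSeries.isLinearizer (hι : Function.Injective ι) (hπ : IsLocalUniformizer π)
    (hf : IsLubinTateSeries π f) :
    IsLinearizer (PowerSeries.map ι f) (linearizer (PowerSeries.map ι f))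
      ((linearizer (PowerSeries.map ι f)).substInvOfIsUnit isUnit_coeff_one_linearizer) :=
  isLinearizer_linearizer hf.constantCoeff_map (hf.coeff_one_map_pow_ne hι hπ)

/-- There is a series with prescribed linear term that commutes with a Lubin-Tate series. -/
theorem IsLubinTateSeries.exists_subst_comm {σ : Type*} [Fintype σ] (hι : Function.Injective ι)
    (hπ : IsLocalUniformizer π) (hf : IsLubinTateSeries π f) (a : σ → A) :
    ∃ F : MvPowerSeries σ A, MvPowerSeries.constantCoeff F = 0 ∧
      (∀ i, MvPowerSeries.coeff (Finsupp.single i 1) F = a i) ∧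
      f.subst F = F.subst (substVars σ f) := by
  have hL := hf.isLinearizer hι hπ
  set e := (linearizer (PowerSeries.map ι f)).substInvOfIsUnit isUnit_coeff_one_linearizer
  set Λ := linearizer (PowerSeries.map ι f)
  set φ := e.subst (IsLinearizer.logCombination Λ (ι ∘ a)) with hφ
  have h0 : MvPowerSeries.constantCoeff φ = 0 :=
    constantCoeff_subst_zero hL.constantCoeff_exp (hL.constantCoeff_logCombination _)
  have hlin := hL.coeff_exp_logCombination (ι ∘ a)
  rw [← hφ] at hlin
  have hcomm := hL.subst_exp_logCombination hf.constantCoeff_map (ι ∘ a)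
  rw [← hφ] at hcomm
  -- The candidate constructed over the field commutes with f and has integral linear part, so it
  -- descends to `A`.
  choose F hF using coeff_mem_range_of_subst_comm hι hπ hf h0 (fun d hd => by
    obtain ⟨i, rfl⟩ : d ∈ Set.range fun i : σ => Finsupp.single i 1 := by
      rw [Finsupp.range_single_one]; exact hd
    exact ⟨a i, (hlin i).symm⟩) hcomm
  let F' : MvPowerSeries σ A := F
  have hF' : MvPowerSeries.map ι F' = φ := by
    ext d
    rw [MvPowerSeries.coeff_map]
    exact hF d
  have hF0 : MvPowerSeries.constantCoeff F' = 0 := by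
    apply hι
    rw [← MvPowerSeries.constantCoeff_map, hF', h0, map_zero]
  refine ⟨F', hF0, fun i => hι ?_, ?_⟩
  · rw [← MvPowerSeries.coeff_map, hF', hlin, Function.comp_apply]
  · refine MvPowerSeries.ext fun d => hι ?_
    rw [← MvPowerSeries.coeff_map, ← MvPowerSeries.coeff_map, map_subst_zero f hF0, map_substVars hf.constantCoeff_eq, hF', hcomm]

/-- Existence is what gives meaning to the choice by `Classical.epsilon`; later properties follow
from the linear part and the commutation alone. -/
theorem isGroupLawOf_groupLaw (hι : Function.Injective ι) (hπ : IsLocalUniformizer π)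
    (hf : IsLubinTateSeries π f) : IsGroupLawOf f (groupLaw f) := by
  refine Classical.epsilon_spec (p := IsGroupLawOf f) ?_
  obtain ⟨F, h0, h1, h2⟩ := hf.exists_subst_comm hι hπ (σ := Fin 2) fun _ => 1
  exact ⟨F, h0, h1 0, h1 1, h2⟩

theorem isEndoOf_endo (hι : Function.Injective ι) (hπ : IsLocalUniformizer π)
    (hf : IsLubinTateSeries π f) (a : A) : IsEndoOf f a (endo f a) := by
  refine Classical.epsilon_spec (p := IsEndoOf f a) ?_
  obtain ⟨F, h0, h1, h2⟩ := hf.exists_subst_comm hι hπ (σ := Unit) fun _ => a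
  refine ⟨F, h0, h1 (), h2.trans ?_⟩
  change F.subst (fun _ => f.subst (PowerSeries.X : PowerSeries A)) = F.subst fun _ => f
  rw [PowerSeries.X_subst]

variable {Λ e : PowerSeries E}

/-- The group law commutes with f and has linear part X + Y, so its logarithm is the combination of
Λ(X) and Λ(Y) with coefficients 1. -/
theorem log_subst_groupLaw (hι : Function.Injective ι) (hπ : IsLocalUniformizer π)
    (hf : IsLubinTateSeries π f) (hL : IsLinearizer (PowerSeries.map ι f) Λ e) :
    Λ.subst (MvPowerSeries.map ι (groupLaw f)) =
      Λ.subst (MvPowerSeries.X 0 : MvPowerSeries (Fin 2) E) +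
      Λ.subst (MvPowerSeries.X 1 : MvPowerSeries (Fin 2) E) := by
  have hF := isGroupLawOf_groupLaw hι hπ hf
  have h := hL.log_subst_eq_logCombination (φ := MvPowerSeries.map ι (groupLaw f))
    hf.constantCoeff_map (hf.coeff_one_map_pow_ne hι hπ)
    (by rw [MvPowerSeries.constantCoeff_map, hF.constantCoeff_eq, map_zero])
    (by
      rw [← map_subst_zero f hF.constantCoeff_eq, ← map_substVars hf.constantCoeff_eq, hF.comm]
      rfl)
  rw [h, IsLinearizer.logCombination, Fin.sum_univ_two, MvPowerSeries.coeff_map,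
    MvPowerSeries.coeff_map, hF.coeff_X_eq, hF.coeff_Y_eq, map_one, one_smul, one_smul]

theorem log_subst_endo (hι : Function.Injective ι) (hπ : IsLocalUniformizer π)
    (hf : IsLubinTateSeries π f) (hL : IsLinearizer (PowerSeries.map ι f) Λ e) (a : A) :
    Λ.subst (PowerSeries.map ι (endo f a)) = ι a • Λ := by
  have hF := isEndoOf_endo hι hπ hf a
  have hvar : substVars Unit (PowerSeries.map ι f) = fun _ => PowerSeries.map ι f := by
    funext i
    exact PowerSeries.X_subst _
  have h0 : PowerSeries.constantCoeff (PowerSeries.map ι (endo f a)) = 0 := by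
    rw [← PowerSeries.coeff_zero_eq_constantCoeff_apply, PowerSeries.coeff_map,
      PowerSeries.coeff_zero_eq_constantCoeff_apply, hF.constantCoeff_eq, map_zero]
  have h := hL.log_subst_eq_logCombination (σ := Unit) (φ := PowerSeries.map ι (endo f a))
    hf.constantCoeff_map (hf.coeff_one_map_pow_ne hι hπ) h0
    (by
      rw [hvar]
      exact (PowerSeries.map_subst (.of_constantCoeff_zero' hF.constantCoeff_eq) f).symm.trans
        ((congrArg (MvPowerSeries.map ι) hF.comm).trans
          (PowerSeries.map_subst (.of_constantCoeff_zero' hf.constantCoeff_eq) (endo f a))))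
  rw [h, IsLinearizer.logCombination, Finset.univ_unique, Finset.sum_singleton]
  change PowerSeries.coeff 1 (PowerSeries.map ι (endo f a)) • Λ.subst PowerSeries.X = _
  rw [PowerSeries.coeff_map, hF.coeff_one_eq, PowerSeries.X_subst]

end GroupLaw

/-! ### The logarithm as the integral of the invariant differential. -/

section LogSeries

variable {E : Type*} [Field E]

/-- The values `0` and `X` at which the first and the second variable are specialized. -/
def axisVars (E : Type*) [Field E] : Fin 2 → MvPowerSeries Unit E := ![0, PowerSeries.X]

lemma constantCoeff_axisVars (i : Fin 2) : MvPowerSeries.constantCoeff (axisVars E i) = 0 := by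
  fin_cases i
  · simp [axisVars]
  · exact PowerSeries.constantCoeff_X

lemma coeff_subst_axisVars (G : MvPowerSeries (Fin 2) E) (j : ℕ) :
    PowerSeries.coeff j (G.subst (axisVars E)) =
      MvPowerSeries.coeff (Finsupp.single 1 j) G := by
  rw [PowerSeries.coeff, MvPowerSeries.coeff_subst (hasSubst_mv constantCoeff_axisVars)]
  change (∑ᶠ d : Fin 2 →₀ ℕ, MvPowerSeries.coeff d G • PowerSeries.coeff j
    (d.prod fun i k => axisVars E i ^ k)) = _
  have hd : ∀ d : Fin 2 →₀ ℕ, (d.prod fun i k => axisVars E i ^ k) =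
      (0 : PowerSeries E) ^ d 0 * PowerSeries.X ^ d 1 := by
    intro d
    rw [Finsupp.prod_fintype _ _ (by simp), Fin.prod_univ_two]
    rfl
  simp only [hd]
  rw [finsum_eq_single _ (Finsupp.single 1 j)]
  · simp [PowerSeries.coeff_X_pow]
  · intro d hne
    rcases eq_or_ne (d 0) 0 with h0 | h0
    · rw [h0, pow_zero, one_mul, PowerSeries.coeff_X_pow, if_neg, smul_zero]
      rintro rfl
      apply hne
      ext i
      fin_cases i
      · simp [h0]
      · simp
    · rw [zero_pow h0, zero_mul, map_zero, smul_zero]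

lemma partialX_eq_subst_pderiv (F : MvPowerSeries (Fin 2) E) :
    partialX F = (MvPowerSeries.pderiv E 0 F).subst (axisVars E) := by
  ext j
  rw [coeff_subst_axisVars, MvPowerSeries.coeff_pderiv, partialX, PowerSeries.coeff_mk, add_comm]
  simp

variable {f Λ e : PowerSeries E} {F : MvPowerSeries (Fin 2) E}

/-- Differentiate Λ(F(X, Y)) = Λ(X) + Λ(Y) in X at X = 0: as F(0, Y) = Y, this reads Λ'(Y) ·
∂F/∂X(0, Y) = Λ'(0) = 1. The chain rule is carried out on the powers of F. -/
lemma derivative_log_mul_partialX (hL : IsLinearizer f Λ e)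
    (hF₀ : MvPowerSeries.constantCoeff F = 0)
    (hF : Λ.subst F = Λ.subst (MvPowerSeries.X 0 : MvPowerSeries (Fin 2) E) +
      Λ.subst (MvPowerSeries.X 1 : MvPowerSeries (Fin 2) E)) :
    PowerSeries.derivative E Λ * partialX F = 1 := by
  classical
  have hs := hasSubst_mv (constantCoeff_axisVars (E := E))
  have hF' := PowerSeries.HasSubst.of_constantCoeff_zero hF₀
  -- The neutral element law F(0, Y) = Y is not part of the defining conditions; it follows from
  -- injectivity of Λ.
  have haxis : F.subst (axisVars E) = PowerSeries.X := by
    refine hL.log_subst_injective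
      (MvPowerSeries.constantCoeff_subst_eq_zero hs constantCoeff_axisVars hF₀)
      PowerSeries.constantCoeff_X ?_
    rw [← subst_subst_mv _ hF₀ constantCoeff_axisVars, hF, ← MvPowerSeries.coe_substAlgHom hs,
      map_add, MvPowerSeries.coe_substAlgHom, subst_subst_mv _ (by simp) constantCoeff_axisVars,
      subst_subst_mv _ (by simp) constantCoeff_axisVars, MvPowerSeries.subst_X hs,
      MvPowerSeries.subst_X hs]
    change Λ.subst (0 : MvPowerSeries Unit E) + _ = _
    rw [PowerSeries.subst_zero_of_constantCoeff_zero hL.constantCoeff_log, zero_add]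
    rfl
  have hpow : ∀ k : ℕ, (MvPowerSeries.pderiv E 0 (F ^ k)).subst (axisVars E) =
      (k : E) • (PowerSeries.X ^ (k - 1) * partialX F) := by
    intro k
    rw [MvPowerSeries.pderiv_pow, partialX_eq_subst_pderiv, ← MvPowerSeries.coe_substAlgHom hs,
      map_mul, map_mul, map_pow, map_natCast, MvPowerSeries.coe_substAlgHom, haxis, mul_assoc,
      PowerSeries.smul_eq_C_mul, map_natCast]
  ext j
  -- Λ(X) + Λ(Y) has no mixed terms, so the coefficient at X Y^j vanishes unless j = 0.
  have h1 : PowerSeries.coeff j ((MvPowerSeries.pderiv E 0 (Λ.subst F)).subst (axisVars E)) =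
      PowerSeries.coeff j (1 : PowerSeries E) := by
    rw [coeff_subst_axisVars, MvPowerSeries.coeff_pderiv, hF, map_add,
      PowerSeries.coeff_subst_single, PowerSeries.coeff_subst_single]
    rcases eq_or_ne j 0 with rfl | hj
    · simp [hL.coeff_one_log]
    · have h01 : ¬ (Finsupp.single 1 j + Finsupp.single 0 1 : Fin 2 →₀ ℕ) =
          Finsupp.single 0 ((Finsupp.single 1 j + Finsupp.single 0 1 : Fin 2 →₀ ℕ) 0) := by
        intro h
        have := DFunLike.congr_fun h 1
        simp at this
        exact hj this
      have h02 : ¬ (Finsupp.single 1 j + Finsupp.single 0 1 : Fin 2 →₀ ℕ) =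
          Finsupp.single 1 ((Finsupp.single 1 j + Finsupp.single 0 1 : Fin 2 →₀ ℕ) 1) := by
        intro h
        have := DFunLike.congr_fun h 0
        simp at this
      rw [if_neg h01, if_neg h02, PowerSeries.coeff_one, if_neg hj, add_zero, zero_mul]
  rw [← h1, coeff_subst_axisVars, MvPowerSeries.coeff_pderiv, PowerSeries.coeff_subst hF',
    PowerSeries.coeff_mul, Finset.Nat.sum_antidiagonal_eq_sum_range_succ_mk]
  have hterm : ∀ k : ℕ, MvPowerSeries.coeff (Finsupp.single 1 j + Finsupp.single 0 1) (F ^ k) =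
      (k : E) * PowerSeries.coeff j (PowerSeries.X ^ (k - 1) * partialX F) := by
    intro k
    have := congrArg (PowerSeries.coeff j) (hpow k)
    rw [coeff_subst_axisVars, MvPowerSeries.coeff_pderiv, map_smul, smul_eq_mul] at this
    simpa using this
  simp only [hterm, smul_eq_mul]
  rw [finsum_eq_sum_of_support_subset (s := Finset.range (j + 1 + 1)), Finset.sum_range_succ' _ (j + 1)]
  · have : ((Finsupp.single 1 j : Fin 2 →₀ ℕ) 0 : ℕ) = 0 := by simp
    rw [this]
    simp only [Nat.cast_zero, zero_mul, mul_zero, add_zero, add_tsub_cancel_right, zero_add,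
      mul_one]
    refine Finset.sum_congr rfl fun k hk => ?_
    rw [Finset.mem_range] at hk
    rw [PowerSeries.coeff_derivative, PowerSeries.coeff_X_pow_mul', if_pos (by omega)]
    push_cast
    ring
  · intro k hk
    rw [Function.mem_support] at hk
    by_contra h
    simp only [Finset.coe_range, Set.mem_Iio, not_lt] at h
    refine hk ?_
    rw [PowerSeries.coeff_X_pow_mul', if_neg (by omega), mul_zero, mul_zero]

theorem logSeries_eq [CharZero E] (hL : IsLinearizer f Λ e)
    (hF₀ : MvPowerSeries.constantCoeff F = 0)
    (hF : Λ.subst F = Λ.subst (MvPowerSeries.X 0 : MvPowerSeries (Fin 2) E) +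
      Λ.subst (MvPowerSeries.X 1 : MvPowerSeries (Fin 2) E)) : logSeries F = Λ := by
  have h := derivative_log_mul_partialX hL hF₀ hF
  have h0 : PowerSeries.constantCoeff (partialX F) ≠ 0 := by
    intro h0
    have := congrArg PowerSeries.constantCoeff h
    rw [map_mul, h0, mul_zero, map_one] at this
    exact zero_ne_one this
  have hinv : (partialX F)⁻¹ = PowerSeries.derivative E Λ := by
    rw [PowerSeries.inv_eq_iff_mul_eq_one h0, h]
  ext n
  rw [logSeries, PowerSeries.coeff_mk, hinv]
  rcases n with _ | n
  -- In degree 0 the division by zero in `logSeries` returns 0, the right constant term.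
  · rw [Nat.cast_zero, div_zero, PowerSeries.coeff_zero_eq_constantCoeff_apply,
      hL.constantCoeff_log]
  · rw [add_tsub_cancel_right, PowerSeries.coeff_derivative, Nat.cast_succ,
      mul_div_cancel_right₀ _ (Nat.cast_add_one_ne_zero n)]

lemma expSeries_eq (hΛ : logSeries F = Λ) (h : IsUnit (PowerSeries.coeff 1 Λ)) :
    expSeries F = Λ.substInvOfIsUnit h := by
  subst hΛ
  rw [expSeries, dif_pos h]

end LogSeries

/-! ### Growth of the logarithm and the exponential. -/

section Bounds

variable {E : Type*} [NormedField E] [IsUltrametricDist E] {S : Subring E} {θ : ℝ}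
  {f Λ e : PowerSeries E}

lemma norm_pow_sub_self {x : E} (hx : ‖x‖ < 1) (n : ℕ) : ‖x ^ (n + 2) - x‖ = ‖x‖ := by
  rcases eq_or_ne x 0 with rfl | h0
  · simp
  have h1 : ‖x ^ (n + 2)‖ < ‖x‖ := by
    rw [norm_pow]
    exact pow_lt_self_of_lt_one₀ (norm_pos_iff.2 h0) hx (by omega)
  rw [sub_eq_add_neg, IsUltrametricDist.norm_add_eq_max_of_norm_ne_norm, norm_neg,
    max_eq_right h1.le]
  rw [norm_neg]
  exact h1.ne

/-- The denominator π^n - π has absolute value |π|, while f^k has Gauss norm at most (θ|π|)^k. For k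
≥ 1 the factor |π|^k absorbs the denominator, and the k = 0 term is zero. -/
lemma boundedOn_linearizer (hθ : 0 < θ) (hS : ∀ x ∈ S, x⁻¹ ∈ S)
    (hπ : ‖PowerSeries.coeff 1 f‖ < 1) (hπ₀ : PowerSeries.coeff 1 f ≠ 0)
    (hf : BoundedOn S θ (θ * ‖PowerSeries.coeff 1 f‖) f) :
    BoundedOn S θ θ (linearizer f) := by
  have hfS := (boundedOn_powerSeries_iff.1 hf).1 1
  rw [boundedOn_powerSeries_iff, ← forall_and]
  intro n
  rw [linearizer, PowerSeries.coeff_mk]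
  induction n using Nat.strong_induction_on with
  | _ n ih =>
    obtain _ | _ | n := n
    · simpa [linearizerCoeff, S.zero_mem] using hθ.le
    · simp [linearizerCoeff, S.one_mem]
    have hpow : ∀ k, BoundedOn S θ _ (f ^ k) := fun k => hf.pow hθ.le k
    rw [linearizerCoeff]
    constructor
    · rw [div_eq_mul_inv]
      refine S.mul_mem (S.neg_mem (S.sum_mem fun k _ => S.mul_mem (ih k k.2).1 ?_))
        (hS _ (S.sub_mem (S.pow_mem hfS _) hfS))
      exact (boundedOn_powerSeries_iff.1 (hpow k)).1 _
    · rw [norm_div, norm_neg, norm_pow_sub_self hπ, div_mul_eq_mul_div,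
        div_le_iff₀ (norm_pos_iff.2 hπ₀), ← le_div_iff₀ (by positivity)]
      refine IsUltrametricDist.norm_sum_le_of_forall_le_of_nonneg (by positivity) fun k _ => ?_
      rw [norm_mul, le_div_iff₀ (by positivity), mul_assoc]
      obtain ⟨k, hk⟩ := k
      obtain _ | k := k
      · simp only [linearizerCoeff, norm_zero, zero_mul]
        positivity
      have h1 := (boundedOn_powerSeries_iff.1 (hpow (k + 1))).2 (n + 2)
      have h2 := (ih (k + 1) hk).2
      calc _ ≤ ‖linearizerCoeff f (k + 1)‖ * (θ * ‖PowerSeries.coeff 1 f‖) ^ (k + 1) := by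
            gcongr
        _ = (‖linearizerCoeff f (k + 1)‖ * θ ^ (k + 1)) * ‖PowerSeries.coeff 1 f‖ ^ (k + 1) := by
            rw [mul_pow, mul_assoc]
        _ ≤ θ * ‖PowerSeries.coeff 1 f‖ := by
            gcongr
            exact pow_le_of_le_one (norm_nonneg _) hπ.le (by simp)

/-- Since Λ = X + ⋯, the identity e(Λ) = X determines the coefficients of e recursively without
division, and Λ^k has Gauss norm at most θ^k. -/
lemma IsLinearizer.boundedOn_exp (hL : IsLinearizer f Λ e) (hθ : 0 < θ)
    (hΛ : BoundedOn S θ θ Λ) : BoundedOn S θ θ e := by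
  rw [boundedOn_powerSeries_iff, ← forall_and]
  intro n
  induction n using Nat.strong_induction_on with
  | _ n ih =>
    have hpow : ∀ k, BoundedOn S θ _ (Λ ^ k) := fun k => hΛ.pow hθ.le k
    have h := congrArg (PowerSeries.coeff n) hL.exp_subst_log
    rw [coeff_subst_eq_sum _ hL.constantCoeff_log, Finset.sum_range_succ,
      coeff_pow_self hL.constantCoeff_log, hL.coeff_one_log, one_pow, mul_one,
      ← eq_sub_iff_add_eq'] at h
    have hX := boundedOn_powerSeries_iff.1 (BoundedOn.X (S := S) () hθ.le)
    rw [h]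
    constructor
    · refine S.sub_mem (hX.1 n) (S.sum_mem fun k hk => S.mul_mem (ih k (by simpa using hk)).1 ?_)
      exact (boundedOn_powerSeries_iff.1 (hpow k)).1 n
    · rw [← le_div_iff₀ (by positivity), sub_eq_add_neg]
      refine (IsUltrametricDist.norm_add_le_max _ _).trans (max_le ?_ ?_)
      · rw [le_div_iff₀ (by positivity)]
        exact hX.2 n
      · rw [norm_neg]
        refine IsUltrametricDist.norm_sum_le_of_forall_le_of_nonneg (by positivity) fun k hk => ?_
        rw [norm_mul, le_div_iff₀ (by positivity), mul_assoc]
        have h1 := (boundedOn_powerSeries_iff.1 (hpow k)).2 n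
        exact (mul_le_mul_of_nonneg_left h1 (norm_nonneg _)).trans (ih k (by simpa using hk)).2

end Bounds

/-! ### Rings of integers of finite extensions of ℚ_p. -/

section RingOfIntegers

variable {p : ℕ} [Fact p.Prime] {M : IntermediateField ℚ_[p] (PadicAlgCl p)}

lemma isComplete_intermediateField (M : IntermediateField ℚ_[p] (PadicAlgCl p))
    [FiniteDimensional ℚ_[p] M] : IsComplete (M.toSubfield.toSubring : Set (PadicAlgCl p)) := by
  have : FiniteDimensional ℚ_[p] (Subalgebra.toSubmodule M.toSubalgebra) :=
    inferInstanceAs (FiniteDimensional ℚ_[p] M)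
  exact (Subalgebra.toSubmodule M.toSubalgebra).complete_of_finiteDimensional

lemma norm_coe_le_one (x : integers M) : ‖(x : PadicAlgCl p)‖ ≤ 1 := x.2.2

lemma isUnit_integers_iff {x : integers M} : IsUnit x ↔ ‖(x : PadicAlgCl p)‖ = 1 := by
  constructor
  · rintro ⟨u, rfl⟩
    have h : ‖((u : integers M) : PadicAlgCl p)‖ * ‖((↑u⁻¹ : integers M) : PadicAlgCl p)‖ = 1 := by
      rw [← norm_mul, ← Subring.coe_mul, Units.mul_inv, Subring.coe_one, norm_one]
    refine le_antisymm (norm_coe_le_one _) ?_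
    rw [← h]
    exact mul_le_of_le_one_right (norm_nonneg _) (norm_coe_le_one _)
  · intro h
    have h0 : (x : PadicAlgCl p) ≠ 0 := by
      intro h0; rw [h0, norm_zero] at h; exact zero_ne_one h
    refine IsUnit.of_mul_eq_one ⟨(x : PadicAlgCl p)⁻¹, M.inv_mem x.2.1, by rw [norm_inv, h, inv_one]⟩
      (Subtype.ext ?_)
    exact mul_inv_cancel₀ h0

lemma dvd_integers_iff {x y : integers M} (hx : x ≠ 0) :
    x ∣ y ↔ ‖(y : PadicAlgCl p)‖ ≤ ‖(x : PadicAlgCl p)‖ := by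
  have hx' : (x : PadicAlgCl p) ≠ 0 := fun h => hx (Subtype.ext h)
  constructor
  · rintro ⟨z, rfl⟩
    rw [Subring.coe_mul, norm_mul]
    exact mul_le_of_le_one_right (norm_nonneg _) (norm_coe_le_one _)
  · intro h
    refine ⟨⟨(x : PadicAlgCl p)⁻¹ * y, M.mul_mem (M.inv_mem x.2.1) y.2.1, ?_⟩, Subtype.ext ?_⟩
    · rw [norm_mul, norm_inv]
      exact inv_mul_le_one_of_le₀ h (norm_nonneg _)
    · exact (mul_inv_cancel_left₀ hx' _).symm

variable {π : integers M}

lemma norm_irreducible_lt_one (hπ : Irreducible π) : ‖(π : PadicAlgCl p)‖ < 1 :=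
  lt_of_le_of_ne (norm_coe_le_one _) fun h => hπ.not_isUnit (isUnit_integers_iff.2 h)

lemma norm_irreducible_pos (hπ : Irreducible π) : 0 < ‖(π : PadicAlgCl p)‖ :=
  norm_pos_iff.2 fun h => hπ.ne_zero (Subtype.ext h)

/-- An x with |π| < |x| < 1 would give a factorization of π into two nonunits. Irreducibility thus
replaces any appeal to discreteness of the valuation. -/
lemma irreducible_dvd_iff (hπ : Irreducible π) {x : integers M} :
    π ∣ x ↔ ‖(x : PadicAlgCl p)‖ < 1 := by
  rw [dvd_integers_iff hπ.ne_zero]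
  refine ⟨fun h => h.trans_lt (norm_irreducible_lt_one hπ), fun h => ?_⟩
  by_contra! hlt
  have hx : x ≠ 0 := by
    rintro rfl
    exact absurd hlt (by simp)
  obtain ⟨y, hy⟩ := (dvd_integers_iff hx).2 hlt.le
  rcases hπ.isUnit_or_isUnit hy with hu | hu
  · exact h.ne (isUnit_integers_iff.1 hu)
  · rw [isUnit_integers_iff] at hu
    rw [hy, Subring.coe_mul, norm_mul, hu, mul_one] at hlt
    exact hlt.false

lemma isUnit_integers_iff_not_dvd (hπ : Irreducible π) {x : integers M} :
    IsUnit x ↔ ¬ π ∣ x := by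
  rw [irreducible_dvd_iff hπ, isUnit_integers_iff, not_lt]
  exact ⟨fun h => h.ge, fun h => le_antisymm (norm_coe_le_one _) h⟩

instance : IsLocalRing (integers M) := by
  refine .of_nonunits_add fun a b ha hb => ?_
  rw [mem_nonunits_iff, isUnit_integers_iff] at *
  refine ne_of_lt ((IsUltrametricDist.norm_add_le_max _ _).trans_lt (max_lt ?_ ?_))
  exacts [lt_of_le_of_ne (norm_coe_le_one _) ha, lt_of_le_of_ne (norm_coe_le_one _) hb]

lemma maximalIdeal_eq_span (hπ : Irreducible π) :
    IsLocalRing.maximalIdeal (integers M) = Ideal.span {π} := by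
  ext x
  rw [IsLocalRing.mem_maximalIdeal, mem_nonunits_iff, isUnit_integers_iff_not_dvd hπ, not_not,
    Ideal.mem_span_singleton]

/-- The ring of integers is compact, being a closed ball in a finite-dimensional space, and the
ideal (π) is open. -/
lemma finite_quotient_span [FiniteDimensional ℚ_[p] M] (hπ : Irreducible π) :
    Finite (integers M ⧸ Ideal.span {π}) := by
  let N := Subalgebra.toSubmodule M.toSubalgebra
  have : FiniteDimensional ℚ_[p] N := inferInstanceAs (FiniteDimensional ℚ_[p] M)
  have : ProperSpace N := FiniteDimensional.proper ℚ_[p] N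
  have hc : CompactSpace (integers M) := by
    refine isCompact_iff_compactSpace.1 (?_ : IsCompact (integers M : Set (PadicAlgCl p)))
    have h := (isCompact_closedBall (0 : N) 1).image continuous_subtype_val
    convert h using 1
    ext x
    simp only [Set.mem_image, Metric.mem_closedBall, dist_zero_right]
    constructor
    · intro hx
      exact ⟨⟨x, hx.1⟩, hx.2, rfl⟩
    · rintro ⟨y, hy, rfl⟩
      exact ⟨y.2, hy⟩
  refine AddSubgroup.quotient_finite_of_isOpen (Ideal.span {π}).toAddSubgroup ?_
  have : ((Ideal.span {π}).toAddSubgroup : Set (integers M)) =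
      (fun x : integers M => ‖(x : PadicAlgCl p)‖) ⁻¹' Set.Iio 1 := by
    ext x
    simp only [Submodule.coe_toAddSubgroup, SetLike.mem_coe, Set.mem_preimage, Set.mem_Iio]
    rw [Ideal.mem_span_singleton, irreducible_dvd_iff hπ]
  rw [this]
  exact isOpen_Iio.preimage continuous_subtype_val.norm

lemma isLocalUniformizer [FiniteDimensional ℚ_[p] M] (hπ : Irreducible π) :
    IsLocalUniformizer π where
  ne_zero := hπ.ne_zero
  isUnit_pow_sub_one n := by
    rw [isUnit_integers_iff_not_dvd hπ]
    intro h
    have h1 : π ∣ 1 := by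
      have := (dvd_pow_self π n.succ_ne_zero).sub h
      rwa [Nat.succ_eq_add_one, sub_sub_cancel] at this
    exact hπ.not_isUnit (isUnit_of_dvd_one h1)
  isMaximal := by
    rw [← maximalIdeal_eq_span hπ]
    infer_instance
  finite := finite_quotient_span hπ

lemma dvd_natCard_quotient [FiniteDimensional ℚ_[p] M] (hπ : Irreducible π) :
    π ∣ ((Nat.card (integers M ⧸ Ideal.span {π}) : ℕ) : integers M) := by
  rw [← Ideal.mem_span_singleton, ← Ideal.Quotient.eq_zero_iff_mem, map_natCast]
  have := finite_quotient_span hπ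
  have := Fintype.ofFinite (integers M ⧸ Ideal.span {π})
  rw [Nat.card_eq_fintype_card, Nat.cast_card_eq_zero]

lemma two_le_natCard_quotient [FiniteDimensional ℚ_[p] M] (hπ : Irreducible π) :
    2 ≤ Nat.card (integers M ⧸ Ideal.span {π}) := by
  have := (isLocalUniformizer hπ).finite
  have : Nontrivial (integers M ⧸ Ideal.span {π}) :=
    Ideal.Quotient.nontrivial_iff.2 (isLocalUniformizer hπ).isMaximal.ne_top
  exact Finite.one_lt_card

lemma mem_span_pow_iff (hπ : Irreducible π) {n : ℕ} {x : integers M} :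
    x ∈ Ideal.span {π} ^ n ↔ ‖(x : PadicAlgCl p)‖ ≤ ‖(π : PadicAlgCl p)‖ ^ n := by
  rw [Ideal.span_singleton_pow, Ideal.mem_span_singleton,
    dvd_integers_iff (pow_ne_zero n hπ.ne_zero), Subring.coe_pow, norm_pow]

/-- By `mem_span_pow_iff` the π-adic filtration is the filtration by absolute value, so completeness
of the field suffices. Weierstrass preparation requires this. -/
lemma isAdicComplete_integers [FiniteDimensional ℚ_[p] M] (hπ : Irreducible π) :
    IsAdicComplete (IsLocalRing.maximalIdeal (integers M)) (integers M) := by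
  rw [maximalIdeal_eq_span hπ]
  have hlim : Filter.Tendsto (fun n => ‖(π : PadicAlgCl p)‖ ^ n) Filter.atTop (nhds 0) :=
    tendsto_pow_atTop_nhds_zero_of_lt_one (norm_nonneg _) (norm_irreducible_lt_one hπ)
  have hmod : ∀ {n : ℕ} {x y : integers M},
      x ≡ y [SMOD (Ideal.span {π} ^ n • ⊤ : Submodule (integers M) (integers M))] ↔
        ‖(x : PadicAlgCl p) - y‖ ≤ ‖(π : PadicAlgCl p)‖ ^ n := by
    intro n x y
    rw [SModEq.sub_mem, smul_eq_mul, Ideal.mul_top, mem_span_pow_iff hπ, AddSubgroupClass.coe_sub]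
  rw [isAdicComplete_iff]
  constructor
  · constructor
    intro x hx
    simp only [hmod, Subring.coe_zero, sub_zero] at hx
    have := ge_of_tendsto' hlim hx
    exact Subtype.ext (norm_le_zero_iff.1 this)
  · constructor
    intro f hf
    simp only [hmod] at hf ⊢
    have hcauchy : CauchySeq fun n => (f n : PadicAlgCl p) := by
      refine cauchySeq_of_le_tendsto_0 _ (fun m n N hm hn => ?_) hlim
      rw [dist_eq_norm]
      have h1 := hf hm
      have h2 := hf hn
      rw [norm_sub_rev] at h1
      calc _ = ‖((f m : PadicAlgCl p) - f N) + (f N - f n)‖ := by rw [sub_add_sub_cancel]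
        _ ≤ _ := (IsUltrametricDist.norm_add_le_max _ _).trans (max_le h1 h2)
    obtain ⟨a, haM, ha⟩ := cauchySeq_tendsto_of_isComplete (isComplete_intermediateField M)
      (fun n => (f n).2.1) hcauchy
    have ha1 : ‖a‖ ≤ 1 := le_of_tendsto' ha.norm fun n => norm_coe_le_one _
    refine ⟨⟨a, haM, ha1⟩, fun n => ?_⟩
    refine le_of_tendsto (tendsto_const_nhds.sub ha).norm ?_
    filter_upwards [Filter.eventually_ge_atTop n] with m hm using hf hm

end RingOfIntegers

/-! ### Evaluation of power series in the open unit disc. -/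

section Evaluation

variable {E : Type*} [NormedField E]

/-- The value of a power series at a point. -/
def evalAt (z : E) (u : PowerSeries E) : E :=
  PowerSeries.constantCoeff (comp u (PowerSeries.C z))

lemma evalAt_eq_tsum (z : E) (u : PowerSeries E) :
    evalAt z u = ∑' k : ℕ, PowerSeries.coeff k u * z ^ k := by
  rw [evalAt, ← PowerSeries.coeff_zero_eq_constantCoeff_apply, comp, PowerSeries.coeff_mk]
  simp only [← map_pow, PowerSeries.coeff_zero_C]

lemma evalAt_one (z : E) : evalAt z 1 = 1 := by
  rw [evalAt, comp_eq_mvComp, show (1 : PowerSeries E) = (1 : MvPowerSeries Unit E) from rfl,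
    mvComp_one]
  exact map_one _

lemma evalAt_coe (z : E) (g : Polynomial E) : evalAt z (g : PowerSeries E) = g.eval z := by
  rw [evalAt_eq_tsum, Polynomial.eval_eq_sum_range, tsum_eq_sum (s := Finset.range (g.natDegree + 1))]
  · simp only [Polynomial.coeff_coe]
  · intro k hk
    rw [Polynomial.coeff_coe, Polynomial.coeff_eq_zero_of_natDegree_lt, zero_mul]
    simpa [Nat.lt_succ_iff] using hk

variable {S : Subring E} {z : E} {u v : PowerSeries E}

lemma boundedOn_C {t : ℝ} (hz : z ∈ S) : BoundedOn S t ‖z‖ (PowerSeries.C z) := by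
  rw [boundedOn_powerSeries_iff]
  constructor
  · intro n
    rw [PowerSeries.coeff_C]
    split_ifs
    exacts [hz, S.zero_mem]
  · intro n
    rw [PowerSeries.coeff_C]
    split_ifs with h
    · simp [h]
    · simp

variable [IsUltrametricDist E]

lemma evalAt_mul (hS : IsComplete (S : Set E)) (hz : z ∈ S) (hz1 : ‖z‖ < 1)
    (hu : BoundedOn S 1 1 u) (hv : BoundedOn S 1 1 v) :
    evalAt z (u * v) = evalAt z u * evalAt z v := by
  simp only [evalAt, comp_eq_mvComp]
  have := mvComp_mul (τ := Unit) hS one_pos (norm_nonneg z) hz1 hu hv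
    fun _ : Unit => boundedOn_C hz
  exact (congrArg _ this).trans (map_mul _ _ _)

lemma evalAt_add (hS : IsComplete (S : Set E)) (hz : z ∈ S) (hz1 : ‖z‖ < 1)
    (hu : BoundedOn S 1 1 u) (hv : BoundedOn S 1 1 v) :
    evalAt z (u + v) = evalAt z u + evalAt z v := by
  simp only [evalAt, comp_eq_mvComp]
  have := mvComp_add (τ := Unit) hS one_pos (norm_nonneg z) hz1 hu hv
    fun _ : Unit => boundedOn_C hz
  exact (congrArg _ this).trans (map_add _ _ _)

end Evaluation

/-! ### Zeros of a Lubin–Tate series. -/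

section Zeros

variable {p : ℕ} [Fact p.Prime] {M : IntermediateField ℚ_[p] (PadicAlgCl p)}

/-- Supplies a complete field in which series over `M` can be evaluated at the given points. -/
lemma exists_finiteDimensional_extension (M : IntermediateField ℚ_[p] (PadicAlgCl p))
    [FiniteDimensional ℚ_[p] M] (s : Finset (PadicAlgCl p)) :
    ∃ N : IntermediateField ℚ_[p] (PadicAlgCl p), FiniteDimensional ℚ_[p] N ∧ M ≤ N ∧
      ∀ z ∈ s, z ∈ N := by
  have : FiniteDimensional ℚ_[p] (IntermediateField.adjoin ℚ_[p] (s : Set (PadicAlgCl p))) :=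
    IntermediateField.finiteDimensional_adjoin fun x _ => Algebra.IsIntegral.isIntegral x
  refine ⟨M ⊔ IntermediateField.adjoin ℚ_[p] (s : Set (PadicAlgCl p)),
    IntermediateField.finiteDimensional_sup _ _, le_sup_left, fun z hz => ?_⟩
  exact (le_sup_right : _ ≤ M ⊔ _) (IntermediateField.subset_adjoin _ _ hz)

lemma coeff_ofIntegers (u : PowerSeries (integers M)) (n : ℕ) :
    PowerSeries.coeff n (ofIntegers u) = ((PowerSeries.coeff n u : integers M) : PadicAlgCl p) :=
  PowerSeries.coeff_map _ _ _

lemma ofIntegers_mul (u v : PowerSeries (integers M)) :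
    ofIntegers (u * v) = ofIntegers u * ofIntegers v := map_mul _ u v

lemma ofIntegers_one : ofIntegers (1 : PowerSeries (integers M)) = 1 := map_one _

lemma ofIntegers_coe (g : Polynomial (integers M)) :
    ofIntegers (g : PowerSeries (integers M)) =
      (g.map (integers M).subtype : PowerSeries (PadicAlgCl p)) := by
  rw [ofIntegers, Polynomial.polynomial_map_coe]

lemma boundedOn_ofIntegers {N : IntermediateField ℚ_[p] (PadicAlgCl p)} (hMN : M ≤ N)
    (u : PowerSeries (integers M)) : BoundedOn N.toSubfield.toSubring 1 1 (ofIntegers u) := by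
  rw [boundedOn_powerSeries_iff]
  refine ⟨fun n => ?_, fun n => ?_⟩
  · rw [coeff_ofIntegers]
    have h : ((PowerSeries.coeff n u : integers M) : PadicAlgCl p) ∈ M :=
      (PowerSeries.coeff n u : integers M).2.1
    exact hMN h
  · rw [coeff_ofIntegers, one_pow, mul_one]
    exact norm_coe_le_one _

lemma evalAt_ofIntegers_mul [FiniteDimensional ℚ_[p] M] {z : PadicAlgCl p} (hz : ‖z‖ < 1)
    (u v : PowerSeries (integers M)) :
    evalAt z (ofIntegers (u * v)) = evalAt z (ofIntegers u) * evalAt z (ofIntegers v) := by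
  obtain ⟨N, hN, hMN, hzN⟩ := exists_finiteDimensional_extension M {z}
  rw [ofIntegers_mul]
  exact evalAt_mul (isComplete_intermediateField N) (hzN z (by simp)) hz
    (boundedOn_ofIntegers hMN u) (boundedOn_ofIntegers hMN v)

lemma evalAt_ofIntegers_add [FiniteDimensional ℚ_[p] M] {z : PadicAlgCl p} (hz : ‖z‖ < 1)
    (u v : PowerSeries (integers M)) :
    evalAt z (ofIntegers (u + v)) = evalAt z (ofIntegers u) + evalAt z (ofIntegers v) := by
  obtain ⟨N, hN, hMN, hzN⟩ := exists_finiteDimensional_extension M {z}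
  have : ofIntegers (u + v) = ofIntegers u + ofIntegers v := map_add _ u v
  rw [this]
  exact evalAt_add (isComplete_intermediateField N) (hzN z (by simp)) hz
    (boundedOn_ofIntegers hMN u) (boundedOn_ofIntegers hMN v)

lemma evalAt_ofIntegers_ne_zero [FiniteDimensional ℚ_[p] M] {z : PadicAlgCl p} (hz : ‖z‖ < 1)
    {u : PowerSeries (integers M)} (hu : IsUnit u) : evalAt z (ofIntegers u) ≠ 0 := by
  obtain ⟨v, hv⟩ := hu.exists_right_inv
  intro h
  have := evalAt_ofIntegers_mul hz u v
  rw [hv, ofIntegers_one, evalAt_one, h, zero_mul] at this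
  exact one_ne_zero this

lemma mem_zeroSet_iff {f : PowerSeries (integers M)} {z : PadicAlgCl p} :
    z ∈ zeroSet f ↔ ‖z‖ < 1 ∧ evalAt z (ofIntegers f) = 0 := by
  rw [evalAt_eq_tsum]
  simp only [coeff_ofIntegers]
  exact Iff.rfl

lemma norm_lt_one_of_mem_zeros {f : PowerSeries (integers M)} {z : PadicAlgCl p}
    (hz : z ∈ zeros f) : ‖z‖ < 1 := by
  rw [zeros] at hz
  split_ifs at hz with h
  · rw [Set.Finite.mem_toFinset] at hz
    exact hz.1
  · simp at hz

variable {π : integers M} {f : PowerSeries (integers M)}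

lemma IsLubinTateSeries.map_residue (hπ : Irreducible π) (hf : IsLubinTateSeries π f) :
    PowerSeries.map (IsLocalRing.residue (integers M)) f =
      PowerSeries.X ^ Nat.card (integers M ⧸ Ideal.span {π}) := by
  obtain ⟨g, hg⟩ := hf.dvd_sub
  rw [sub_eq_iff_eq_add] at hg
  have h : IsLocalRing.residue (integers M) π = 0 := by
    rw [IsLocalRing.residue_eq_zero_iff, maximalIdeal_eq_span hπ]
    exact Ideal.mem_span_singleton_self π
  rw [hg, map_add, map_mul, PowerSeries.map_C, h, map_zero, zero_mul, zero_add, map_pow,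
    PowerSeries.map_X]

-- For |z| ≥ 1 the leading term strictly dominates, since every lower coefficient is divisible by π.
open Polynomial in
lemma norm_root_lt_one (hπ : Irreducible π) {g : (integers M)[X]}
    (hg : g.IsDistinguishedAt (IsLocalRing.maximalIdeal (integers M))) {z : PadicAlgCl p}
    (hz : (g.map (integers M).subtype).eval z = 0) : ‖z‖ < 1 := by
  by_contra! h1
  have hm : (g.map (integers M).subtype).Monic := hg.monic.map _
  rw [eval_eq_sum_range, Finset.sum_range_succ, hm.coeff_natDegree, one_mul,
    hg.monic.natDegree_map] at hz
  have hz' : z ^ g.natDegree = -∑ i ∈ Finset.range g.natDegree,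
      (g.map (integers M).subtype).coeff i * z ^ i := by linear_combination hz
  have hle : ‖z ^ g.natDegree‖ ≤ ‖(π : PadicAlgCl p)‖ * ‖z‖ ^ g.natDegree := by
    rw [hz', norm_neg]
    refine IsUltrametricDist.norm_sum_le_of_forall_le_of_nonneg (by positivity) fun i hi => ?_
    rw [Finset.mem_range] at hi
    have hmem := hg.mem hi
    rw [maximalIdeal_eq_span hπ, Ideal.mem_span_singleton, dvd_integers_iff hπ.ne_zero] at hmem
    rw [norm_mul, norm_pow, coeff_map]
    exact mul_le_mul hmem (pow_le_pow_right₀ h1 hi.le) (by positivity) (norm_nonneg _)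
  rw [norm_pow] at hle
  have hpos : 0 < ‖z‖ ^ g.natDegree := by positivity
  have := norm_irreducible_lt_one hπ
  nlinarith

variable [FiniteDimensional ℚ_[p] M]

/-- The derivative of a Lubin-Tate series is the uniformizer times an invertible series. -/
lemma IsLubinTateSeries.exists_derivative_eq (hπ : Irreducible π) (hf : IsLubinTateSeries π f) :
    ∃ w : PowerSeries (integers M), IsUnit w ∧
      PowerSeries.derivative (integers M) f = PowerSeries.C π * w := by
  have hdvd : ∀ n, π ∣ PowerSeries.coeff n (PowerSeries.derivative (integers M) f) := by
    intro n
    obtain ⟨g, hg⟩ := hf.dvd_sub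
    rw [sub_eq_iff_eq_add] at hg
    rw [PowerSeries.coeff_derivative, hg, map_add, PowerSeries.coeff_C_mul,
      PowerSeries.coeff_X_pow, add_mul, mul_assoc]
    refine dvd_add (dvd_mul_right _ _) ?_
    -- The power X^q contributes the coefficient q in degree q - 1, and π divides q.
    split_ifs with h
    · rw [one_mul]
      have := dvd_natCard_quotient hπ
      rw [← h] at this
      exact_mod_cast this
    · rw [zero_mul]
      exact dvd_zero _
  choose w hw using hdvd
  have heq : PowerSeries.derivative (integers M) f = PowerSeries.C π * PowerSeries.mk w := by
    ext1 n
    rw [hw, PowerSeries.coeff_C_mul, PowerSeries.coeff_mk]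
  refine ⟨PowerSeries.mk w, ?_, heq⟩
  rw [PowerSeries.isUnit_iff_constantCoeff, ← PowerSeries.coeff_zero_eq_constantCoeff_apply,
    PowerSeries.coeff_mk]
  have h0 := hw 0
  rw [PowerSeries.coeff_derivative, zero_add, hf.coeff_one_eq, Nat.cast_zero, zero_add,
    mul_one] at h0
  have : w 0 = 1 := mul_left_cancel₀ hπ.ne_zero (by rw [← h0, mul_one])
  rw [this]
  exact isUnit_one

open Polynomial in
/-- A Lubin-Tate series has exactly `q` zeros in the maximal ideal. -/
theorem card_zeros (hπ : Irreducible π) (hf : IsLubinTateSeries π f) :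
    (zeros f).card = Nat.card (integers M ⧸ Ideal.span {π}) := by
  classical
  have := isAdicComplete_integers hπ
  have hres := hf.map_residue hπ
  have hne : PowerSeries.map (IsLocalRing.residue (integers M)) f ≠ 0 := by
    rw [hres]
    exact pow_ne_zero _ PowerSeries.X_ne_zero
  -- f is a distinguished polynomial g times a unit h. The degree of g is q because f reduces to
  -- X^q, and the roots of g are the zeros of f in the disc.
  obtain ⟨g, h, H⟩ := PowerSeries.exists_isWeierstrassFactorization hne
  have hdeg : g.natDegree = Nat.card (integers M ⧸ Ideal.span {π}) := by
    rw [H.natDegree_eq_toNat_order_map, hres, PowerSeries.order_X_pow, ENat.toNat_natCast]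
  set G := g.map (integers M).subtype with hG
  have hGm : G.Monic := H.isDistinguishedAt.monic.map _
  have heval : ∀ {z : PadicAlgCl p}, ‖z‖ < 1 →
      evalAt z (ofIntegers f) = G.eval z * evalAt z (ofIntegers h) := by
    intro z hz
    rw [H.eq_mul, evalAt_ofIntegers_mul hz, ofIntegers_coe, evalAt_coe]
  have hset : zeroSet f = (G.roots.toFinset : Set (PadicAlgCl p)) := by
    ext z
    rw [mem_zeroSet_iff, Finset.mem_coe, Multiset.mem_toFinset, mem_roots hGm.ne_zero, IsRoot.def]
    constructor
    · rintro ⟨hz, h0⟩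
      rw [heval hz] at h0
      exact (mul_eq_zero.1 h0).resolve_right (evalAt_ofIntegers_ne_zero hz H.isUnit)
    · intro h0
      have hz := norm_root_lt_one hπ H.isDistinguishedAt h0
      exact ⟨hz, by rw [heval hz, h0, zero_mul]⟩
  have hfin : (zeroSet f).Finite := hset ▸ Finset.finite_toSet _
  have hzeros : zeros f = G.roots.toFinset := by
    rw [zeros, dif_pos hfin]
    ext z
    rw [Set.Finite.mem_toFinset, hset, Finset.mem_coe]
  -- A multiple root would be a zero of f' = π w, which is impossible as w is invertible.
  have hnodup : G.roots.Nodup := by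
    rw [Multiset.nodup_iff_count_le_one]
    intro z
    rw [count_roots]
    by_contra! hlt
    obtain ⟨h0, h1⟩ := (one_lt_rootMultiplicity_iff_isRoot hGm.ne_zero).1 hlt
    have hz := norm_root_lt_one hπ H.isDistinguishedAt h0
    obtain ⟨w, hw, hfw⟩ := hf.exists_derivative_eq hπ
    have h2 : PowerSeries.derivative (integers M) f =
        (g : PowerSeries (integers M)) * PowerSeries.derivative (integers M) h +
          h * ((derivative g : (integers M)[X]) : PowerSeries (integers M)) := by
      rw [H.eq_mul, Derivation.leibniz, PowerSeries.derivative_coe, smul_eq_mul, smul_eq_mul]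
    have h3 := congrArg (fun u => evalAt z (ofIntegers u)) (hfw.symm.trans h2)
    simp only [evalAt_ofIntegers_add hz, evalAt_ofIntegers_mul hz, ofIntegers_coe, evalAt_coe]
      at h3
    rw [← hG, h0, zero_mul, zero_add, ← derivative_map, ← hG, h1, mul_zero] at h3
    refine mul_ne_zero ?_ (evalAt_ofIntegers_ne_zero hz hw) h3
    have hC : ofIntegers (PowerSeries.C π) = (C (π : PadicAlgCl p) : (PadicAlgCl p)[X]) := by
      rw [ofIntegers, PowerSeries.map_C, Polynomial.coe_C]
      rfl
    rw [hC, evalAt_coe, eval_C]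
    exact norm_pos_iff.1 (norm_irreducible_pos hπ)
  rw [hzeros, Multiset.toFinset_card_of_nodup hnodup,
    IsAlgClosed.card_roots_eq_natDegree, H.isDistinguishedAt.monic.natDegree_map, hdeg]

end Zeros

/-! ### Constant terms modulo elements smaller than ϖ. -/

section Congruences

variable {E : Type*} [NormedField E] [IsUltrametricDist E] {S : Subring E} {ϖ t ρ : ℝ}

/-- The additive group of the elements of absolute value less than `ϖ`. -/
def smallElements (E : Type*) [NormedField E] [IsUltrametricDist E] (ϖ : ℝ) (hϖ : 0 < ϖ) :
    AddSubgroup E where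
  carrier := {x | ‖x‖ < ϖ}
  zero_mem' := by simpa using hϖ
  add_mem' ha hb := (IsUltrametricDist.norm_add_le_max _ _).trans_lt (max_lt ha hb)
  neg_mem' ha := by simpa using ha

lemma mem_smallElements {hϖ : 0 < ϖ} {x : E} : x ∈ smallElements E ϖ hϖ ↔ ‖x‖ < ϖ := Iff.rfl

/-- G - P starts in degree 2, so at arguments of size at most ϖ it takes values of size at most ϖ² <
ϖ. -/
lemma norm_constantCoeff_mvComp_sub_lt {σ : Type*} [Finite σ] (hS : IsComplete (S : Set E))
    (hϖ : 0 < ϖ) (hϖ1 : ϖ < 1) {G P : MvPowerSeries σ E} (hG : BoundedOn S 1 1 G)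
    (hP : BoundedOn S 1 1 P)
    (hGP : ∀ d : σ →₀ ℕ, d.degree ≤ 1 → MvPowerSeries.coeff d G = MvPowerSeries.coeff d P)
    {r : σ → MvPowerSeries Unit E} (hr : ∀ i, BoundedOn S 1 ϖ (r i)) :
    ‖MvPowerSeries.constantCoeff (mvComp G r) - MvPowerSeries.constantCoeff (mvComp P r)‖ < ϖ := by
  have hQ : BoundedOn S 1 1 (G - P) := hG.sub zero_le_one hP
  have hQ' : BoundedOn S ϖ (ϖ ^ 2) (G - P) := by
    refine ⟨hQ.coeff_mem, fun d => ?_⟩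
    by_cases hd : d.degree ≤ 1
    · rw [map_sub, hGP d hd, sub_self, norm_zero, zero_mul]
      positivity
    · calc _ ≤ 1 * ϖ ^ d.degree := by
            gcongr
            exact hQ.norm_coeff_le d
        _ ≤ ϖ ^ 2 := by
            rw [one_mul]
            exact pow_le_pow_of_le_one hϖ.le hϖ1.le (by omega)
  have hadd := mvComp_add hS one_pos hϖ.le hϖ1 hQ hP hr
  rw [sub_add_cancel] at hadd
  rw [hadd, map_add, add_sub_cancel_right]
  refine (BoundedOn.mvComp hS one_pos hQ' hr).norm_constantCoeff_le.trans_lt ?_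
  nlinarith

lemma BoundedOn.formalAdd (hS : IsComplete (S : Set E)) (hϖ : 0 ≤ ϖ) (hϖ1 : ϖ ≤ 1)
    {F : MvPowerSeries (Fin 2) E} (hF : BoundedOn S 1 1 F)
    (hF₀ : MvPowerSeries.constantCoeff F = 0) {u v : PowerSeries E} (ht : 0 < t)
    (hu : BoundedOn S t ϖ u) (hv : BoundedOn S t ϖ v) : BoundedOn S t ϖ (formalAdd F u v) := by
  rw [formalAdd_eq_mvComp]
  refine BoundedOn.mvComp hS ht (hF.self_of_le one_pos hF₀ hϖ hϖ1) ?_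
  simpa [Fin.forall_fin_two] using And.intro hu hv

lemma BoundedOn.formalSum (hS : IsComplete (S : Set E)) (hϖ : 0 ≤ ϖ) (hϖ1 : ϖ ≤ 1)
    {F : MvPowerSeries (Fin 2) E} (hF : BoundedOn S 1 1 F)
    (hF₀ : MvPowerSeries.constantCoeff F = 0) {l : List (PowerSeries E)} (ht : 0 < t)
    (hl : ∀ u ∈ l, BoundedOn S t ϖ u) : BoundedOn S t ϖ (formalSum F l) := by
  induction l with
  | nil => exact .zero hϖ
  | cons u l ih =>
    simp only [List.forall_mem_cons] at hl
    exact .formalAdd hS hϖ hϖ1 hF hF₀ ht hl.1 (ih hl.2)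

lemma norm_constantCoeff_formalAdd_sub_lt (hS : IsComplete (S : Set E)) (hϖ : 0 < ϖ) (hϖ1 : ϖ < 1)
    {F : MvPowerSeries (Fin 2) E} (hF : BoundedOn S 1 1 F)
    (hF₀ : MvPowerSeries.constantCoeff F = 0)
    (hFX : ∀ i, MvPowerSeries.coeff (Finsupp.single i 1) F = 1) {u v : PowerSeries E}
    (hu : BoundedOn S 1 ϖ u) (hv : BoundedOn S 1 ϖ v) :
    ‖PowerSeries.constantCoeff (formalAdd F u v) -
      (PowerSeries.constantCoeff u + PowerSeries.constantCoeff v)‖ < ϖ := by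
  classical
  have hX : ∀ i : Fin 2, BoundedOn S 1 1 (MvPowerSeries.X i : MvPowerSeries (Fin 2) E) :=
    fun i => .X i zero_le_one
  have hr : ∀ i, BoundedOn S 1 ϖ ((![u, v] : Fin 2 → MvPowerSeries Unit E) i) := by
    simpa [Fin.forall_fin_two] using And.intro hu hv
  have h := norm_constantCoeff_mvComp_sub_lt hS hϖ hϖ1 hF ((hX 0).add zero_le_one (hX 1)) ?_ hr
  · rw [mvComp_add hS one_pos hϖ.le hϖ1 (hX 0) (hX 1) hr, mvComp_X, mvComp_X,
      ← formalAdd_eq_mvComp] at h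
    exact h
  · intro d hd
    rcases Nat.le_one_iff_eq_zero_or_eq_one.1 hd with hd | hd
    · rw [Finsupp.degree_eq_zero_iff] at hd
      rw [hd, MvPowerSeries.coeff_zero_eq_constantCoeff_apply,
        MvPowerSeries.coeff_zero_eq_constantCoeff_apply, hF₀]
      simp
    · obtain ⟨i, rfl⟩ : d ∈ Set.range fun i : Fin 2 => Finsupp.single i 1 := by
        rw [Finsupp.range_single_one]; exact hd
      rw [hFX, map_add, MvPowerSeries.coeff_X, MvPowerSeries.coeff_X]
      fin_cases i <;> simp [Finsupp.single_left_inj]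

lemma norm_constantCoeff_formalSum_sub_lt (hS : IsComplete (S : Set E)) (hϖ : 0 < ϖ) (hϖ1 : ϖ < 1)
    {F : MvPowerSeries (Fin 2) E} (hF : BoundedOn S 1 1 F)
    (hF₀ : MvPowerSeries.constantCoeff F = 0)
    (hFX : ∀ i, MvPowerSeries.coeff (Finsupp.single i 1) F = 1) {l : List (PowerSeries E)}
    (hl : ∀ u ∈ l, BoundedOn S 1 ϖ u) :
    PowerSeries.constantCoeff (formalSum F l) - (l.map PowerSeries.constantCoeff).sum ∈
      smallElements E ϖ hϖ := by
  induction l with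
  | nil =>
    simp [formalSum, zero_mem]
  | cons u l ih =>
    simp only [List.forall_mem_cons] at hl
    have h1 : PowerSeries.constantCoeff (formalAdd F u (formalSum F l)) -
        (PowerSeries.constantCoeff u + PowerSeries.constantCoeff (formalSum F l)) ∈
          smallElements E ϖ hϖ :=
      norm_constantCoeff_formalAdd_sub_lt hS hϖ hϖ1 hF hF₀ hFX hl.1
        (.formalSum hS hϖ.le hϖ1.le hF hF₀ one_pos hl.2)
    have h2 := add_mem h1 (ih hl.2)
    rw [List.map_cons, List.sum_cons]
    convert h2 using 1
    change PowerSeries.constantCoeff (formalAdd F u (formalSum F l)) - _ = _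
    ring

lemma norm_constantCoeff_comp_linear_sub_lt (hS : IsComplete (S : Set E)) (hϖ : 0 < ϖ)
    (hϖ1 : ϖ < 1) {c u : PowerSeries E} (hc : BoundedOn S 1 1 c)
    (hc₀ : PowerSeries.constantCoeff c = 0) (hu : BoundedOn S 1 ϖ u) :
    ‖PowerSeries.constantCoeff (comp c u) -
      PowerSeries.coeff 1 c * PowerSeries.constantCoeff u‖ < ϖ := by
  have hc' := boundedOn_powerSeries_iff.1 hc
  have hP : BoundedOn S 1 1 (PowerSeries.coeff 1 c • (PowerSeries.X : PowerSeries E)) := by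
    rw [boundedOn_powerSeries_iff]
    refine ⟨fun n => ?_, fun n => ?_⟩
    · rw [PowerSeries.coeff_smul, PowerSeries.coeff_X]
      split_ifs
      · simpa using hc'.1 1
      · simp [S.zero_mem]
    · rw [PowerSeries.coeff_smul, PowerSeries.coeff_X]
      split_ifs
      · simpa using hc'.2 1
      · simp
  have h := norm_constantCoeff_mvComp_sub_lt hS hϖ hϖ1 hc hP ?_ fun _ : Unit => hu
  · have h1 := comp_smul (PowerSeries.coeff 1 c) PowerSeries.X u
    rw [comp_X, comp_eq_mvComp] at h1
    rw [comp_eq_mvComp]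
    rw [h1] at h
    have h2 : PowerSeries.constantCoeff (PowerSeries.coeff 1 c • u) =
        PowerSeries.coeff 1 c * PowerSeries.constantCoeff u := by
      rw [PowerSeries.smul_eq_C_mul, map_mul, PowerSeries.constantCoeff_C]
    rw [← h2]
    exact h
  · intro d hd
    have hd' : d = Finsupp.single () (d ()) := by ext; simp
    rw [hd', Finsupp.degree_single] at hd
    rw [hd']
    change PowerSeries.coeff (d ()) c = PowerSeries.coeff (d ()) _
    generalize d () = k at hd
    rw [PowerSeries.coeff_smul, PowerSeries.coeff_X]
    rcases Nat.le_one_iff_eq_zero_or_eq_one.1 hd with hd | hd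
    · rw [hd, PowerSeries.coeff_zero_eq_constantCoeff_apply, hc₀]
      simp
    · rw [hd]
      simp

lemma comp_add_left (hS : IsComplete (S : Set E)) {C C' : ℝ} {u v h : PowerSeries E}
    (ht : 0 < t) (hρ : ρ < 1) (hu : BoundedOn S 1 C u) (hv : BoundedOn S 1 C' v)
    (hh : BoundedOn S t ρ h) : comp (u + v) h = comp u h + comp v h := by
  simp only [comp_eq_mvComp]
  exact mvComp_add hS ht hh.nonneg hρ (hu.mono (le_max_left C C')) (hv.mono (le_max_right C C'))
    fun _ => hh

/-- The nonconstant part of `u` has coefficients at most ϖ, each multiplied by a positive power of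
an inner series of Gauss norm at most ρ < 1. -/
lemma norm_constantCoeff_comp_sub_lt (hS : IsComplete (S : Set E)) (hϖ : 0 < ϖ)
    {u h : PowerSeries E} (hu : BoundedOn S 1 ϖ u) (ht : 0 < t) (hρ : ρ < 1)
    (hh : BoundedOn S t ρ h) :
    ‖PowerSeries.constantCoeff (comp u h) - PowerSeries.constantCoeff u‖ < ϖ := by
  have hu' := boundedOn_powerSeries_iff.1 hu
  have hu₀ : PowerSeries.constantCoeff u ∈ S := by simpa using hu'.1 0
  have hu₁ : ‖PowerSeries.constantCoeff u‖ ≤ ϖ := hu.norm_constantCoeff_le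
  have hC : BoundedOn S 1 ϖ (PowerSeries.C (PowerSeries.constantCoeff u)) :=
    (boundedOn_C hu₀).mono hu₁
  have hv : BoundedOn S 1 ϖ (u - PowerSeries.C (PowerSeries.constantCoeff u)) :=
    hu.sub zero_le_one hC
  have hadd := comp_add_left hS ht hρ hv hC hh
  have hv₀ : MvPowerSeries.constantCoeff
      (u - PowerSeries.C (PowerSeries.constantCoeff u) : PowerSeries E) = 0 := by
    change PowerSeries.constantCoeff
      (u - PowerSeries.C (PowerSeries.constantCoeff u) : PowerSeries E) = 0
    simp
  have hcC : comp (PowerSeries.C (PowerSeries.constantCoeff u)) h =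
      PowerSeries.C (PowerSeries.constantCoeff u) := by
    rw [comp_eq_mvComp]
    have := mvComp_monomial (0 : Unit →₀ ℕ) (PowerSeries.constantCoeff u)
      fun _ => (h : MvPowerSeries Unit E)
    rw [Finsupp.prod_zero_index] at this
    refine this.trans ?_
    exact (PowerSeries.smul_eq_C_mul (1 : PowerSeries E) _).trans (mul_one _)
  rw [sub_add_cancel, hcC] at hadd
  rw [hadd, map_add, PowerSeries.constantCoeff_C, add_sub_cancel_right]
  have hs := hv.shrink hh.nonneg hρ.le
  rw [hv₀, norm_zero] at hs
  have hb := BoundedOn.mvComp hS ht hs fun _ : Unit => hh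
  rw [comp_eq_mvComp]
  refine hb.norm_constantCoeff_le.trans_lt (max_lt hϖ ?_)
  nlinarith

end Congruences

/-! ### The radius θ and the bounds for a Lubin–Tate group law. -/

section LogBounds

variable {p : ℕ} [Fact p.Prime] {M N : IntermediateField ℚ_[p] (PadicAlgCl p)} {π : integers M}
  {f : PowerSeries (integers M)} {θ : ℝ}

/-- The radius `θ = |π| ^ (1 / (q - 1))` of the disc on which the logarithm of a Lubin-Tate formal
group law for `π` is an isometry. -/
structure IsLogRadius (π : integers M) (θ : ℝ) : Prop where
  norm_le : ‖(π : PadicAlgCl p)‖ ≤ θ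
  lt_one : θ < 1
  pow_eq : θ ^ Nat.card (integers M ⧸ Ideal.span {π}) = θ * ‖(π : PadicAlgCl p)‖
  norm_lt_of_ne_two : Nat.card (integers M ⧸ Ideal.span {π}) ≠ 2 → ‖(π : PadicAlgCl p)‖ < θ

lemma IsLogRadius.pos (hπ : Irreducible π) (hθ : IsLogRadius π θ) : 0 < θ :=
  (norm_irreducible_pos hπ).trans_le hθ.norm_le

lemma exists_isLogRadius [FiniteDimensional ℚ_[p] M] (hπ : Irreducible π) :
    ∃ θ, IsLogRadius π θ := by
  obtain ⟨k, hk⟩ : ∃ k, Nat.card (integers M ⧸ Ideal.span {π}) = k + 2 :=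
    Nat.exists_eq_add_of_le' (two_le_natCard_quotient hπ)
  have h0 := norm_irreducible_pos hπ
  have h1 := norm_irreducible_lt_one hπ
  set ϖ := ‖(π : PadicAlgCl p)‖
  -- Here q = k + 2, so the exponent is 1/(q - 1). For k = 0 this gives θ = ϖ, hence the separate
  -- strict inequality for q ≠ 2.
  set θ := ϖ ^ ((k + 1 : ℕ) : ℝ)⁻¹
  have hpow : θ ^ (k + 1) = ϖ := Real.rpow_inv_natCast_pow h0.le (Nat.succ_ne_zero k)
  have hθ0 : 0 < θ := Real.rpow_pos_of_pos h0 _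
  have hθ1 : θ < 1 := by
    by_contra! h
    have := one_le_pow₀ h (n := k + 1)
    rw [hpow] at this
    linarith
  refine ⟨θ, ?_, hθ1, ?_, fun h => ?_⟩
  · change ϖ ≤ θ
    rw [← hpow, pow_succ]
    exact mul_le_of_le_one_left hθ0.le (pow_le_one₀ hθ0.le hθ1.le)
  · rw [hk, show k + 2 = (k + 1) + 1 from rfl, pow_succ, hpow, mul_comm]
  · change ϖ < θ
    rw [← hpow, pow_succ]
    exact mul_lt_of_lt_one_left hθ0 (pow_lt_one₀ hθ0.le hθ1 (by omega))

lemma coeff_one_ofIntegers (hf : IsLubinTateSeries π f) :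
    PowerSeries.coeff 1 (ofIntegers f) = (π : PadicAlgCl p) :=
  hf.coeff_one_map

/-- In degree q the term is at most θ^q = θ|π|, which is what fixes θ. In any other positive degree
the coefficient is divisible by π and θ^n ≤ θ. -/
lemma boundedOn_ofIntegers_lubinTateSeries (hMN : M ≤ N) (hπ : Irreducible π)
    (hf : IsLubinTateSeries π f) (hθ : IsLogRadius π θ) :
    BoundedOn N.toSubfield.toSubring θ (θ * ‖(π : PadicAlgCl p)‖) (ofIntegers f) := by
  have hθ0 := hθ.pos hπ
  have hb := boundedOn_powerSeries_iff.1 (boundedOn_ofIntegers hMN f)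
  rw [boundedOn_powerSeries_iff]
  refine ⟨hb.1, fun n => ?_⟩
  by_cases hn : n = Nat.card (integers M ⧸ Ideal.span {π})
  · subst hn
    have h := hb.2 (Nat.card (integers M ⧸ Ideal.span {π}))
    rw [one_pow, mul_one] at h
    rw [hθ.pow_eq]
    exact mul_le_of_le_one_left (by positivity) h
  · rcases n with _ | n
    · rw [PowerSeries.coeff_zero_eq_constantCoeff_apply, ofIntegers, hf.constantCoeff_map,
        norm_zero, zero_mul]
      positivity
    · have hdvd : π ∣ PowerSeries.coeff (n + 1) f := by
        obtain ⟨g, hg⟩ := hf.dvd_sub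
        rw [sub_eq_iff_eq_add] at hg
        rw [hg, map_add, PowerSeries.coeff_C_mul, PowerSeries.coeff_X_pow, if_neg hn, add_zero]
        exact dvd_mul_right _ _
      rw [dvd_integers_iff hπ.ne_zero] at hdvd
      rw [coeff_ofIntegers, mul_comm θ]
      refine mul_le_mul hdvd ?_ (by positivity) (norm_nonneg _)
      rw [pow_succ]
      exact mul_le_of_le_one_left hθ0.le (pow_le_one₀ hθ0.le hθ.lt_one.le)

lemma boundedOn_law (hMN : M ≤ N) : BoundedOn N.toSubfield.toSubring 1 1 (law f) := by
  refine ⟨fun d => ?_, fun d => ?_⟩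
  · rw [law, MvPowerSeries.coeff_map]
    exact hMN (MvPowerSeries.coeff d (groupLaw f)).2.1
  · rw [law, MvPowerSeries.coeff_map, one_pow, mul_one]
    exact norm_coe_le_one _

variable [FiniteDimensional ℚ_[p] M]

lemma isGroupLawOf_groupLaw_integers (hπ : Irreducible π) (hf : IsLubinTateSeries π f) :
    IsGroupLawOf f (groupLaw f) :=
  isGroupLawOf_groupLaw (integers M).subtype_injective (isLocalUniformizer hπ) hf

lemma isEndoOf_endo_integers (hπ : Irreducible π) (hf : IsLubinTateSeries π f) (a : integers M) :
    IsEndoOf f a (endo f a) :=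
  isEndoOf_endo (integers M).subtype_injective (isLocalUniformizer hπ) hf a

lemma constantCoeff_law (hπ : Irreducible π) (hf : IsLubinTateSeries π f) :
    MvPowerSeries.constantCoeff (law f) = 0 := by
  rw [law, MvPowerSeries.constantCoeff_map, (isGroupLawOf_groupLaw_integers hπ hf).constantCoeff_eq,
    map_zero]

lemma coeff_single_law (hπ : Irreducible π) (hf : IsLubinTateSeries π f) (i : Fin 2) :
    MvPowerSeries.coeff (Finsupp.single i 1) (law f) = 1 := by
  have h := isGroupLawOf_groupLaw_integers hπ hf
  rw [law, MvPowerSeries.coeff_map]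
  fin_cases i
  · exact (congrArg _ h.coeff_X_eq).trans (map_one _)
  · exact (congrArg _ h.coeff_Y_eq).trans (map_one _)

lemma constantCoeff_mulBy (hπ : Irreducible π) (hf : IsLubinTateSeries π f) (a : integers M) :
    PowerSeries.constantCoeff (mulBy f a) = 0 := by
  rw [← PowerSeries.coeff_zero_eq_constantCoeff_apply, mulBy, coeff_ofIntegers,
    PowerSeries.coeff_zero_eq_constantCoeff_apply, (isEndoOf_endo_integers hπ hf a).constantCoeff_eq]
  rfl

lemma coeff_one_mulBy (hπ : Irreducible π) (hf : IsLubinTateSeries π f) (a : integers M) :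
    PowerSeries.coeff 1 (mulBy f a) = (a : PadicAlgCl p) := by
  rw [mulBy, coeff_ofIntegers, (isEndoOf_endo_integers hπ hf a).coeff_one_eq]

lemma boundedOn_mulBy (hMN : M ≤ N) (hπ : Irreducible π) (hf : IsLubinTateSeries π f)
    (a : integers M) {ρ : ℝ} (hρ₀ : 0 ≤ ρ) (hρ : ρ ≤ 1) :
    BoundedOn N.toSubfield.toSubring ρ ρ (mulBy f a) :=
  (boundedOn_ofIntegers hMN _).self_of_le one_pos (constantCoeff_mulBy hπ hf a) hρ₀ hρ

lemma logSeries_law (hπ : Irreducible π) (hf : IsLubinTateSeries π f) :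
    logSeries (law f) = linearizer (ofIntegers f) := by
  have hL := hf.isLinearizer (integers M).subtype_injective (isLocalUniformizer hπ)
  exact logSeries_eq hL (constantCoeff_law hπ hf)
    (log_subst_groupLaw (integers M).subtype_injective (isLocalUniformizer hπ) hf hL)

lemma isLinearizer_logSeries (hπ : Irreducible π) (hf : IsLubinTateSeries π f) :
    IsLinearizer (ofIntegers f) (logSeries (law f)) (expSeries (law f)) := by
  have hL := hf.isLinearizer (integers M).subtype_injective (isLocalUniformizer hπ)
  rw [expSeries_eq (logSeries_law hπ hf) isUnit_coeff_one_linearizer, logSeries_law hπ hf]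
  exact hL

lemma boundedOn_logSeries (hMN : M ≤ N) (hπ : Irreducible π) (hf : IsLubinTateSeries π f)
    (hθ : IsLogRadius π θ) : BoundedOn N.toSubfield.toSubring θ θ (logSeries (law f)) := by
  rw [logSeries_law hπ hf]
  refine boundedOn_linearizer (hθ.pos hπ) (fun x hx => N.toSubfield.inv_mem hx) ?_ ?_ ?_
  · rw [coeff_one_ofIntegers hf]
    exact norm_irreducible_lt_one hπ
  · rw [coeff_one_ofIntegers hf]
    exact norm_pos_iff.1 (norm_irreducible_pos hπ)
  · rw [coeff_one_ofIntegers hf]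
    exact boundedOn_ofIntegers_lubinTateSeries hMN hπ hf hθ

lemma boundedOn_expSeries (hMN : M ≤ N) (hπ : Irreducible π) (hf : IsLubinTateSeries π f)
    (hθ : IsLogRadius π θ) : BoundedOn N.toSubfield.toSubring θ θ (expSeries (law f)) :=
  (isLinearizer_logSeries hπ hf).boundedOn_exp (hθ.pos hπ) (boundedOn_logSeries hMN hπ hf hθ)

lemma logSeries_subst_law (hπ : Irreducible π) (hf : IsLubinTateSeries π f) :
    (logSeries (law f)).subst (law f) =
      (logSeries (law f)).subst (MvPowerSeries.X 0 : MvPowerSeries (Fin 2) (PadicAlgCl p)) +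
      (logSeries (law f)).subst (MvPowerSeries.X 1 : MvPowerSeries (Fin 2) (PadicAlgCl p)) :=
  log_subst_groupLaw (integers M).subtype_injective (isLocalUniformizer hπ) hf
    (isLinearizer_logSeries hπ hf)

lemma logSeries_subst_mulBy (hπ : Irreducible π) (hf : IsLubinTateSeries π f) (a : integers M) :
    (logSeries (law f)).subst (mulBy f a) = (a : PadicAlgCl p) • logSeries (law f) :=
  log_subst_endo (integers M).subtype_injective (isLocalUniformizer hπ) hf
    (isLinearizer_logSeries hπ hf) a

end LogBounds

/-! ### Translation by a zero of f. -/

section Translates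

variable {p : ℕ} [Fact p.Prime] {M N : IntermediateField ℚ_[p] (PadicAlgCl p)} {π : integers M}
  {f : PowerSeries (integers M)} {u v c : PowerSeries (PadicAlgCl p)} {z : PadicAlgCl p} {t ϖ θ : ℝ}

lemma translate_smul (a : PadicAlgCl p) : translate f (a • u) z = a • translate f u z :=
  comp_smul _ _ _

variable [FiniteDimensional ℚ_[p] M] [FiniteDimensional ℚ_[p] N]

/-- For t < 1 the bound max(t, |z|) is less than 1, which is what makes r(X ⊕ z) converge although X
⊕ z has a constant term. -/
lemma boundedOn_formalAdd_X_C (hMN : M ≤ N) (hπ : Irreducible π) (hf : IsLubinTateSeries π f)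
    (hz : z ∈ N) (hz1 : ‖z‖ < 1) (ht : 0 < t) (ht1 : t ≤ 1) :
    BoundedOn N.toSubfield.toSubring t (max t ‖z‖)
      (formalAdd (law f) PowerSeries.X (PowerSeries.C z)) :=
  .formalAdd (isComplete_intermediateField N) (ht.le.trans (le_max_left _ _))
    (max_le ht1 hz1.le) (boundedOn_law hMN) (constantCoeff_law hπ hf) ht
    ((BoundedOn.X () ht.le).mono (le_max_left _ _)) ((boundedOn_C hz).mono (le_max_right _ _))

lemma max_half_lt_one (hz1 : ‖z‖ < 1) : max (1 / 2) ‖z‖ < 1 := max_lt (by norm_num) hz1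

lemma InDomain.translate (hMN : M ≤ N) (hπ : Irreducible π) (hf : IsLubinTateSeries π f)
    (hz : z ∈ N) (hz1 : ‖z‖ < 1) (hϖ : 0 < ϖ) (hϖθ : ϖ ≤ θ)
    (hu : InDomain N.toSubfield.toSubring ϖ θ u) :
    InDomain N.toSubfield.toSubring ϖ θ (translate f u z) := by
  refine hu.comp_right (isComplete_intermediateField N) hϖ hϖθ ?_ (by norm_num)
    (max_half_lt_one hz1)
    (boundedOn_formalAdd_X_C hMN hπ hf hz hz1 (by norm_num) (by norm_num))
  simpa [hz1.le] using boundedOn_formalAdd_X_C hMN hπ hf hz hz1 one_pos le_rfl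

lemma comp_translate (hMN : M ≤ N) (hπ : Irreducible π) (hf : IsLubinTateSeries π f)
    (hz : z ∈ N) (hz1 : ‖z‖ < 1) (hϖ : 0 < ϖ) (hϖθ : ϖ ≤ θ)
    (hc : BoundedOn N.toSubfield.toSubring θ θ c) (hu : InDomain N.toSubfield.toSubring ϖ θ u) :
    comp c (translate f u z) = translate f (comp c u) z :=
  comp_comp_right (isComplete_intermediateField N) hϖ hϖθ hc hu (by norm_num)
    (max_half_lt_one hz1)
    (boundedOn_formalAdd_X_C hMN hπ hf hz hz1 (by norm_num) (by norm_num))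

lemma translate_add (hMN : M ≤ N) (hπ : Irreducible π) (hf : IsLubinTateSeries π f)
    (hz : z ∈ N) (hz1 : ‖z‖ < 1) (hu : BoundedOn N.toSubfield.toSubring 1 ϖ u)
    (hv : BoundedOn N.toSubfield.toSubring 1 ϖ v) :
    translate f (u + v) z = translate f u z + translate f v z :=
  comp_add_left (isComplete_intermediateField N) (by norm_num) (max_half_lt_one hz1) hu hv
    (boundedOn_formalAdd_X_C hMN hπ hf hz hz1 (by norm_num) (by norm_num))

lemma boundedOn_translate (hMN : M ≤ N) (hπ : Irreducible π) (hf : IsLubinTateSeries π f)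
    (hz : z ∈ N) (hz1 : ‖z‖ < 1) (hu : BoundedOn N.toSubfield.toSubring 1 ϖ u) :
    BoundedOn N.toSubfield.toSubring 1 ϖ (translate f u z) := by
  rw [translate, comp_eq_mvComp]
  refine BoundedOn.mvComp (isComplete_intermediateField N) one_pos hu fun _ => ?_
  simpa [hz1.le] using boundedOn_formalAdd_X_C hMN hπ hf hz hz1 one_pos le_rfl

lemma norm_constantCoeff_translate_sub_lt (hMN : M ≤ N) (hπ : Irreducible π)
    (hf : IsLubinTateSeries π f) (hz : z ∈ N) (hz1 : ‖z‖ < 1) (hϖ : 0 < ϖ)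
    (hu : BoundedOn N.toSubfield.toSubring 1 ϖ u) :
    ‖PowerSeries.constantCoeff (translate f u z) - PowerSeries.constantCoeff u‖ < ϖ :=
  norm_constantCoeff_comp_sub_lt (isComplete_intermediateField N) hϖ hu (by norm_num)
    (max_half_lt_one hz1)
    (boundedOn_formalAdd_X_C hMN hπ hf hz hz1 (by norm_num) (by norm_num))

/-- The constant terms of the translates add up to a small element, as there are `q` of them. -/
lemma sum_constantCoeff_translate_mem (hMN : M ≤ N) (hπ : Irreducible π)
    (hf : IsLubinTateSeries π f) (hN : ∀ z ∈ zeros f, z ∈ N) (hϖ : 0 < ϖ)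
    (hu : BoundedOn N.toSubfield.toSubring 1 ϖ u) :
    ∑ z ∈ zeros f, PowerSeries.constantCoeff (translate f u z) ∈
      smallElements (PadicAlgCl p) ϖ hϖ := by
  have h1 : ∑ z ∈ zeros f,
      (PowerSeries.constantCoeff (translate f u z) - PowerSeries.constantCoeff u) ∈
        smallElements (PadicAlgCl p) ϖ hϖ := sum_mem fun z hz =>
    norm_constantCoeff_translate_sub_lt hMN hπ hf (hN z hz) (norm_lt_one_of_mem_zeros hz) hϖ hu
  rw [Finset.sum_sub_distrib, Finset.sum_const, card_zeros hπ hf] at h1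
  have h2 := (irreducible_dvd_iff hπ).1 (dvd_natCard_quotient hπ)
  rw [Subring.coe_natCast] at h2
  have h3 : ‖PowerSeries.constantCoeff u‖ ≤ ϖ := hu.norm_constantCoeff_le
  have h4 : Nat.card (integers M ⧸ Ideal.span {π}) • PowerSeries.constantCoeff u ∈
      smallElements (PadicAlgCl p) ϖ hϖ := by
    rw [mem_smallElements, nsmul_eq_mul, norm_mul]
    calc _ ≤ ‖((Nat.card (integers M ⧸ Ideal.span {π}) : ℕ) : PadicAlgCl p)‖ * ϖ := by gcongr
      _ < ϖ := mul_lt_of_lt_one_left hϖ h2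
  have h5 := add_mem h1 h4
  rwa [sub_add_cancel] at h5

end Translates

/-! ### Coleman's trace operator and substitution of [π_K]. -/

section TraceOperator

variable {p : ℕ} [Fact p.Prime] {L K N : IntermediateField ℚ_[p] (PadicAlgCl p)}
  {πL α : integers L} {fL : PowerSeries (integers L)} {πK : integers K}
  {fK : PowerSeries (integers K)} {g r s t : PowerSeries (PadicAlgCl p)} {θ ϖ : ℝ}

lemma integers_smul_def (a : integers L) (u : PowerSeries (PadicAlgCl p)) :
    a • u = (a : PadicAlgCl p) • u := rfl

lemma mem_divisibleSeries_iff (hLK : L ≤ K) (hπL : Irreducible πL) :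
    r ∈ divisibleSeries K πL ↔
      BoundedOn K.toSubfield.toSubring 1 ‖(πL : PadicAlgCl p)‖ r := by
  rw [boundedOn_powerSeries_iff]
  constructor
  · rintro ⟨s, rfl⟩
    refine ⟨fun n => ?_, fun n => ?_⟩
    · rw [integers_smul_def, PowerSeries.coeff_smul, coeff_ofIntegers]
      exact K.mul_mem (hLK πL.2.1) (PowerSeries.coeff n s).2.1
    · rw [integers_smul_def, PowerSeries.coeff_smul, coeff_ofIntegers, one_pow, mul_one,
        norm_smul]
      exact mul_le_of_le_one_right (norm_nonneg _) (norm_coe_le_one _)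
  · rintro ⟨h1, h2⟩
    have h0 := norm_irreducible_pos hπL
    have h0' := norm_pos_iff.1 h0
    refine ⟨PowerSeries.mk fun n => ⟨(πL : PadicAlgCl p)⁻¹ * PowerSeries.coeff n r,
      K.mul_mem (K.inv_mem (hLK πL.2.1)) (h1 n), ?_⟩, ?_⟩
    · have := h2 n
      rw [one_pow, mul_one] at this
      rw [norm_mul, norm_inv, inv_mul_le_iff₀ h0, mul_one]
      exact this
    · ext n
      rw [integers_smul_def, PowerSeries.coeff_smul, coeff_ofIntegers, PowerSeries.coeff_mk]
      exact (mul_inv_cancel_left₀ h0' _).symm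

lemma BoundedOn.exists_eq_ofIntegers (hr : BoundedOn K.toSubfield.toSubring 1 1 r) :
    ∃ s : PowerSeries (integers K), r = ofIntegers s := by
  rw [boundedOn_powerSeries_iff] at hr
  refine ⟨PowerSeries.mk fun n => ⟨PowerSeries.coeff n r, hr.1 n, by simpa using hr.2 n⟩, ?_⟩
  ext n
  rw [coeff_ofIntegers, PowerSeries.coeff_mk]

variable [FiniteDimensional ℚ_[p] K]

lemma isUnit_coeff_one_mulBy (hπK : Irreducible πK) (hfK : IsLubinTateSeries πK fK) :
    IsUnit (PowerSeries.coeff 1 (mulBy fK πK)) := by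
  rw [coeff_one_mulBy hπK hfK]
  exact (norm_pos_iff.1 (norm_irreducible_pos hπK)).isUnit

lemma subst_mulBy_subst_inv (hπK : Irreducible πK) (hfK : IsLubinTateSeries πK fK)
    (t : PowerSeries (PadicAlgCl p)) :
    PowerSeries.subst ((mulBy fK πK).substInvOfIsUnit (isUnit_coeff_one_mulBy hπK hfK))
      (t.subst (mulBy fK πK) : PowerSeries (PadicAlgCl p)) = t := by
  have h0 := constantCoeff_mulBy hπK hfK πK
  rw [PowerSeries.subst_comp_subst_apply (.of_constantCoeff_zero' h0)
    (.of_constantCoeff_zero' (by simp)), PowerSeries.subst_substInvOfIsUnit_right _ h0,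
    PowerSeries.X_subst]

lemma subst_inv_subst_mulBy (hπK : Irreducible πK) (hfK : IsLubinTateSeries πK fK)
    (t : PowerSeries (PadicAlgCl p)) :
    PowerSeries.subst (mulBy fK πK) (t.subst ((mulBy fK πK).substInvOfIsUnit
      (isUnit_coeff_one_mulBy hπK hfK)) : PowerSeries (PadicAlgCl p)) = t := by
  have h0 := constantCoeff_mulBy hπK hfK πK
  rw [PowerSeries.subst_comp_subst_apply (.of_constantCoeff_zero' (by simp))
    (.of_constantCoeff_zero' h0), PowerSeries.subst_substInvOfIsUnit_left _ h0,
    PowerSeries.X_subst]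

/-- The linear coefficient π_K of [π_K] is nonzero, so over a field substitution of [π_K] is
bijective: the chosen series exists and is unique. -/
lemma colemanTrace_eq_iff (hπK : Irreducible πK) (hfK : IsLubinTateSeries πK fK) :
    colemanTrace πK fK g = t ↔
      t.subst (mulBy fK πK) = ∑ z ∈ zeros fK, translate fK g z := by
  have hspec : (colemanTrace πK fK g).subst (mulBy fK πK) = ∑ z ∈ zeros fK, translate fK g z :=
    Classical.epsilon_spec
      (p := fun t : PowerSeries (PadicAlgCl p) => t.subst (mulBy fK πK) = ∑ z ∈ zeros fK, translate fK g z)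
      ⟨_, subst_inv_subst_mulBy hπK hfK _⟩
  refine ⟨fun h => h ▸ hspec, fun h => ?_⟩
  rw [← subst_mulBy_subst_inv hπK hfK t, h, ← hspec, subst_mulBy_subst_inv hπK hfK]

lemma smul_subst_mulBy (hπK : Irreducible πK) (hfK : IsLubinTateSeries πK fK) :
    (α • g).subst (mulBy fK πK) = (α : PadicAlgCl p) • g.subst (mulBy fK πK) := by
  have h0 := constantCoeff_mulBy hπK hfK πK
  rw [← comp_eq_subst h0, ← comp_eq_subst h0, integers_smul_def, comp_smul]

variable [FiniteDimensional ℚ_[p] N]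

lemma InDomain.subst_mulBy (hKN : K ≤ N) (hπK : Irreducible πK) (hfK : IsLubinTateSeries πK fK)
    (hϖ : 0 < ϖ) (hϖθ : ϖ ≤ θ) (hr : InDomain N.toSubfield.toSubring ϖ θ r) :
    InDomain N.toSubfield.toSubring ϖ θ (r.subst (mulBy fK πK)) := by
  rw [← comp_eq_subst (constantCoeff_mulBy hπK hfK πK)]
  exact hr.comp_right (isComplete_intermediateField N) hϖ hϖθ
    (boundedOn_mulBy hKN hπK hfK πK zero_le_one le_rfl) (by norm_num) (by norm_num)
    (boundedOn_mulBy hKN hπK hfK πK (ρ := 1 / 2) (by norm_num) (by norm_num))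

lemma comp_subst_mulBy (hKN : K ≤ N) (hπK : Irreducible πK) (hfK : IsLubinTateSeries πK fK)
    (hϖ : 0 < ϖ) (hϖθ : ϖ ≤ θ) {c : PowerSeries (PadicAlgCl p)}
    (hc : BoundedOn N.toSubfield.toSubring θ θ c) (hr : InDomain N.toSubfield.toSubring ϖ θ r) :
    comp c (r.subst (mulBy fK πK)) = (comp c r).subst (mulBy fK πK) := by
  have h0 := constantCoeff_mulBy hπK hfK πK
  rw [← comp_eq_subst h0, ← comp_eq_subst h0]
  exact comp_comp_right (isComplete_intermediateField N) hϖ hϖθ hc hr (by norm_num) (by norm_num)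
    (boundedOn_mulBy hKN hπK hfK πK (ρ := 1 / 2) (by norm_num) (by norm_num))

end TraceOperator

/-! ### The logarithm of F_L on its domain. -/

section Logarithm

variable {p : ℕ} [Fact p.Prime] {L N : IntermediateField ℚ_[p] (PadicAlgCl p)}
  {πL : integers L} {fL : PowerSeries (integers L)} {r s : PowerSeries (PadicAlgCl p)} {θ : ℝ}

lemma InDomain.mono_field {K : IntermediateField ℚ_[p] (PadicAlgCl p)} (hKN : K ≤ N) {ϖ : ℝ}
    (hr : InDomain K.toSubfield.toSubring ϖ θ r) : InDomain N.toSubfield.toSubring ϖ θ r :=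
  ⟨hr.bounded.mono_subring hKN, hr.norm_constantCoeff_lt⟩

variable [FiniteDimensional ℚ_[p] L] [FiniteDimensional ℚ_[p] N]

/-- The domain on which the logarithm is inverted by the exponential. -/
abbrev LogDomain (N : IntermediateField ℚ_[p] (PadicAlgCl p)) (πL : integers L) (θ : ℝ)
    (r : PowerSeries (PadicAlgCl p)) : Prop :=
  InDomain N.toSubfield.toSubring ‖(πL : PadicAlgCl p)‖ θ r

lemma LogDomain.comp_log (hLN : L ≤ N) (hπL : Irreducible πL) (hfL : IsLubinTateSeries πL fL)
    (hθ : IsLogRadius πL θ) (hr : LogDomain N πL θ r) :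
    LogDomain N πL θ (comp (logSeries (law fL)) r) :=
  hr.comp (isComplete_intermediateField N) (norm_irreducible_pos hπL) hθ.norm_le
    (boundedOn_logSeries hLN hπL hfL hθ) (isLinearizer_logSeries hπL hfL).constantCoeff_log

lemma LogDomain.comp_exp (hLN : L ≤ N) (hπL : Irreducible πL) (hfL : IsLubinTateSeries πL fL)
    (hθ : IsLogRadius πL θ) (hr : LogDomain N πL θ r) :
    LogDomain N πL θ (comp (expSeries (law fL)) r) :=
  hr.comp (isComplete_intermediateField N) (norm_irreducible_pos hπL) hθ.norm_le
    (boundedOn_expSeries hLN hπL hfL hθ) (isLinearizer_logSeries hπL hfL).constantCoeff_exp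

lemma LogDomain.exp_log (hLN : L ≤ N) (hπL : Irreducible πL) (hfL : IsLubinTateSeries πL fL)
    (hθ : IsLogRadius πL θ) (hr : LogDomain N πL θ r) :
    comp (expSeries (law fL)) (comp (logSeries (law fL)) r) = r := by
  have hL := isLinearizer_logSeries hπL hfL
  rw [comp_comp_of_inDomain (isComplete_intermediateField N) (norm_irreducible_pos hπL) hθ.norm_le
    (boundedOn_expSeries hLN hπL hfL hθ) (boundedOn_logSeries hLN hπL hfL hθ)
    hL.constantCoeff_log hr, hL.exp_subst_log, comp_X]

lemma LogDomain.log_exp (hLN : L ≤ N) (hπL : Irreducible πL) (hfL : IsLubinTateSeries πL fL)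
    (hθ : IsLogRadius πL θ) (hr : LogDomain N πL θ r) :
    comp (logSeries (law fL)) (comp (expSeries (law fL)) r) = r := by
  have hL := isLinearizer_logSeries hπL hfL
  rw [comp_comp_of_inDomain (isComplete_intermediateField N) (norm_irreducible_pos hπL) hθ.norm_le
    (boundedOn_logSeries hLN hπL hfL hθ) (boundedOn_expSeries hLN hπL hfL hθ)
    hL.constantCoeff_exp hr, hL.log_subst_exp, comp_X]

lemma LogDomain.log_injective (hLN : L ≤ N) (hπL : Irreducible πL)
    (hfL : IsLubinTateSeries πL fL) (hθ : IsLogRadius πL θ) (hr : LogDomain N πL θ r)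
    (hs : LogDomain N πL θ s)
    (h : comp (logSeries (law fL)) r = comp (logSeries (law fL)) s) : r = s := by
  rw [← hr.exp_log hLN hπL hfL hθ, h, hs.exp_log hLN hπL hfL hθ]

lemma LogDomain.formalAdd (hLN : L ≤ N) (hπL : Irreducible πL) (hfL : IsLubinTateSeries πL fL)
    (hθ : IsLogRadius πL θ) (hr : LogDomain N πL θ r) (hs : LogDomain N πL θ s) :
    LogDomain N πL θ (formalAdd (law fL) r s) :=
  InDomain.formalAdd (isComplete_intermediateField N) (norm_irreducible_pos hπL) hθ.norm_le
    hθ.lt_one.le (boundedOn_law hLN) (constantCoeff_law hπL hfL) hr hs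

lemma LogDomain.log_formalAdd (hLN : L ≤ N) (hπL : Irreducible πL)
    (hfL : IsLubinTateSeries πL fL) (hθ : IsLogRadius πL θ) (hr : LogDomain N πL θ r)
    (hs : LogDomain N πL θ s) :
    comp (logSeries (law fL)) (LubinTate.formalAdd (law fL) r s) =
      comp (logSeries (law fL)) r + comp (logSeries (law fL)) s :=
  comp_formalAdd (isComplete_intermediateField N) (norm_irreducible_pos hπL) hθ.norm_le
    hθ.lt_one.le (boundedOn_law hLN) (constantCoeff_law hπL hfL)
    (boundedOn_logSeries hLN hπL hfL hθ) (logSeries_subst_law hπL hfL) hr hs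

lemma LogDomain.comp_mulBy (hLN : L ≤ N) (hπL : Irreducible πL) (hfL : IsLubinTateSeries πL fL)
    (hθ : IsLogRadius πL θ) (hr : LogDomain N πL θ r) (a : integers L) :
    LogDomain N πL θ (comp (mulBy fL a) r) :=
  hr.comp (isComplete_intermediateField N) (norm_irreducible_pos hπL) hθ.norm_le
    (boundedOn_mulBy hLN hπL hfL a (hθ.pos hπL).le hθ.lt_one.le) (constantCoeff_mulBy hπL hfL a)

lemma LogDomain.log_mulBy (hLN : L ≤ N) (hπL : Irreducible πL) (hfL : IsLubinTateSeries πL fL)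
    (hθ : IsLogRadius πL θ) (hr : LogDomain N πL θ r) (a : integers L) :
    comp (logSeries (law fL)) (comp (mulBy fL a) r) =
      (a : PadicAlgCl p) • comp (logSeries (law fL)) r := by
  rw [comp_comp_of_inDomain (isComplete_intermediateField N) (norm_irreducible_pos hπL) hθ.norm_le
    (boundedOn_logSeries hLN hπL hfL hθ)
    (boundedOn_mulBy hLN hπL hfL a (hθ.pos hπL).le hθ.lt_one.le) (constantCoeff_mulBy hπL hfL a) hr,
    logSeries_subst_mulBy hπL hfL, comp_smul]

end Logarithm

/-! ### The norm equation and the trace equation. -/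

section Equivalence

variable {p : ℕ} [Fact p.Prime] {L K N : IntermediateField ℚ_[p] (PadicAlgCl p)}
  {πL α : integers L} {fL : PowerSeries (integers L)} {πK : integers K}
  {fK : PowerSeries (integers K)} {g r s : PowerSeries (PadicAlgCl p)} {θ : ℝ}

lemma norm_eq_one_of_not_dvd (hπL : Irreducible πL) (h : ¬ πL ∣ α) :
    ‖(α : PadicAlgCl p)‖ = 1 :=
  isUnit_integers_iff.1 ((isUnit_integers_iff_not_dvd hπL).2 h)

/-- The excluded case enters here. For q ≠ 2 one has ϖ < θ outright; for q = 2 the hypothesis makes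
α a unit, and the smallness obtained from the equation applies. -/
lemma norm_constantCoeff_lt_of_not_dvd_imp (hθ : IsLogRadius πL θ)
    (hq : ¬ (Nat.card (integers L ⧸ Ideal.span {πL}) = 2 ∧ πL ∣ α))
    (hr : BoundedOn K.toSubfield.toSubring 1 ‖(πL : PadicAlgCl p)‖ r)
    (h : ¬ πL ∣ α → ‖PowerSeries.constantCoeff r‖ < ‖(πL : PadicAlgCl p)‖) :
    ‖PowerSeries.constantCoeff r‖ < θ := by
  by_cases h2 : Nat.card (integers L ⧸ Ideal.span {πL}) = 2
  · exact (h fun hα => hq ⟨h2, hα⟩).trans_le hθ.norm_le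
  · exact hr.norm_constantCoeff_le.trans_lt (hθ.norm_lt_of_ne_two h2)

variable [FiniteDimensional ℚ_[p] K]

lemma constantCoeff_subst_mulBy (hπK : Irreducible πK) (hfK : IsLubinTateSeries πK fK) :
    PowerSeries.constantCoeff (r.subst (mulBy fK πK)) = PowerSeries.constantCoeff r := by
  have h := coeff_subst_eq_sum r (constantCoeff_mulBy hπK hfK πK) 0
  simpa using h

/-- If `α` is a unit then the trace equation makes the constant term small. -/
lemma norm_constantCoeff_lt_of_colemanTrace_eq (hπL : Irreducible πL) (hπK : Irreducible πK)
    (hfK : IsLubinTateSeries πK fK) (hα : ¬ πL ∣ α)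
    (hg : BoundedOn K.toSubfield.toSubring 1 ‖(πL : PadicAlgCl p)‖ g)
    (h : colemanTrace πK fK g = α • g) :
    ‖PowerSeries.constantCoeff g‖ < ‖(πL : PadicAlgCl p)‖ := by
  obtain ⟨N, _, hKN, hN⟩ := exists_finiteDimensional_extension K (zeros fK)
  have h1 := sum_constantCoeff_translate_mem hKN hπK hfK hN (norm_irreducible_pos hπL)
    (hg.mono_subring hKN)
  rw [colemanTrace_eq_iff hπK hfK, smul_subst_mulBy hπK hfK] at h
  rw [← map_sum, ← h, PowerSeries.smul_eq_C_mul, map_mul, PowerSeries.constantCoeff_C,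
    constantCoeff_subst_mulBy hπK hfK] at h1
  rwa [mem_smallElements, norm_mul, norm_eq_one_of_not_dvd hπL hα, one_mul] at h1

/-- Divisibility by π_L alone gives only |g(0)| ≤ ϖ; the eigenvalue equation supplies the rest when
ϖ = θ. -/
theorem mem_traceEigenspace_iff (hLK : L ≤ K) (hπL : Irreducible πL) (hθ : IsLogRadius πL θ)
    (hπK : Irreducible πK) (hfK : IsLubinTateSeries πK fK)
    (hq : ¬ (Nat.card (integers L ⧸ Ideal.span {πL}) = 2 ∧ πL ∣ α)) :
    g ∈ traceEigenspace πL πK fK α ↔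
      LogDomain K πL θ g ∧ colemanTrace πK fK g = α • g := by
  rw [traceEigenspace, Set.mem_ofPred_eq, mem_divisibleSeries_iff hLK hπL]
  constructor
  · rintro ⟨hg, h⟩
    exact ⟨⟨hg, norm_constantCoeff_lt_of_not_dvd_imp hθ hq hg fun hα =>
      norm_constantCoeff_lt_of_colemanTrace_eq hπL hπK hfK hα hg h⟩, h⟩
  · rintro ⟨hg, h⟩
    exact ⟨hg.bounded, h⟩

variable [FiniteDimensional ℚ_[p] L]

/-- The logarithm turns the norm equation into the trace equation. -/
theorem formalSum_translate_eq_iff (hLK : L ≤ K) (hπL : Irreducible πL)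
    (hfL : IsLubinTateSeries πL fL) (hθ : IsLogRadius πL θ) (hπK : Irreducible πK)
    (hfK : IsLubinTateSeries πK fK) (hr : LogDomain K πL θ r) :
    formalSum (law fL) ((zeros fK).toList.map (translate fK r)) =
      comp (mulBy fL α) (r.subst (mulBy fK πK)) ↔
    colemanTrace πK fK (comp (logSeries (law fL)) r) = α • comp (logSeries (law fL)) r := by
  obtain ⟨N, _, hKN, hN⟩ := exists_finiteDimensional_extension K (zeros fK)
  have hLN := hLK.trans hKN
  have hS := isComplete_intermediateField N
  have hϖ := norm_irreducible_pos hπL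
  have hr : LogDomain N πL θ r := hr.mono_field hKN
  have hlog := boundedOn_logSeries hLN hπL hfL hθ
  have hz : ∀ z ∈ zeros fK, LogDomain N πL θ (translate fK r z) := fun z hz =>
    hr.translate hKN hπK hfK (hN z hz) (norm_lt_one_of_mem_zeros hz) hϖ hθ.norm_le
  have hl : ∀ u ∈ (zeros fK).toList.map (translate fK r), LogDomain N πL θ u := by
    simpa [List.forall_mem_map] using hz
  have hm : LogDomain N πL θ (r.subst (mulBy fK πK)) :=
    hr.subst_mulBy hKN hπK hfK hϖ hθ.norm_le
  have hleft : comp (logSeries (law fL))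
      (formalSum (law fL) ((zeros fK).toList.map (translate fK r))) =
        ∑ z ∈ zeros fK, translate fK (comp (logSeries (law fL)) r) z := by
    rw [comp_formalSum hS hϖ hθ.norm_le hθ.lt_one.le (boundedOn_law hLN)
      (constantCoeff_law hπL hfL) hlog (isLinearizer_logSeries hπL hfL).constantCoeff_log
      (logSeries_subst_law hπL hfL) hl, List.map_map, Finset.sum_map_toList]
    exact Finset.sum_congr rfl fun z hz => comp_translate hKN hπK hfK (hN z hz)
      (norm_lt_one_of_mem_zeros hz) hϖ hθ.norm_le hlog hr
  -- On the right side log([α](r([π_K]))) = α (log r)([π_K]), the substituted form of the eigenvalue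
  -- α.
  have hright : comp (logSeries (law fL)) (comp (mulBy fL α) (r.subst (mulBy fK πK))) =
      (α • comp (logSeries (law fL)) r).subst (mulBy fK πK) := by
    rw [hm.log_mulBy hLN hπL hfL hθ, comp_subst_mulBy hKN hπK hfK hϖ hθ.norm_le hlog hr,
      smul_subst_mulBy hπK hfK]
  rw [colemanTrace_eq_iff hπK hfK, ← hleft, ← hright]
  refine ⟨fun h => by rw [h], fun h => ?_⟩
  -- Both sides of the norm equation lie in the domain where exp undoes log, so equality of
  -- logarithms is enough.
  exact (LogDomain.log_injective hLN hπL hfL hθ (hm.comp_mulBy hLN hπL hfL hθ α)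
    (InDomain.formalSum hS hϖ hθ.norm_le hθ.lt_one.le (boundedOn_law hLN)
      (constantCoeff_law hπL hfL) hl) h).symm

/-- If `α` is a unit then the norm equation makes the constant term small. -/
lemma norm_constantCoeff_lt_of_formalSum_eq (hLK : L ≤ K) (hπL : Irreducible πL)
    (hfL : IsLubinTateSeries πL fL) (hπK : Irreducible πK) (hfK : IsLubinTateSeries πK fK)
    (hα : ¬ πL ∣ α) (hr : BoundedOn K.toSubfield.toSubring 1 ‖(πL : PadicAlgCl p)‖ r)
    (h : formalSum (law fL) ((zeros fK).toList.map (translate fK r)) =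
      comp (mulBy fL α) (r.subst (mulBy fK πK))) :
    ‖PowerSeries.constantCoeff r‖ < ‖(πL : PadicAlgCl p)‖ := by
  obtain ⟨N, _, hKN, hN⟩ := exists_finiteDimensional_extension K (zeros fK)
  have hLN := hLK.trans hKN
  have hS := isComplete_intermediateField N
  have hϖ := norm_irreducible_pos hπL
  have hϖ1 := norm_irreducible_lt_one hπL
  have hr : BoundedOn N.toSubfield.toSubring 1 ‖(πL : PadicAlgCl p)‖ r := hr.mono_subring hKN
  have hl : ∀ u ∈ (zeros fK).toList.map (translate fK r),
      BoundedOn N.toSubfield.toSubring 1 ‖(πL : PadicAlgCl p)‖ u := by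
    rw [List.forall_mem_map]
    intro z hz
    rw [Finset.mem_toList] at hz
    exact boundedOn_translate hKN hπK hfK (hN z hz) (norm_lt_one_of_mem_zeros hz) hr
  have h1 := norm_constantCoeff_formalSum_sub_lt hS hϖ hϖ1 (boundedOn_law hLN)
    (constantCoeff_law hπL hfL) (coeff_single_law hπL hfL) hl
  rw [List.map_map, Finset.sum_map_toList] at h1
  have h2 := add_mem h1 (sum_constantCoeff_translate_mem hKN hπK hfK hN hϖ hr)
  have hb : BoundedOn N.toSubfield.toSubring 1 ‖(πL : PadicAlgCl p)‖ (r.subst (mulBy fK πK)) := by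
    rw [← comp_eq_subst (constantCoeff_mulBy hπK hfK πK), comp_eq_mvComp]
    exact BoundedOn.mvComp hS one_pos hr fun _ =>
      boundedOn_mulBy hKN hπK hfK πK zero_le_one le_rfl
  have h3 : _ ∈ smallElements (PadicAlgCl p) _ hϖ := norm_constantCoeff_comp_linear_sub_lt hS hϖ
    hϖ1 (boundedOn_mulBy hLN hπL hfL α zero_le_one le_rfl) (constantCoeff_mulBy hπL hfL α) hb
  -- The left side has small constant term by `h2`, and by `h3` the right side agrees with α r(0) up
  -- to a small element; the equation combines them into α r(0) small.
  have h4 := sub_mem h2 h3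
  rw [constantCoeff_subst_mulBy hπK hfK, coeff_one_mulBy hπL hfL, ← h] at h4
  simp only [Function.comp_def, sub_add_cancel, sub_sub_cancel] at h4
  rwa [mem_smallElements, norm_mul, norm_eq_one_of_not_dvd hπL hα, one_mul] at h4

/-- Together with `mem_traceEigenspace_iff` this describes both sides by the same trace equation on
the same domain, which log and exp preserve. -/
theorem mem_divisibleNormSeries_iff (hLK : L ≤ K) (hπL : Irreducible πL)
    (hfL : IsLubinTateSeries πL fL) (hθ : IsLogRadius πL θ)
    (hπK : Irreducible πK) (hfK : IsLubinTateSeries πK fK)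
    (hq : ¬ (Nat.card (integers L ⧸ Ideal.span {πL}) = 2 ∧ πL ∣ α)) :
    r ∈ divisibleNormSeries πL fL πK fK α ↔ LogDomain K πL θ r ∧
      colemanTrace πK fK (comp (logSeries (law fL)) r) = α • comp (logSeries (law fL)) r := by
  rw [divisibleNormSeries, Set.mem_inter_iff, mem_divisibleSeries_iff hLK hπL]
  constructor
  · rintro ⟨⟨-, -, h⟩, hr⟩
    have hd : LogDomain K πL θ r := ⟨hr, norm_constantCoeff_lt_of_not_dvd_imp hθ hq hr fun hα =>
      norm_constantCoeff_lt_of_formalSum_eq hLK hπL hfL hπK hfK hα hr h⟩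
    exact ⟨hd, (formalSum_translate_eq_iff hLK hπL hfL hθ hπK hfK hd).1 h⟩
  · rintro ⟨hr, h⟩
    exact ⟨⟨(hr.bounded.mono (norm_coe_le_one _)).exists_eq_ofIntegers,
      hr.norm_constantCoeff_lt.trans hθ.lt_one,
      (formalSum_translate_eq_iff hLK hπL hfL hθ hπK hfK hr).2 h⟩, hr.bounded⟩

end Equivalence

/-! ### The eigenspace as a submodule and the logarithm as a bijection. -/

section Isomorphism

variable {p : ℕ} [Fact p.Prime] {L K : IntermediateField ℚ_[p] (PadicAlgCl p)}
  {πL α : integers L} {fL : PowerSeries (integers L)} {πK : integers K}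
  {fK : PowerSeries (integers K)} {θ : ℝ}
  [FiniteDimensional ℚ_[p] K]

lemma add_mem_traceEigenspace (hLK : L ≤ K) (hπL : Irreducible πL) (hπK : Irreducible πK)
    (hfK : IsLubinTateSeries πK fK) {g h : PowerSeries (PadicAlgCl p)}
    (hg : g ∈ traceEigenspace πL πK fK α) (hh : h ∈ traceEigenspace πL πK fK α) :
    g + h ∈ traceEigenspace πL πK fK α := by
  obtain ⟨N, _, hKN, hN⟩ := exists_finiteDimensional_extension K (zeros fK)
  rw [traceEigenspace, Set.mem_ofPred_eq, mem_divisibleSeries_iff hLK hπL,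
    colemanTrace_eq_iff hπK hfK, smul_subst_mulBy hπK hfK] at *
  refine ⟨hg.1.add zero_le_one hh.1, ?_⟩
  have h0 := constantCoeff_mulBy hπK hfK πK
  have hsubst : (g + h).subst (mulBy fK πK) =
      (g.subst (mulBy fK πK) + h.subst (mulBy fK πK) : PowerSeries (PadicAlgCl p)) :=
    PowerSeries.subst_add (.of_constantCoeff_zero' h0) _ _
  rw [hsubst, smul_add, hg.2, hh.2, ← Finset.sum_add_distrib]
  exact Finset.sum_congr rfl fun z hz => (translate_add hKN hπK hfK (hN z hz)
    (norm_lt_one_of_mem_zeros hz) (hg.1.mono_subring hKN) (hh.1.mono_subring hKN)).symm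

lemma smul_mem_traceEigenspace (hLK : L ≤ K) (hπL : Irreducible πL) (hπK : Irreducible πK)
    (hfK : IsLubinTateSeries πK fK) (a : integers L) {g : PowerSeries (PadicAlgCl p)}
    (hg : g ∈ traceEigenspace πL πK fK α) : a • g ∈ traceEigenspace πL πK fK α := by
  rw [traceEigenspace, Set.mem_ofPred_eq, mem_divisibleSeries_iff hLK hπL,
    colemanTrace_eq_iff hπK hfK, smul_subst_mulBy hπK hfK] at *
  refine ⟨?_, ?_⟩
  · have h := boundedOn_powerSeries_iff.1 hg.1
    rw [boundedOn_powerSeries_iff]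
    refine ⟨fun n => ?_, fun n => ?_⟩
    · rw [integers_smul_def, PowerSeries.coeff_smul]
      exact K.mul_mem (hLK a.2.1) (h.1 n)
    · rw [integers_smul_def, PowerSeries.coeff_smul, norm_smul, mul_assoc]
      exact (mul_le_of_le_one_left (by positivity) (norm_coe_le_one a)).trans (h.2 n)
  · rw [smul_subst_mulBy hπK hfK, smul_comm, hg.2, Finset.smul_sum]
    exact Finset.sum_congr rfl fun z _ => (translate_smul _).symm

/-- The eigenspace of Coleman's trace operator, as a submodule. -/
def traceSubmodule (hLK : L ≤ K) (hπL : Irreducible πL) (hπK : Irreducible πK)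
    (hfK : IsLubinTateSeries πK fK) (α : integers L) :
    Submodule (integers L) (PowerSeries (PadicAlgCl p)) where
  carrier := traceEigenspace πL πK fK α
  add_mem' := add_mem_traceEigenspace hLK hπL hπK hfK
  zero_mem' := by
    rw [traceEigenspace, Set.mem_ofPred_eq, mem_divisibleSeries_iff hLK hπL,
      colemanTrace_eq_iff hπK hfK, smul_subst_mulBy hπK hfK]
    refine ⟨.zero (norm_nonneg _), ?_⟩
    have hz : ∀ z, translate fK 0 z = 0 := fun z => by
      have := translate_smul (f := fK) (u := 0) (z := z) 0
      rwa [smul_zero, zero_smul] at this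
    have h0 := comp_smul (0 : PadicAlgCl p) 0 (mulBy fK πK)
    rw [smul_zero, zero_smul, comp_eq_subst (constantCoeff_mulBy hπK hfK πK)] at h0
    rw [h0, smul_zero, Finset.sum_congr rfl fun z _ => hz z, Finset.sum_const_zero]
  smul_mem' := smul_mem_traceEigenspace hLK hπL hπK hfK

variable [FiniteDimensional ℚ_[p] L]

/-- The bijection given by the logarithm, with inverse given by the exponential. -/
def logEquiv (hLK : L ≤ K) (hπL : Irreducible πL) (hfL : IsLubinTateSeries πL fL)
    (hθ : IsLogRadius πL θ) (hπK : Irreducible πK) (hfK : IsLubinTateSeries πK fK)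
    (hq : ¬ (Nat.card (integers L ⧸ Ideal.span {πL}) = 2 ∧ πL ∣ α)) :
    divisibleNormSeries πL fL πK fK α ≃ traceSubmodule hLK hπL hπK hfK α where
  toFun r := ⟨comp (logSeries (law fL)) r, by
    have h := (mem_divisibleNormSeries_iff hLK hπL hfL hθ hπK hfK hq).1 r.2
    exact (mem_traceEigenspace_iff hLK hπL hθ hπK hfK hq).2
      ⟨h.1.comp_log hLK hπL hfL hθ, h.2⟩⟩
  invFun g := ⟨comp (expSeries (law fL)) g, by
    have h := (mem_traceEigenspace_iff hLK hπL hθ hπK hfK hq).1 g.2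
    refine (mem_divisibleNormSeries_iff hLK hπL hfL hθ hπK hfK hq).2
      ⟨h.1.comp_exp hLK hπL hfL hθ, ?_⟩
    rw [h.1.log_exp hLK hπL hfL hθ]
    exact h.2⟩
  left_inv r := Subtype.ext
    (((mem_divisibleNormSeries_iff hLK hπL hfL hθ hπK hfK hq).1 r.2).1.exp_log hLK hπL hfL hθ)
  right_inv g := Subtype.ext
    (((mem_traceEigenspace_iff hLK hπL hθ hπK hfK hq).1 g.2).1.log_exp hLK hπL hfL hθ)

end Isomorphism

end LubinTate

end

theorem theorem2p0p3 {p : ℕ} [Fact p.Prime]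
    (L K : IntermediateField ℚ_[p] (PadicAlgCl p))
    [FiniteDimensional ℚ_[p] L] [FiniteDimensional ℚ_[p] K] (hLK : L ≤ K)
    (πL : LubinTate.integers L) (hπL : Irreducible πL)
    (fL : PowerSeries (LubinTate.integers L)) (hfL : LubinTate.IsLubinTateSeries πL fL)
    (πK : LubinTate.integers K) (hπK : Irreducible πK)
    (fK : PowerSeries (LubinTate.integers K)) (hfK : LubinTate.IsLubinTateSeries πK fK)
    (α : LubinTate.integers L)
    -- the case of a residue field with two elements and `α` divisible by `π_L` is excluded
    (hq : ¬ (Nat.card (LubinTate.integers L ⧸ Ideal.span {πL}) = 2 ∧ πL ∣ α)) :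
    -- `A` is an `𝒪_L`-module under the formal group law of `fL`, `E` under the usual operations
    ∃ (_ : AddCommGroup (LubinTate.divisibleNormSeries πL fL πK fK α))
      (_ : Module (LubinTate.integers L) (LubinTate.divisibleNormSeries πL fL πK fK α))
      (E : Submodule (LubinTate.integers L) (PowerSeries (PadicAlgCl p)))
      (e : LubinTate.divisibleNormSeries πL fL πK fK α ≃ₗ[LubinTate.integers L] E),
      (∀ r s : LubinTate.divisibleNormSeries πL fL πK fK α,
        ((r + s : LubinTate.divisibleNormSeries πL fL πK fK α) : PowerSeries (PadicAlgCl p)) =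
          LubinTate.formalAdd (LubinTate.law fL) r s) ∧
      (∀ (a : LubinTate.integers L) (r : LubinTate.divisibleNormSeries πL fL πK fK α),
        ((a • r : LubinTate.divisibleNormSeries πL fL πK fK α) : PowerSeries (PadicAlgCl p)) =
          LubinTate.comp (LubinTate.mulBy fL a) r) ∧
      (E : Set (PowerSeries (PadicAlgCl p))) = LubinTate.traceEigenspace πL πK fK α ∧
      (∀ r : LubinTate.divisibleNormSeries πL fL πK fK α,
        LubinTate.Composable (LubinTate.logSeries (LubinTate.law fL)) r ∧
        (e r : PowerSeries (PadicAlgCl p)) =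
          LubinTate.comp (LubinTate.logSeries (LubinTate.law fL)) r) ∧
      (∀ g : E,
        LubinTate.Composable (LubinTate.expSeries (LubinTate.law fL)) (g : PowerSeries _) ∧
        (e.symm g : PowerSeries (PadicAlgCl p)) =
          LubinTate.comp (LubinTate.expSeries (LubinTate.law fL)) (g : PowerSeries _)) := by
  obtain ⟨θ, hθ⟩ := LubinTate.exists_isLogRadius hπL
  have hS := LubinTate.isComplete_intermediateField K
  have hϖ := LubinTate.norm_irreducible_pos hπL
  let ε := LubinTate.logEquiv hLK hπL hfL hθ hπK hfK hq
  -- The module structure is transported from the eigenspace, so the module axioms need no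
  -- associativity or distributivity of ⊕_L; only the formulas for the operations remain to be
  -- checked.
  let := ε.addCommGroup
  let := ε.module (LubinTate.integers L)
  have hdom : ∀ r : LubinTate.divisibleNormSeries πL fL πK fK α, LubinTate.LogDomain K πL θ r :=
    fun r => ((LubinTate.mem_divisibleNormSeries_iff hLK hπL hfL hθ hπK hfK hq).1 r.2).1
  have hlog : ∀ r : LubinTate.divisibleNormSeries πL fL πK fK α,
      (ε r : PowerSeries (PadicAlgCl p)) =
        LubinTate.comp (LubinTate.logSeries (LubinTate.law fL)) r := fun _ => rfl
  refine ⟨inferInstance, inferInstance, LubinTate.traceSubmodule hLK hπL hπK hfK α,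
    ε.linearEquiv (LubinTate.integers L), fun r s => ?_, fun a r => ?_, rfl, fun r => ?_,
    fun g => ?_⟩
  -- The transported sum and r ⊕_L s have the same logarithm, and both lie in its domain of
  -- injectivity. Scalars are treated in the same way.
  · refine (hdom (r + s)).log_injective hLK hπL hfL hθ
      ((hdom r).formalAdd hLK hπL hfL hθ (hdom s)) ?_
    rw [(hdom r).log_formalAdd hLK hπL hfL hθ (hdom s), ← hlog, ← hlog, ← hlog, Equiv.add_def,
      Equiv.apply_symm_apply]
    rfl
  · refine (hdom (a • r)).log_injective hLK hπL hfL hθ ((hdom r).comp_mulBy hLK hπL hfL hθ a) ?_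
    rw [(hdom r).log_mulBy hLK hπL hfL hθ, ← hlog, ← hlog, Equiv.smul_def,
      Equiv.apply_symm_apply]
    rfl
  · exact ⟨(hdom r).composable hS hϖ hθ.norm_le
      (LubinTate.boundedOn_logSeries hLK hπL hfL hθ), rfl⟩
  · exact ⟨((LubinTate.mem_traceEigenspace_iff hLK hπL hθ hπK hfK hq).1 g.2).1.composable hS hϖ
      hθ.norm_le (LubinTate.boundedOn_expSeries hLK hπL hfL hθ), rfl⟩
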